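/- Let $H$ and $U$ be (real or complex) Hilbert spaces, let $(S(t))_{t\in\mathbb R}$ be a strongly continuous group of bounded operators on $H$ with infinitesimal generator $(A,D(A))$, let $D(A^*)$ carry the scalar product $\langle z_1,z_2\rangle+\langle A^*z_1,A^*z_2\rangle$, let $D(A^*)'$ be its dual with pivot space $H$, and let $B\in\mathcal L(U,D(A^*)')$, with $B^*\in\mathcal L(D(A^*),U)$. Assume that $B$ is admissible: for all $T>0$ and $u\in L^2((0,T);U)$, the function $t\mapsto\int_0^tS(t-s)Bu(s)\,ds$ belongs to $C([0,T];H)$. Weak solutions of $y'=Ay+Bu$, $y(0)=y_0$ on $(0,T)$ are functions $y\in C([0,T];H)$ with $y(0)=y_0$ and $\frac{d}{dt}\langle y,\varphi\rangle=\langle y,A^*\varphi\rangle+\langle u,B^*\varphi\rangle$ in the sense of distributions on $(0,T)$ for all $\varphi\in D(A^*)$. Similarly, weak solutions of $z'=-A^*z+g$ with $g\in L^1((0,T);H)$ are functions $z\in C([0,T];H)$ with $\frac{d}{dt}\langle z,\varphi\rangle=-\langle z,A\varphi\rangle+\langle g,\varphi\rangle$ for all $\varphi\in D(A)$; for such $z$,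 $B^*z\in L^2((0,T);U)$ is defined by density with respect to the data $(z(0),g)\in H\times L^1((0,T);H)$, starting from $z(0)\in D(A^*)$ and $g\in C([0,T];D(A^*))$. Proposition. Assume that $y'=Ay+Bu$ is exactly controllable in some time $T>0$, i.e., for all $y_0,y_1\in H$ there is $u\in L^2((0,T);U)$ whose weak solution with $y(0)=y_0$ satisfies $y(T)=y_1$. Then the system is rapidly stabilizable by static feedback in the trajectory sense: for every $\lambda>0$ there exist a symmetric, coercive, invertible $Q\in\mathcal L(H)$, a symmetric non-negative $R\in\mathcal L(H)$ and a symmetric non-negative $W\in\mathcal L(U)$ with $$\langle Qx,A^*y\rangle+\langle A^*x,Qy\rangle-\langle WB^*x,B^*y\rangle+\langle RQx,Qy\rangle+2\lambda\langle Qx,y\rangle=0\qquad\text{for all }x,y\in D(A^*),$$ and a constant $C>0$ such that, for every $y_0\in H$, the system $$y'=Ay-BWB^*\tilde y,\qquad \tilde y'=-A^*\tilde y-2\lambda\tilde y-RQ\tilde y,\qquad y(0)=y_0,\quad \tilde y(0)=Q^{-1}y_0$$ has a weak solution $(y,\tilde y)$ on $[0,\infty)$, which is the unique weak solution in $C([0,T];H)^2$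 on $[0,T]$ for every $T>0$, and which satisfies, for all $t\ge0$, $$\tilde y(t)=Q^{-1}y(t)\qquad\text{and}\qquad \|y(t)\|\le Ce^{-\lambda t}\|y_0\|.$$ Thus $y$ is the trajectory of the system for the static feedback control "$u=-WB^*Q^{-1}y$", where the meaning of $B^*Q^{-1}y$ is $B^*\tilde y$. -/

import Mathlib

open Set Filter Topology MeasureTheory
open scoped ContDiff

noncomputable section

/-- A strongly continuous group `(S(t))_{t ∈ ℝ}` of bounded linear operators on `H`. -/
structure C0Group (𝕜 H : Type*) [RCLike 𝕜] [NormedAddCommGroup H] [InnerProductSpace 𝕜 H] where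
  toFun : ℝ → H →L[𝕜] H
  map_zero' : toFun 0 = ContinuousLinearMap.id 𝕜 H
  map_add' : ∀ s t : ℝ, toFun (s + t) = (toFun s).comp (toFun t)
  tendsto_zero' : ∀ x : H, Tendsto (fun t => toFun t x) (𝓝 0) (𝓝 x)

namespace C0Group

variable {𝕜 H : Type*} [RCLike 𝕜] [NormedAddCommGroup H] [InnerProductSpace 𝕜 H]

instance : CoeFun (C0Group 𝕜 H) (fun _ => ℝ → H →L[𝕜] H) := ⟨C0Group.toFun⟩

theorem apply_zero (S : C0Group 𝕜 H) (x : H) : S 0 x = x := by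
  rw [S.map_zero']; rfl

theorem apply_add (S : C0Group 𝕜 H) (s t : ℝ) (x : H) : S (s + t) x = S s (S t x) := by
  rw [S.map_add']; rfl

theorem apply_comm (S : C0Group 𝕜 H) (s t : ℝ) (x : H) : S s (S t x) = S t (S s x) := by
  rw [← S.apply_add, ← S.apply_add, add_comm]

theorem continuous_apply (S : C0Group 𝕜 H) (x : H) : Continuous (fun t => S t x) := by
  rw [continuous_iff_continuousAt]
  intro a
  have h1 : Tendsto (fun t : ℝ => t - a) (𝓝 a) (𝓝 0) := by
    have : Tendsto (fun t : ℝ => t - a) (𝓝 a) (𝓝 (a - a)) :=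
      (continuous_id.sub continuous_const).tendsto a
    simpa using this
  have h2 := ((S a).continuous.tendsto x).comp ((S.tendsto_zero' x).comp h1)
  refine h2.congr fun t => ?_
  simp only [Function.comp_apply]
  rw [← S.apply_add, add_sub_cancel]

/-- The infinitesimal generator `(A, D(A))` of the group: `D(A)` consists of the `x` for which
`(S(h)x - x)/h` converges in `H` as `h → 0`, and `A x` is the limit. -/
def generator (S : C0Group 𝕜 H) : H →ₗ.[𝕜] H where
  domain :=
    { carrier := {x | ∃ y, Tendsto (fun h : ℝ => ((h : 𝕜)⁻¹) • (S h x - x)) (𝓝[≠] 0) (𝓝 y)}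
      zero_mem' := ⟨0, by simp⟩
      add_mem' := by
        rintro a b ⟨y, hy⟩ ⟨z, hz⟩
        refine ⟨y + z, (hy.add hz).congr fun h => ?_⟩
        rw [← smul_add, map_add]
        congr 1
        abel
      smul_mem' := by
        rintro c a ⟨y, hy⟩
        refine ⟨c • y, (hy.const_smul c).congr fun h => ?_⟩
        rw [smul_comm, smul_sub, map_smul] }
  toFun :=
    { toFun := fun x => Classical.choose x.2
      map_add' := by
        intro a b
        refine tendsto_nhds_unique (Classical.choose_spec (a + b).2) ?_
        refine ((Classical.choose_spec a.2).add (Classical.choose_spec b.2)).congr fun h => ?_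
        rw [← smul_add, Submodule.coe_add, map_add]
        congr 1
        abel
      map_smul' := by
        intro c a
        refine tendsto_nhds_unique (Classical.choose_spec (c • a).2) ?_
        refine ((Classical.choose_spec a.2).const_smul c).congr fun h => ?_
        rw [smul_comm, smul_sub, Submodule.coe_smul, map_smul] }

theorem mem_generator_domain (S : C0Group 𝕜 H) (x : H) :
    x ∈ S.generator.domain ↔
      ∃ y, Tendsto (fun h : ℝ => ((h : 𝕜)⁻¹) • (S h x - x)) (𝓝[≠] 0) (𝓝 y) :=
  Iff.rfl

theorem tendsto_generator (S : C0Group 𝕜 H) (x : S.generator.domain) :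
    Tendsto (fun h : ℝ => ((h : 𝕜)⁻¹) • (S h (x : H) - x)) (𝓝[≠] 0) (𝓝 (S.generator x)) :=
  Classical.choose_spec x.2

theorem apply_generator_tendsto (S : C0Group 𝕜 H) (t : ℝ) (x : S.generator.domain) :
    Tendsto (fun h : ℝ => ((h : 𝕜)⁻¹) • (S h (S t (x : H)) - S t (x : H))) (𝓝[≠] 0)
      (𝓝 (S t (S.generator x))) := by
  refine (((S t).continuous.tendsto _).comp (S.tendsto_generator x)).congr fun h => ?_
  simp only [Function.comp_apply]
  rw [map_smul, map_sub, S.apply_comm]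

/-- `S(t)` maps `D(A)` into itself and commutes with `A` there. -/
theorem apply_mem_domain (S : C0Group 𝕜 H) (t : ℝ) (x : S.generator.domain) :
    S t (x : H) ∈ S.generator.domain :=
  ⟨_, S.apply_generator_tendsto t x⟩

theorem generator_apply (S : C0Group 𝕜 H) (t : ℝ) (x : S.generator.domain) :
    S.generator ⟨S t (x : H), S.apply_mem_domain t x⟩ = S t (S.generator x) :=
  tendsto_nhds_unique (S.tendsto_generator ⟨S t (x : H), S.apply_mem_domain t x⟩)
    (S.apply_generator_tendsto t x)

/-- The generator is densely defined, so that its adjoint is the usual one. -/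
theorem dense_generator_domain [CompleteSpace H] (S : C0Group 𝕜 H) :
    Dense (S.generator.domain : Set H) := by
  let _ : NormedSpace ℝ H := NormedSpace.restrictScalars ℝ 𝕜 H
  have _ : IsScalarTower ℝ 𝕜 H := RestrictScalars.isScalarTower ℝ 𝕜 H
  have hint : ∀ (x : H) (a b : ℝ), IntervalIntegrable (fun s => S s x) volume a b :=
    fun x a b => (S.continuous_apply x).intervalIntegrable a b
  have key : ∀ (x : H) (a : ℝ), (∫ s in (0:ℝ)..a, S s x) ∈ S.generator.domain := by
    intro x a
    rw [mem_generator_domain]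
    refine ⟨S a x - x, ?_⟩
    have hd : HasDerivAt (fun h : ℝ => ∫ s in h..(a + h), S s x) (S a x - x) 0 := by
      have h1 : HasDerivAt (fun h : ℝ => ∫ s in (0:ℝ)..(a + h), S s x) (S a x) 0 := by
        have h := intervalIntegral.integral_hasDerivAt_right (hint x 0 (a + 0))
          ((S.continuous_apply x).stronglyMeasurableAtFilter _ _)
          (S.continuous_apply x).continuousAt
        have h' := HasDerivAt.comp_const_add a 0 h
        simpa using h'
      have h2 : HasDerivAt (fun h : ℝ => ∫ s in (0:ℝ)..h, S s x) x 0 := by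
        have h := intervalIntegral.integral_hasDerivAt_right (hint x 0 0)
          ((S.continuous_apply x).stronglyMeasurableAtFilter _ _)
          (S.continuous_apply x).continuousAt
        simpa [S.apply_zero] using h
      refine (h1.sub h2).congr_of_eventuallyEq (Eventually.of_forall fun h => ?_)
      simp only [Pi.sub_apply]
      rw [intervalIntegral.integral_interval_sub_left (hint x _ _) (hint x _ _)]
    have hs := hd.tendsto_slope
    refine hs.congr fun h => ?_
    rw [slope_def_module, sub_zero]
    have e : S h (∫ s in (0:ℝ)..a, S s x) = ∫ s in h..(a + h), S s x := by
      rw [← ContinuousLinearMap.intervalIntegral_comp_comm (S h) (hint x 0 a)]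
      have := intervalIntegral.integral_comp_add_right (a := 0) (b := a) (fun s => S s x) h
      rw [zero_add] at this
      rw [← this]
      refine intervalIntegral.integral_congr fun s _ => ?_
      rw [← S.apply_add, add_comm]
    rw [e, add_zero, ← RCLike.ofReal_inv, ← algebraMap_smul 𝕜 (h⁻¹)]
  intro x
  have hd : HasDerivAt (fun h : ℝ => ∫ s in (0:ℝ)..h, S s x) x 0 := by
    have h := intervalIntegral.integral_hasDerivAt_right (hint x 0 0)
      ((S.continuous_apply x).stronglyMeasurableAtFilter _ _)
      (S.continuous_apply x).continuousAt
    simpa [S.apply_zero] using h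
  have hs := hd.tendsto_slope
  refine mem_closure_of_tendsto hs (Eventually.of_forall fun h => ?_)
  rw [slope_def_module, intervalIntegral.integral_same, sub_zero, sub_zero,
    ← algebraMap_smul 𝕜 h⁻¹]
  exact S.generator.domain.smul_mem _ (key x h)

variable [CompleteSpace H]

/-- The domain `D(A*)` of the adjoint of the generator with the scalar product
`⟨z₁, z₂⟩ + ⟨A* z₁, A* z₂⟩`, realised as the graph of `A*` in the Hilbert sum `H ⊕ H`: its elements
are the pairs `(z, A* z)` with `z ∈ D(A*)`. -/
def DAdj (S : C0Group 𝕜 H) : Submodule 𝕜 (WithLp 2 (H × H)) :=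
  S.generator.adjoint.graph.comap (WithLp.linearEquiv 2 𝕜 (H × H)).toLinearMap

/-- The inclusion `D(A*) → H`. -/
def incl (S : C0Group 𝕜 H) (φ : S.DAdj) : H := φ.1.fst

/-- The operator `A* : D(A*) → H`. -/
def Astar (S : C0Group 𝕜 H) (φ : S.DAdj) : H := φ.1.snd

theorem mem_DAdj_iff (S : C0Group 𝕜 H) (p : WithLp 2 (H × H)) :
    p ∈ S.DAdj ↔ ∀ x : S.generator.domain,
      inner 𝕜 p.fst (S.generator x) = inner 𝕜 p.snd (x : H) := by
  have h1 : p ∈ S.DAdj ↔ (p.fst, p.snd) ∈ S.generator.adjoint.graph := Iff.rfl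
  rw [h1, LinearPMap.mem_graph_iff]
  constructor
  · rintro ⟨y, hy1, hy2⟩ x
    have := S.generator.adjoint_isFormalAdjoint S.dense_generator_domain y x
    simp only at hy1 hy2
    rw [← hy1, ← hy2, this]
  · intro h
    have hm : p.fst ∈ S.generator.adjoint.domain :=
      LinearPMap.mem_adjoint_domain_of_exists _ ⟨p.snd, fun x => (h x).symm⟩
    exact ⟨⟨p.fst, hm⟩, rfl,
      LinearPMap.adjoint_apply_eq S.dense_generator_domain _ fun x => (h x).symm⟩

/-- The operator `S(t)*` on `D(A*)`, which it maps into itself. -/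
def adjApply (S : C0Group 𝕜 H) (t : ℝ) (φ : S.DAdj) : S.DAdj :=
  ⟨WithLp.toLp 2 ((S t).adjoint (S.incl φ), (S t).adjoint (S.Astar φ)), by
    rw [mem_DAdj_iff]
    intro x
    have h := (S.mem_DAdj_iff φ.1).1 φ.2 ⟨S t (x : H), S.apply_mem_domain t x⟩
    rw [S.generator_apply] at h
    change inner 𝕜 ((S t).adjoint φ.1.fst) (S.generator x)
      = inner 𝕜 ((S t).adjoint φ.1.snd) (x : H)
    rw [ContinuousLinearMap.adjoint_inner_left, ContinuousLinearMap.adjoint_inner_left, h]⟩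

/-- The dual `D(A*)'` of `D(A*)` with pivot space `H`: bounded conjugate-linear functionals
on `D(A*)`. An element `x` of `H` acts as `φ ↦ inner 𝕜 φ x`, which is conjugate-linear in `φ`. -/
abbrev DAdjDual (S : C0Group 𝕜 H) : Type _ := S.DAdj →L⋆[𝕜] 𝕜

variable {U : Type*} [NormedAddCommGroup U] [InnerProductSpace 𝕜 U] [CompleteSpace U]

/-- The operator `B* ∈ L(D(A*), U)` of a control operator `B ∈ L(U, D(A*)')`, characterised by
`⟨u, B* φ⟩_U = ⟨B u, φ⟩`. -/
def Bstar (S : C0Group 𝕜 H) (B : U →L[𝕜] S.DAdjDual) (φ : S.DAdj) : U :=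
  (InnerProductSpace.toDual 𝕜 U).symm (B.flip φ)

theorem inner_Bstar (S : C0Group 𝕜 H) (B : U →L[𝕜] S.DAdjDual) (φ : S.DAdj) (u : U) :
    inner 𝕜 (S.Bstar B φ) u = B u φ := by
  simp [Bstar, InnerProductSpace.toDual_symm_apply]

/-- `B` is an admissible control operator: for all `T > 0` and `u ∈ L²((0,T); U)` the function
`t ↦ ∫₀ᵗ S(t-s) B u(s) ds`, with values in `D(A*)'`, belongs to `C([0,T]; H)`. Here `S(r)` acts on
`f ∈ D(A*)'` by `(S(r) f)(φ) = f (S(r)* φ)`. -/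
def IsAdmissible (S : C0Group 𝕜 H) (B : U →L[𝕜] S.DAdjDual) : Prop :=
  ∀ T : ℝ, 0 < T → ∀ u : ℝ → U, MemLp u 2 (volume.restrict (Ioo 0 T)) →
    ∃ Φ : ℝ → H, ContinuousOn Φ (Icc 0 T) ∧ ∀ t ∈ Icc 0 T, ∀ φ : S.DAdj,
      inner 𝕜 (S.incl φ) (Φ t) = ∫ s in Ioo 0 t, B (u s) (S.adjApply (t - s) φ)

end C0Group

/-- `f' = g` on `(0,T)` in the sense of distributions. -/
def HasDistribDeriv {𝕜 : Type*} [RCLike 𝕜] (T : ℝ) (f g : ℝ → 𝕜) : Prop :=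
  ∀ θ : ℝ → ℝ, ContDiff ℝ ∞ θ → HasCompactSupport θ → tsupport θ ⊆ Ioo 0 T →
    ∫ t in Ioo 0 T, ((deriv θ t : ℝ) : 𝕜) * f t = - ∫ t in Ioo 0 T, ((θ t : ℝ) : 𝕜) * g t

namespace C0Group

variable {𝕜 H : Type*} [RCLike 𝕜] [NormedAddCommGroup H] [InnerProductSpace 𝕜 H] [CompleteSpace H]
variable {U : Type*} [NormedAddCommGroup U] [InnerProductSpace 𝕜 U] [CompleteSpace U]

/-- `y ∈ C([0,T]; H)` is the weak solution of `y' = A y + B u` on `(0,T)`, `y(0) = y₀`, with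
control `u ∈ L²((0,T); U)`: for all `φ ∈ D(A*)`,
`d/dt ⟨y, φ⟩ = ⟨y, A* φ⟩ + ⟨u, B* φ⟩` in the sense of distributions. -/
structure IsWeakSolution (S : C0Group 𝕜 H) (B : U →L[𝕜] S.DAdjDual) (T : ℝ) (y₀ : H)
    (u : ℝ → U) (y : ℝ → H) : Prop where
  control : MemLp u 2 (volume.restrict (Ioo 0 T))
  continuousOn : ContinuousOn y (Icc 0 T)
  initial : y 0 = y₀
  equation : ∀ φ : S.DAdj, HasDistribDeriv T (fun t => inner 𝕜 (S.incl φ) (y t))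
    (fun t => inner 𝕜 (S.Astar φ) (y t) + inner 𝕜 (S.Bstar B φ) (u t))

/-- The system `y' = A y + B u` is exactly controllable in time `T`. -/
def IsExactlyControllable (S : C0Group 𝕜 H) (B : U →L[𝕜] S.DAdjDual) (T : ℝ) : Prop :=
  ∀ y₀ y₁ : H, ∃ (u : ℝ → U) (y : ℝ → H), S.IsWeakSolution B T y₀ u y ∧ y T = y₁

/-- `z ∈ C([0,T]; H)` is the weak solution of `z' = - A* z + g` on `(0,T)`, `z(0) = z₀`, with
source `g ∈ L¹((0,T); H)`. The adjoint of `- A*` is `- A`, so test vectors range over `D(A)`. -/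
structure IsAdjointWeakSolution (S : C0Group 𝕜 H) (T : ℝ) (z₀ : H) (g z : ℝ → H) : Prop where
  source : IntegrableOn g (Ioo 0 T)
  continuousOn : ContinuousOn z (Icc 0 T)
  initial : z 0 = z₀
  equation : ∀ φ : S.generator.domain, HasDistribDeriv T (fun t => inner 𝕜 (φ : H) (z t))
    (fun t => - inner 𝕜 (S.generator φ) (z t) + inner 𝕜 (φ : H) (g t))

/-- `v = B* z` in `L²((0,T); U)`, for the weak solution `z ∈ C([0,T]; H)` of `z' = - A* z + g`.
When the data are regular, `z ∈ C([0,T]; D(A*))` and `B* z` is defined pointwise; in general `B* z`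
is the extension by density with respect to the data `(z(0), g) ∈ H × L¹((0,T); H)`, that is, the
limit in `L²((0,T); U)` of `B* zₙ` for regular solutions `zₙ` whose data converge to those
of `z`. -/
def IsObservation (S : C0Group 𝕜 H) (B : U →L[𝕜] S.DAdjDual) (T : ℝ) (g z : ℝ → H)
    (v : ℝ → U) : Prop :=
  MemLp v 2 (volume.restrict (Ioo 0 T)) ∧
  ∃ gn zn : ℕ → ℝ → S.DAdj,
    (∀ n, ContinuousOn (gn n) (Icc 0 T)) ∧
    (∀ n, ContinuousOn (zn n) (Icc 0 T)) ∧
    (∀ n, S.IsAdjointWeakSolution T (S.incl (zn n 0)) (fun t => S.incl (gn n t))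
      (fun t => S.incl (zn n t))) ∧
    Tendsto (fun n => S.incl (zn n 0)) atTop (𝓝 (z 0)) ∧
    Tendsto (fun n => ∫ t in Ioo 0 T, ‖S.incl (gn n t) - g t‖) atTop (𝓝 0) ∧
    Tendsto (fun n => ∫ t in Ioo 0 T, ‖S.Bstar B (zn n t) - v t‖ ^ 2) atTop (𝓝 0)

/-- `Q` is symmetric, coercive (and invertible), `R` and `W` are symmetric and non-negative, and
`A Q + Q A* - B W B* + Q R Q + 2 lam Q = 0` as a form on `D(A*)`. -/
structure IsRiccatiTriple (S : C0Group 𝕜 H) (B : U →L[𝕜] S.DAdjDual) (lam : ℝ)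
    (Q : H ≃L[𝕜] H) (R : H →L[𝕜] H) (W : U →L[𝕜] U) : Prop where
  Q_symmetric : ∀ x y : H, inner 𝕜 (Q x) y = inner 𝕜 x (Q y)
  Q_coercive : ∃ c : ℝ, 0 < c ∧ ∀ x : H, c * ‖x‖ ^ 2 ≤ RCLike.re (inner 𝕜 (Q x) x)
  R_nonneg : R.IsPositive
  W_nonneg : W.IsPositive
  identity : ∀ x y : S.DAdj,
    inner 𝕜 (Q (S.incl x)) (S.Astar y) + inner 𝕜 (S.Astar x) (Q (S.incl y))
      - inner 𝕜 (W (S.Bstar B x)) (S.Bstar B y)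
      + inner 𝕜 (R (Q (S.incl x))) (Q (S.incl y))
      + 2 * (lam : 𝕜) * inner 𝕜 (Q (S.incl x)) (S.incl y) = 0

/-- `(y, z) ∈ C([0,T]; H)²` is the weak solution, with `v = B* z`, of
`y' = A y - B W B* z`, `z' = - A* z - 2 lam z - R Q z` on `(0,T)`,
`y(0) = y₀`, `z(0) = Q⁻¹ y₀`. -/
structure IsClosedLoopSolution (S : C0Group 𝕜 H) (B : U →L[𝕜] S.DAdjDual) (lam : ℝ)
    (Q : H ≃L[𝕜] H) (R : H →L[𝕜] H) (W : U →L[𝕜] U) (T : ℝ) (y₀ : H)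
    (y z : ℝ → H) (v : ℝ → U) : Prop where
  costate : S.IsAdjointWeakSolution T (Q.symm y₀)
    (fun t => - ((2 * (lam : 𝕜)) • z t) - R (Q (z t))) z
  observation : S.IsObservation B T (fun t => - ((2 * (lam : 𝕜)) • z t) - R (Q (z t))) z v
  state : S.IsWeakSolution B T y₀ (fun t => - W (v t)) y

/-- The system `y' = A y + B u` is stabilizable with decay rate `lam` by a static feedback
`u = - W B* Q⁻¹ y` in the trajectory sense: for some `Q, R, W` satisfying the Riccati identity and
for every `y₀ ∈ H` the system for `(y, z)` is well-posed on `[0, ∞)` (with uniqueness on every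
`[0,T]`), `z = Q⁻¹ y`, so that the control `- W B* z` is `- W B* Q⁻¹ y`, and
`‖y(t)‖ ≤ C e^{- lam t} ‖y₀‖` with `C` independent of `t` and `y₀`. -/
def IsStaticallyStabilizable (S : C0Group 𝕜 H) (B : U →L[𝕜] S.DAdjDual) (lam : ℝ) : Prop :=
  ∃ (Q : H ≃L[𝕜] H) (R : H →L[𝕜] H) (W : U →L[𝕜] U), S.IsRiccatiTriple B lam Q R W ∧
    ∃ C : ℝ, 0 < C ∧ ∀ y₀ : H, ∃ (y z : ℝ → H) (v : ℝ → U),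
      (∀ T : ℝ, 0 < T → S.IsClosedLoopSolution B lam Q R W T y₀ y z v) ∧
      (∀ T : ℝ, 0 < T → ∀ (y' z' : ℝ → H) (v' : ℝ → U),
        S.IsClosedLoopSolution B lam Q R W T y₀ y' z' v' →
          EqOn y' y (Icc 0 T) ∧ EqOn z' z (Icc 0 T) ∧
          v' =ᵐ[volume.restrict (Ioo 0 T)] v) ∧
      (∀ t : ℝ, 0 ≤ t → z t = Q.symm (y t)) ∧
      (∀ t : ℝ, 0 ≤ t → ‖y t‖ ≤ C * Real.exp (- lam * t) * ‖y₀‖)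

/-- Stabilizability by static feedback in the trajectory sense at every prescribed rate. -/
def IsRapidlyStaticallyStabilizable (S : C0Group 𝕜 H) (B : U →L[𝕜] S.DAdjDual) : Prop :=
  ∀ lam : ℝ, 0 < lam → S.IsStaticallyStabilizable B lam

end C0Group

end

noncomputable section

set_option linter.unusedSectionVars false

namespace C0Group

/-! ### Bounds and joint continuity for strongly continuous groups -/

section Basic

variable {𝕜 H : Type*} [RCLike 𝕜] [NormedAddCommGroup H] [InnerProductSpace 𝕜 H]

/-! The feedback comes from a weighted controllability Gramian. Take W = 1, L = 2T and Q = ∫₀ᴸ e(s)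
S(-s) B B* S(-s)* ds with e(s) = exp(-2λs)(1 - s/L). The weight satisfies e(0) = 1, e(L) = 0 and -e'
- 2λe = exp(-2λs)/L ≥ 0. Differentiating h ↦ ⟨Q S(-h)*x, S(-h)*y⟩ at h = 0 therefore gives the
Riccati identity with R = Q⁻¹ G' Q⁻¹, where G' is the Gramian with weight exp(-2λs)/L
(`gramian_riccati_identity`). Admissibility and the uniform boundedness principle make these
Gramians bounded on H (`IsAdmissible.exists_gramian`). Dually, exact controllability gives the
observability inequality (`IsExactlyControllable.exists_le_integral`), hence coercivity of Q, since
e is bounded below on [0,T].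

The costate equation does not involve y and is a bounded perturbation of the group S(-t)*, so it is
solved globally by a fixed point (`exists_adjointWeakSolution`). Along regular solutions the Riccati
identity on the diagonal yields an exact balance for exp(αt)⟨Qz,z⟩ containing ∫ exp(αs)‖B*z‖²
(`IsRiccatiTriple.energy_identity`). With α = 0 it bounds B*z in L² by the data, so B*z exists and
is unique for weak solutions. With α = 2λ it gives exp(2λt)⟨Qz(t),z(t)⟩ ≤ ⟨Qz(0),z(0)⟩, hence the
decay at rate λ. The full Riccati form says that y = Qz solves y' = Ay - BB*z
(`IsRiccatiTriple.isWeakSolution`), so z = Q⁻¹y by construction.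

A* and B* only act on D(A*). The identities are therefore proved for D(A*)-valued solutions and
carried to weak ones by limits, the approximation being the average ε⁻¹∫₀^ε S(s)* ds. Uniqueness
follows in the order z (decay estimate for a difference), B*z (determined by the data), y (variation
of constants). -/

theorem ofReal_inv_smul [NormedSpace ℝ H] [IsScalarTower ℝ 𝕜 H] (h : ℝ) (x : H) :
    ((h : 𝕜)⁻¹) • x = h⁻¹ • x := by
  rw [← RCLike.ofReal_inv, ← algebraMap_smul 𝕜 (h⁻¹)]

theorem hasDerivAt_apply [NormedSpace ℝ H] [IsScalarTower ℝ 𝕜 H] (S : C0Group 𝕜 H)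
    (x : S.generator.domain) (t : ℝ) :
    HasDerivAt (fun s => S s (x : H)) (S t (S.generator x)) t := by
  rw [hasDerivAt_iff_tendsto_slope_zero]
  refine (S.apply_generator_tendsto t x).congr fun h => ?_
  rw [ofReal_inv_smul, ← S.apply_add, add_comm]

/-- If `t ↦ S(t) x` has derivative `y` at `0`, then `x ∈ D(A)`. -/
theorem mem_domain_of_hasDerivAt [NormedSpace ℝ H] [IsScalarTower ℝ 𝕜 H] (S : C0Group 𝕜 H)
    {x y : H} (h : HasDerivAt (fun s => S s x) y 0) :
    ∃ hx : x ∈ S.generator.domain, S.generator ⟨x, hx⟩ = y := by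
  rw [hasDerivAt_iff_tendsto_slope_zero] at h
  have h' : Tendsto (fun h : ℝ => ((h : 𝕜)⁻¹) • (S h x - x)) (𝓝[≠] 0) (𝓝 y) := by
    refine h.congr fun s => ?_
    rw [ofReal_inv_smul, zero_add, S.apply_zero]
  exact ⟨⟨y, h'⟩, tendsto_nhds_unique (S.tendsto_generator ⟨x, ⟨y, h'⟩⟩) h'⟩

theorem intervalIntegrable_apply (S : C0Group 𝕜 H) (x : H) (a b : ℝ) :
    IntervalIntegrable (fun s => S s x) volume a b :=
  (S.continuous_apply x).intervalIntegrable a b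

theorem apply_nat_mul (S : C0Group 𝕜 H) (n : ℕ) (t : ℝ) : S (n * t) = S t ^ n := by
  induction n with
  | zero => rw [Nat.cast_zero, zero_mul, S.map_zero']; rfl
  | succ n ih =>
    have : ((n + 1 : ℕ) : ℝ) * t = n * t + t := by push_cast; ring
    rw [this, S.map_add', ih, pow_succ]; rfl

variable [CompleteSpace H]

/-- Uniform boundedness: each orbit is continuous, hence bounded on a compact interval. -/
theorem exists_bound_Icc (S : C0Group 𝕜 H) (a b : ℝ) :
    ∃ M : ℝ, 0 ≤ M ∧ ∀ t ∈ Icc a b, ‖S t‖ ≤ M := by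
  obtain ⟨C, hC⟩ := banach_steinhaus (g := fun t : Icc a b => S t) fun x => by
    obtain ⟨C, hC⟩ := isCompact_Icc.exists_bound_of_continuousOn
      ((S.continuous_apply x).continuousOn (s := Icc a b))
    exact ⟨C, fun t => hC t t.2⟩
  exact ⟨max C 0, le_max_right _ _, fun t ht => (hC ⟨t, ht⟩).trans (le_max_left _ _)⟩

theorem exists_growth_bound (S : C0Group 𝕜 H) :
    ∃ M w : ℝ, 0 ≤ M ∧ 0 ≤ w ∧ ∀ t, 0 ≤ t → ‖S t‖ ≤ M * Real.exp (w * t) := by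
  obtain ⟨M, hM0, hM⟩ := S.exists_bound_Icc 0 1
  -- K ≥ 1 makes log K ≥ 0 and K^n ≤ K^t for n ≤ t. Cutting [0,t] into n + 1 equal steps of length
  -- at most 1 then gives ‖S(t)‖ ≤ K^(n+1) ≤ K·K^t.
  set K := max M 1 with hK
  have hK1 : 1 ≤ K := le_max_right _ _
  have hK0 : 0 < K := by linarith
  refine ⟨K, Real.log K, hK0.le, Real.log_nonneg hK1, fun t ht => ?_⟩
  obtain ⟨n, hn, hn'⟩ : ∃ n : ℕ, t ≤ n + 1 ∧ (n : ℝ) ≤ t :=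
    ⟨⌊t⌋₊, (Nat.lt_floor_add_one t).le, Nat.floor_le ht⟩
  have hpos : (0 : ℝ) < n + 1 := by positivity
  have e : S t = S (t / (n + 1)) ^ (n + 1) := by
    rw [← S.apply_nat_mul]
    congr 1
    push_cast
    field_simp
  have hb : ‖S (t / (n + 1))‖ ≤ K :=
    (hM _ ⟨by positivity, by rw [div_le_one hpos]; exact hn⟩).trans (le_max_left _ _)
  rw [e]
  calc ‖S (t / (n + 1)) ^ (n + 1)‖ ≤ ‖S (t / (n + 1))‖ ^ (n + 1) :=
        norm_pow_le' _ (Nat.succ_pos n)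
    _ ≤ K ^ (n + 1) := by gcongr
    _ = K * K ^ (n : ℝ) := by rw [Real.rpow_natCast, pow_succ, mul_comm]
    _ ≤ K * K ^ t := by gcongr
    _ = K * Real.exp (Real.log K * t) := by rw [Real.rpow_def_of_pos hK0]

/-- Split S(a(r))x(r) = S(a(r))x(t) + S(a(r))(x(r) - x(t)): strong continuity handles the first
term, the local operator bound the second. -/
theorem continuousOn_apply_apply (S : C0Group 𝕜 H) {a : ℝ → ℝ} {x : ℝ → H} {s : Set ℝ}
    (ha : ContinuousOn a s) (hx : ContinuousOn x s) :
    ContinuousOn (fun t => S (a t) (x t)) s := by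
  intro t ht
  obtain ⟨M, hM0, hM⟩ := S.exists_bound_Icc (a t - 1) (a t + 1)
  have h1 : Tendsto (fun r => S (a r) (x t)) (𝓝[s] t) (𝓝 (S (a t) (x t))) :=
    ((S.continuous_apply (x t)).tendsto _).comp (ha t ht)
  have h2 : Tendsto (fun r => S (a r) (x r - x t)) (𝓝[s] t) (𝓝 0) := by
    have hx0 : Tendsto (fun r => M * ‖x r - x t‖) (𝓝[s] t) (𝓝 0) := by
      have : Tendsto (fun r => x r - x t) (𝓝[s] t) (𝓝 (x t - x t)) :=
        (hx t ht).tendsto.sub tendsto_const_nhds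
      simpa using (this.norm).const_mul M
    refine squeeze_zero_norm' ?_ hx0
    filter_upwards [(ha t ht).tendsto (Icc_mem_nhds (sub_one_lt (a t)) (lt_add_one (a t)))] with r hr
    exact ((S (a r)).le_opNorm _).trans (by gcongr; exact hM _ hr)
  have h3 := h1.add h2
  rw [add_zero] at h3
  exact h3.congr fun r => by rw [map_sub]; abel

theorem continuous_apply_apply (S : C0Group 𝕜 H) {a : ℝ → ℝ} {x : ℝ → H}
    (ha : Continuous a) (hx : Continuous x) : Continuous (fun t => S (a t) (x t)) := by
  rw [← continuousOn_univ] at *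
  exact S.continuousOn_apply_apply ha hx

end Basic

/-! ### Averages of the group over short time intervals -/

section Mean

variable {𝕜 H : Type*} [RCLike 𝕜] [NormedAddCommGroup H] [InnerProductSpace 𝕜 H]
  [CompleteSpace H] [NormedSpace ℝ H] [IsScalarTower ℝ 𝕜 H]

/-- The average `ε⁻¹ ∫₀^ε S(s) ds` of a `C₀`-group. -/
def mean (S : C0Group 𝕜 H) (ε : ℝ) : H →L[𝕜] H :=
  LinearMap.mkContinuousOfExistsBound
    { toFun := fun x => ε⁻¹ • ∫ s in (0:ℝ)..ε, S s x
      map_add' := fun x y => by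
        simp only [map_add]
        rw [intervalIntegral.integral_add (S.intervalIntegrable_apply x _ _)
          (S.intervalIntegrable_apply y _ _), smul_add]
      map_smul' := fun c x => by
        simp only [map_smul, RingHom.id_apply]
        rw [intervalIntegral.integral_smul, smul_comm] }
    (by
      obtain ⟨M, hM0, hM⟩ := S.exists_bound_Icc (-|ε|) |ε|
      refine ⟨|ε|⁻¹ * (M * |ε|), fun x => ?_⟩
      change ‖ε⁻¹ • ∫ s in (0:ℝ)..ε, S s x‖ ≤ _
      rw [norm_smul, norm_inv, Real.norm_eq_abs, mul_assoc]
      gcongr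
      have := intervalIntegral.norm_integral_le_of_norm_le_const (a := 0) (b := ε)
        (f := fun s => S s x) (C := M * ‖x‖) fun s hs => by
          refine ((S s).le_opNorm x).trans ?_
          gcongr
          apply hM
          have h := uIoc_subset_uIcc hs
          rw [mem_uIcc] at h
          rcases h with h | h
          · exact ⟨by linarith [abs_nonneg ε], h.2.trans (le_abs_self _)⟩
          · exact ⟨by linarith [neg_abs_le ε], h.2.trans (abs_nonneg _)⟩
      rw [sub_zero] at this
      linarith)

theorem mean_apply (S : C0Group 𝕜 H) (ε : ℝ) (x : H) :
    S.mean ε x = ε⁻¹ • ∫ s in (0:ℝ)..ε, S s x := rfl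

theorem apply_mean (S : C0Group 𝕜 H) (t ε : ℝ) (x : H) :
    S t (S.mean ε x) = S.mean ε (S t x) := by
  rw [mean_apply, mean_apply, ← algebraMap_smul 𝕜 ε⁻¹, map_smul,
    ← ContinuousLinearMap.intervalIntegral_comp_comm (S t) (S.intervalIntegrable_apply x _ _),
    algebraMap_smul]
  congr 1
  exact intervalIntegral.integral_congr fun s _ => S.apply_comm t s x

theorem tendsto_mean (S : C0Group 𝕜 H) {ε : ℕ → ℝ} (hε : Tendsto ε atTop (𝓝[>] 0)) (x : H) :
    Tendsto (fun n => S.mean (ε n) x) atTop (𝓝 x) := by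
  have hd : HasDerivAt (fun h : ℝ => ∫ s in (0:ℝ)..h, S s x) x 0 := by
    have h := intervalIntegral.integral_hasDerivAt_right (S.intervalIntegrable_apply x 0 0)
      ((S.continuous_apply x).stronglyMeasurableAtFilter _ _)
      (S.continuous_apply x).continuousAt
    simpa [S.apply_zero] using h
  rw [hasDerivAt_iff_tendsto_slope_zero] at hd
  have h2 : Tendsto ε atTop (𝓝[≠] 0) := hε.mono_right (nhdsWithin_mono _ fun t ht => ne_of_gt ht)
  refine (hd.comp h2).congr fun n => ?_
  simp [mean_apply]

/-- The average absorbs the generator: on D(A) the product is the bounded operator ε⁻¹(S(ε) - 1). By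
duality, the adjoint of the average takes values in D(A*). -/
theorem mean_generator (S : C0Group 𝕜 H) (ε : ℝ) (x : S.generator.domain) :
    S.mean ε (S.generator x) = ε⁻¹ • (S ε (x : H) - x) := by
  rw [mean_apply, intervalIntegral.integral_eq_sub_of_hasDerivAt
    (fun t _ => S.hasDerivAt_apply x t) (S.intervalIntegrable_apply _ _ _), S.apply_zero]

theorem mean_mem_domain (S : C0Group 𝕜 H) (ε : ℝ) (x : S.generator.domain) :
    ∃ h : S.mean ε (x : H) ∈ S.generator.domain,
      S.generator ⟨S.mean ε (x : H), h⟩ = S.mean ε (S.generator x) := by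
  apply S.mem_domain_of_hasDerivAt
  have h := (S.mean ε).hasFDerivAt.restrictScalars ℝ |>.comp_hasDerivAt (0 : ℝ)
    (S.hasDerivAt_apply x 0)
  rw [S.apply_zero] at h
  exact h.congr_of_eventuallyEq (Eventually.of_forall fun t => S.apply_mean t ε x)

end Mean

end C0Group

/-! ### The adjoint group and the regularization of H into D(A*) -/

theorem inner_intervalIntegral_right {𝕜 H : Type*} [RCLike 𝕜] [NormedAddCommGroup H]
    [InnerProductSpace 𝕜 H] [CompleteSpace H] [NormedSpace ℝ H] {f : ℝ → H}
    {a b : ℝ} (hf : IntervalIntegrable f volume a b) (x : H) :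
    ∫ s in a..b, inner 𝕜 x (f s) = inner 𝕜 x (∫ s in a..b, f s) :=
  ContinuousLinearMap.intervalIntegral_comp_comm (innerSL 𝕜 x) hf

theorem inner_intervalIntegral_left {𝕜 H : Type*} [RCLike 𝕜] [NormedAddCommGroup H]
    [InnerProductSpace 𝕜 H] [CompleteSpace H] [NormedSpace ℝ H] {f : ℝ → H}
    {a b : ℝ} (hf : IntervalIntegrable f volume a b) (x : H) :
    ∫ s in a..b, inner 𝕜 (f s) x = inner 𝕜 (∫ s in a..b, f s) x := by
  rw [← inner_conj_symm, ← inner_intervalIntegral_right hf]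
  simp only [intervalIntegral, map_sub, ← integral_conj, inner_conj_symm]

namespace C0Group

variable {𝕜 H U : Type*} [RCLike 𝕜] [NormedAddCommGroup H] [InnerProductSpace 𝕜 H]
  [CompleteSpace H] [NormedAddCommGroup U] [InnerProductSpace 𝕜 U] [CompleteSpace U]

/-- The inclusion `D(A*) → H` as a continuous linear map. -/
def inclL (S : C0Group 𝕜 H) : S.DAdj →L[𝕜] H := (WithLp.fstL 2 𝕜 H H).comp S.DAdj.subtypeL

/-- The operator `A* : D(A*) → H` as a continuous linear map. -/
def AstarL (S : C0Group 𝕜 H) : S.DAdj →L[𝕜] H := (WithLp.sndL 2 𝕜 H H).comp S.DAdj.subtypeL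

/-- The operator `B* : D(A*) → U` as a continuous linear map. -/
def BstarL (S : C0Group 𝕜 H) (B : U →L[𝕜] S.DAdjDual) : S.DAdj →L[𝕜] U :=
  ((InnerProductSpace.toDual 𝕜 U).symm.toContinuousLinearEquiv :
    (StrongDual 𝕜 U) →L⋆[𝕜] U).comp B.flip

theorem BstarL_apply (S : C0Group 𝕜 H) (B : U →L[𝕜] S.DAdjDual) (φ : S.DAdj) :
    S.BstarL B φ = S.Bstar B φ := rfl

theorem DAdj_ext (S : C0Group 𝕜 H) {φ ψ : S.DAdj} (h : S.incl φ = S.incl ψ)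
    (h' : S.Astar φ = S.Astar ψ) : φ = ψ :=
  Subtype.ext (WithLp.ofLp_injective 2 (Prod.ext h h'))

theorem inner_incl_generator (S : C0Group 𝕜 H) (φ : S.DAdj) (x : S.generator.domain) :
    inner 𝕜 (S.incl φ) (S.generator x) = inner 𝕜 (S.Astar φ) (x : H) :=
  (S.mem_DAdj_iff φ.1).1 φ.2 x

theorem inner_generator_incl (S : C0Group 𝕜 H) (φ : S.DAdj) (x : S.generator.domain) :
    inner 𝕜 (S.generator x) (S.incl φ) = inner 𝕜 (x : H) (S.Astar φ) := by
  rw [← inner_conj_symm, inner_incl_generator, inner_conj_symm]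

theorem eq_of_inner_domain (S : C0Group 𝕜 H) {x y : H}
    (h : ∀ φ : S.generator.domain, inner 𝕜 (φ : H) x = inner 𝕜 (φ : H) y) : x = y :=
  S.dense_generator_domain.eq_of_inner_right 𝕜 fun v hv => h ⟨v, hv⟩

section Smooth

variable [NormedSpace ℝ H] [IsScalarTower ℝ 𝕜 H]

/-- The regularization `ε⁻¹ ∫₀^ε S(s)* ds : H → D(A*)`. -/
def smooth (S : C0Group 𝕜 H) (ε : ℝ) : H →L[𝕜] S.DAdj :=
  ((WithLp.prodContinuousLinearEquiv 2 𝕜 H H).symm.toContinuousLinearMap.comp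
    ((S.mean ε).adjoint.prod ((ε : 𝕜)⁻¹ • (S ε - ContinuousLinearMap.id 𝕜 H)).adjoint)).codRestrict
      S.DAdj fun x => by
    -- The second component is the adjoint of ε⁻¹(S(ε) - 1), which on D(A) is the average composed
    -- with A; this is the relation that defines A*.
    rw [mem_DAdj_iff]
    intro φ
    change inner 𝕜 ((S.mean ε).adjoint x) (S.generator φ) = inner 𝕜
      (((ε : 𝕜)⁻¹ • (S ε - ContinuousLinearMap.id 𝕜 H)).adjoint x) (φ : H)
    rw [ContinuousLinearMap.adjoint_inner_left, ContinuousLinearMap.adjoint_inner_left,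
      mean_generator, ← ofReal_inv_smul (𝕜 := 𝕜)]
    rfl

theorem incl_smooth (S : C0Group 𝕜 H) (ε : ℝ) (x : H) :
    S.incl (S.smooth ε x) = (S.mean ε).adjoint x := rfl

theorem exists_tendsto_nhdsGT_zero : ∃ ε : ℕ → ℝ, Tendsto ε atTop (𝓝[>] 0) :=
  ⟨fun n => 1 / ((n : ℝ) + 1), tendsto_nhdsWithin_iff.2
    ⟨tendsto_one_div_add_atTop_nhds_zero_nat, Eventually.of_forall fun n => by
      simp only [mem_Ioi]; positivity⟩⟩

/-- A vector y orthogonal to D(A*) is orthogonal to its own regularization, so y is orthogonal to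
its average over [0,ε]; letting ε → 0 gives ‖y‖² = 0. -/
theorem denseRange_incl (S : C0Group 𝕜 H) : DenseRange S.incl := by
  have h : Dense ((LinearMap.range S.inclL.toLinearMap : Submodule 𝕜 H) : Set H) := by
    rw [Submodule.dense_iff_topologicalClosure_eq_top, Submodule.topologicalClosure_eq_top_iff,
      Submodule.eq_bot_iff]
    intro y hy
    obtain ⟨ε, hε⟩ := exists_tendsto_nhdsGT_zero
    have h1 : ∀ n, inner 𝕜 y (S.mean (ε n) y) = 0 := by
      intro n
      have := hy _ (LinearMap.mem_range_self S.inclL.toLinearMap (S.smooth (ε n) y))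
      change inner 𝕜 ((S.mean (ε n)).adjoint y) y = 0 at this
      rwa [ContinuousLinearMap.adjoint_inner_left] at this
    have h2 : Tendsto (fun n => inner 𝕜 y (S.mean (ε n) y)) atTop (𝓝 (inner 𝕜 y y)) :=
      tendsto_const_nhds.inner (S.tendsto_mean hε y)
    simp only [h1] at h2
    exact inner_self_eq_zero.1 (tendsto_nhds_unique h2 tendsto_const_nhds)
  exact h

theorem eq_of_inner_incl (S : C0Group 𝕜 H) {x y : H}
    (h : ∀ φ : S.DAdj, inner 𝕜 (S.incl φ) x = inner 𝕜 (S.incl φ) y) : x = y := by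
  exact S.denseRange_incl.eq_of_inner_right 𝕜 h

/-- For x ∈ D(A), t ↦ ⟨φ, S(t)x⟩ has derivative ⟨A*φ, S(t)x⟩, so the mean value inequality bounds
the pairing with x. Density extends this to all x, and pairing the vector with itself gives the
norm. This Lipschitz estimate is the source of the strong continuity of S(t)*. -/
theorem norm_adjoint_apply_sub_le (S : C0Group 𝕜 H) {M : ℝ} (hM0 : 0 ≤ M)
    (hM : ∀ t ∈ Icc (-1 : ℝ) 1, ‖S t‖ ≤ M) (φ : S.DAdj) {t : ℝ} (ht : t ∈ Icc (-1 : ℝ) 1) :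
    ‖(S t).adjoint (S.incl φ) - S.incl φ‖ ≤ M * ‖S.Astar φ‖ * |t| := by
  have key : ∀ x : H, ‖inner 𝕜 ((S t).adjoint (S.incl φ) - S.incl φ) x‖
      ≤ M * ‖S.Astar φ‖ * |t| * ‖x‖ := by
    intro x
    refine S.dense_generator_domain.induction (P := fun x =>
      ‖inner 𝕜 ((S t).adjoint (S.incl φ) - S.incl φ) x‖ ≤ M * ‖S.Astar φ‖ * |t| * ‖x‖) ?_ ?_ x
    · intro x hx
      have hd : ∀ s ∈ Icc (-1 : ℝ) 1, HasDerivWithinAt (fun s => inner 𝕜 (S.incl φ) (S s x))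
          (inner 𝕜 (S.Astar φ) (S s x)) (Icc (-1 : ℝ) 1) s := by
        intro s _
        have h := ((hasDerivAt_const s (S.incl φ)).inner 𝕜 (S.hasDerivAt_apply ⟨x, hx⟩ s))
        rw [inner_zero_left, add_zero, ← S.generator_apply, inner_incl_generator] at h
        exact h.hasDerivWithinAt
      have h := (convex_Icc (-1 : ℝ) 1).norm_image_sub_le_of_norm_hasDerivWithin_le
        (C := ‖S.Astar φ‖ * (M * ‖x‖)) hd (fun s hs => (norm_inner_le_norm _ _).trans (by
          gcongr
          exact ((S s).le_opNorm x).trans (by gcongr; exact hM s hs)))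
        (show (0 : ℝ) ∈ Icc (-1 : ℝ) 1 by constructor <;> norm_num) ht
      rw [S.apply_zero, sub_zero, Real.norm_eq_abs] at h
      rw [inner_sub_left, ContinuousLinearMap.adjoint_inner_left]
      calc _ ≤ _ := h
        _ = _ := by ring
    · exact isClosed_le (by fun_prop) (by fun_prop)
  have h := key ((S t).adjoint (S.incl φ) - S.incl φ)
  rw [inner_self_eq_norm_sq_to_K, ← RCLike.ofReal_pow, RCLike.norm_ofReal, abs_of_nonneg (by positivity),
    sq] at h
  by_cases h0 : ‖(S t).adjoint (S.incl φ) - S.incl φ‖ = 0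
  · rw [h0]; positivity
  · exact le_of_mul_le_mul_right h (lt_of_le_of_ne (norm_nonneg _) (Ne.symm h0))

/-- The adjoint group `t ↦ S(t)*`. -/
def adj (S : C0Group 𝕜 H) : C0Group 𝕜 H where
  toFun t := (S t).adjoint
  map_zero' := by rw [S.map_zero']; exact ContinuousLinearMap.adjoint_id
  map_add' s t := by rw [add_comm, S.map_add', ContinuousLinearMap.adjoint_comp]
  tendsto_zero' x := by
    obtain ⟨M, hM0, hM⟩ := S.exists_bound_Icc (-1) 1
    rw [Metric.tendsto_nhds]
    intro ε hε
    -- Approximate x by φ ∈ D(A*), where the Lipschitz estimate applies. The factor M + 1 pays for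
    -- both S(t)*(x - φ) and x - φ.
    obtain ⟨φ, hφ⟩ := S.denseRange_incl.exists_dist_lt x (ε := ε / (2 * (M + 1))) (by positivity)
    have h1 : Tendsto (fun t : ℝ => M * ‖S.Astar φ‖ * |t|) (𝓝 0) (𝓝 0) := by
      have : Continuous (fun t : ℝ => M * ‖S.Astar φ‖ * |t|) := by fun_prop
      simpa using this.tendsto 0
    filter_upwards [h1.eventually (gt_mem_nhds (half_pos hε)),
      Icc_mem_nhds (show (-1 : ℝ) < 0 by norm_num) (show (0 : ℝ) < 1 by norm_num)] with t ht1 ht2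
    have hb := S.norm_adjoint_apply_sub_le hM0 hM φ ht2
    have e : (S t).adjoint x - x = (S t).adjoint (x - S.incl φ) - (x - S.incl φ)
        + ((S t).adjoint (S.incl φ) - S.incl φ) := by rw [map_sub]; abel
    have h2 : ‖(S t).adjoint (x - S.incl φ)‖ ≤ M * ‖x - S.incl φ‖ :=
      ((S t).adjoint.le_opNorm _).trans (by
        gcongr; rw [ContinuousLinearMap.adjoint.norm_map]; exact hM t ht2)
    rw [dist_eq_norm] at hφ ⊢
    rw [e]
    have h3 : (M + 1) * ‖x - S.incl φ‖ < ε / 2 := by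
      rw [lt_div_iff₀ (by positivity)] at hφ
      linarith
    calc _ ≤ ‖(S t).adjoint (x - S.incl φ)‖ + ‖x - S.incl φ‖
          + ‖(S t).adjoint (S.incl φ) - S.incl φ‖ :=
          (norm_add_le _ _).trans (by gcongr; exact norm_sub_le _ _)
      _ < ε := by linarith

theorem adj_apply (S : C0Group 𝕜 H) (t : ℝ) (x : H) : S.adj t x = (S t).adjoint x := rfl

/-- Testing against D(A) gives S(t)*φ = φ + ∫₀ᵗ S(s)*A*φ ds, whose integrand is continuous;
differentiate at 0. Only this inclusion between A* and the generator of the adjoint group is needed.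
-/
theorem incl_mem_adj_domain (S : C0Group 𝕜 H) (φ : S.DAdj) :
    ∃ h : S.incl φ ∈ S.adj.generator.domain, S.adj.generator ⟨S.incl φ, h⟩ = S.Astar φ := by
  apply S.adj.mem_domain_of_hasDerivAt
  have e : ∀ t : ℝ, S.adj t (S.incl φ) = S.incl φ + ∫ s in (0:ℝ)..t, S.adj s (S.Astar φ) := by
    intro t
    apply S.eq_of_inner_domain
    intro x
    have hd : ∀ s ∈ uIcc 0 t, HasDerivAt (fun s => inner 𝕜 (S s (x : H)) (S.incl φ))
        (inner 𝕜 (x : H) (S.adj s (S.Astar φ))) s := by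
      intro s _
      have h := ((S.hasDerivAt_apply x s).inner 𝕜 (hasDerivAt_const s (S.incl φ)))
      rw [inner_zero_right, zero_add, ← S.generator_apply, inner_generator_incl] at h
      rw [adj_apply, ContinuousLinearMap.adjoint_inner_right]
      exact h
    have h := intervalIntegral.integral_eq_sub_of_hasDerivAt hd
      (Continuous.intervalIntegrable (continuous_const.inner (S.adj.continuous_apply _)) _ _)
    rw [inner_intervalIntegral_right (S.adj.intervalIntegrable_apply _ _ _), S.apply_zero] at h
    rw [inner_add_right, h, adj_apply, ContinuousLinearMap.adjoint_inner_right]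
    abel
  have h := (intervalIntegral.integral_hasDerivAt_right
    (S.adj.intervalIntegrable_apply (S.Astar φ) 0 0)
    ((S.adj.continuous_apply _).stronglyMeasurableAtFilter _ _)
    (S.adj.continuous_apply _).continuousAt).const_add (S.incl φ)
  rw [S.adj.apply_zero] at h
  exact h.congr_of_eventuallyEq (Eventually.of_forall e)

theorem hasDerivAt_adj (S : C0Group 𝕜 H) (φ : S.DAdj) (t : ℝ) :
    HasDerivAt (fun s => S.adj s (S.incl φ)) (S.adj t (S.Astar φ)) t := by
  obtain ⟨h, e⟩ := S.incl_mem_adj_domain φ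
  have := S.adj.hasDerivAt_apply ⟨_, h⟩ t
  rwa [e] at this

theorem continuous_adjApply (S : C0Group 𝕜 H) (φ : S.DAdj) :
    Continuous (fun t => S.adjApply t φ) :=
  Continuous.subtype_mk ((WithLp.prod_continuous_toLp 2 H H).comp
    ((S.adj.continuous_apply (S.incl φ)).prodMk (S.adj.continuous_apply (S.Astar φ)))) _

/-- Identifies the regularization with an average of the adjoint group, so that its convergence to
the identity follows from `tendsto_mean`. -/
theorem adj_mean (S : C0Group 𝕜 H) (ε : ℝ) : S.adj.mean ε = (S.mean ε).adjoint := by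
  rw [ContinuousLinearMap.eq_adjoint_iff]
  intro x y
  rw [mean_apply, mean_apply, ← ofReal_inv_smul (𝕜 := 𝕜), ← ofReal_inv_smul (𝕜 := 𝕜),
    inner_smul_left, inner_smul_right, ← inner_intervalIntegral_right (S.intervalIntegrable_apply _ _ _),
    ← inner_intervalIntegral_left (S.adj.intervalIntegrable_apply _ _ _), map_inv₀,
    RCLike.conj_ofReal]
  congr 1
  exact intervalIntegral.integral_congr fun s _ => ContinuousLinearMap.adjoint_inner_left _ _ _

theorem tendsto_incl_smooth (S : C0Group 𝕜 H) {ε : ℕ → ℝ} (hε : Tendsto ε atTop (𝓝[>] 0)) (x : H) :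
    Tendsto (fun n => S.incl (S.smooth (ε n) x)) atTop (𝓝 x) := by
  simp only [incl_smooth, ← adj_mean]
  exact S.adj.tendsto_mean hε x

end Smooth

end C0Group

/-! ### Smooth cutoffs approximating Dirac masses and indicators -/

section Transition

theorem deriv_smoothTransition_nonneg (x : ℝ) : 0 ≤ deriv Real.smoothTransition x :=
  Real.smoothTransition.monotone.deriv_nonneg

theorem deriv_smoothTransition_of_neg {x : ℝ} (hx : x < 0) : deriv Real.smoothTransition x = 0 := by
  have : Real.smoothTransition =ᶠ[𝓝 x] fun _ => 0 := by
    filter_upwards [Iio_mem_nhds hx] with y hy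
    exact Real.smoothTransition.zero_of_nonpos (le_of_lt hy)
  rw [this.deriv_eq, deriv_const]

theorem deriv_smoothTransition_of_one_lt {x : ℝ} (hx : 1 < x) :
    deriv Real.smoothTransition x = 0 := by
  have : Real.smoothTransition =ᶠ[𝓝 x] fun _ => 1 := by
    filter_upwards [Ioi_mem_nhds hx] with y hy
    exact Real.smoothTransition.one_of_one_le (le_of_lt hy)
  rw [this.deriv_eq, deriv_const]

theorem continuous_deriv_smoothTransition : Continuous (deriv Real.smoothTransition) :=
  (Real.smoothTransition.contDiff (n := 1)).continuous_deriv le_rfl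

theorem hasDerivAt_smoothTransition_comp (k a t : ℝ) :
    HasDerivAt (fun s => Real.smoothTransition (k * (s - a)))
      (k * deriv Real.smoothTransition (k * (t - a))) t := by
  have h1 : HasDerivAt Real.smoothTransition (deriv Real.smoothTransition (k * (t - a)))
      (k * (t - a)) :=
    ((Real.smoothTransition.contDiff (n := 1)).differentiable (by norm_num) _).hasDerivAt
  have h2 : HasDerivAt (fun s => k * (s - a)) k t := by
    simpa using ((hasDerivAt_id t).sub_const a).const_mul k
  have := h1.comp t h2
  rwa [mul_comm] at this

variable {𝕜 : Type*} [RCLike 𝕜]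

/-- The kernel k σ'(k(t - a)), with σ the smooth transition, is nonnegative, lives on [a, a + 1/k]
and has mass one: it approximates the Dirac mass at a. -/
theorem tendsto_integral_deriv_smoothTransition {T a : ℝ} (ha : a ∈ Ioo 0 T) {f : ℝ → 𝕜}
    (hf : ContinuousOn f (Icc 0 T)) :
    Tendsto (fun k : ℝ => ∫ t in Ioo 0 T,
      ((k * deriv Real.smoothTransition (k * (t - a)) : ℝ) : 𝕜) * f t) atTop (𝓝 (f a)) := by
  rw [Metric.tendsto_nhds]
  intro ε hε
  have hfa : ContinuousAt f a := hf.continuousAt (Icc_mem_nhds ha.1 ha.2)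
  obtain ⟨δ, hδ, hfδ⟩ := Metric.continuousAt_iff.1 hfa (ε / 2) (half_pos hε)
  have hk1 : Tendsto (fun k : ℝ => 1 / k) atTop (𝓝 0) := by
    simpa using tendsto_inv_atTop_zero (𝕜 := ℝ)
  -- 1/k < δ places the kernel where f is close to f(a); 1/k < T - a keeps its whole mass inside
  -- (0,T).
  filter_upwards [eventually_gt_atTop (0 : ℝ), hk1.eventually (gt_mem_nhds hδ),
    hk1.eventually (gt_mem_nhds (sub_pos.2 ha.2))] with k hk hkδ hkT
  set ρ : ℝ → ℝ := fun t => k * deriv Real.smoothTransition (k * (t - a)) with hρ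
  have hρc : Continuous ρ :=
    continuous_const.mul (continuous_deriv_smoothTransition.comp (by fun_prop))
  have hρ0 : ∀ t, 0 ≤ ρ t := fun t => mul_nonneg hk.le (deriv_smoothTransition_nonneg _)
  have hT : (0 : ℝ) ≤ T := (ha.1.trans ha.2).le
  have hρi : ∫ t in Ioo 0 T, ρ t = 1 := by
    rw [← integral_Ioc_eq_integral_Ioo, ← intervalIntegral.integral_of_le hT,
      intervalIntegral.integral_eq_sub_of_hasDerivAt
        (fun t _ => hasDerivAt_smoothTransition_comp k a t) (hρc.intervalIntegrable _ _),
      Real.smoothTransition.one_of_one_le, Real.smoothTransition.zero_of_nonpos, sub_zero]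
    · nlinarith [ha.1]
    · rw [one_div_lt hk (sub_pos.2 ha.2)] at hkT
      rw [one_div, inv_lt_iff_one_lt_mul₀ (sub_pos.2 ha.2)] at hkT
      exact hkT.le
  have hρI : IntegrableOn (fun t => (ρ t : 𝕜)) (Ioo 0 T) :=
    ((RCLike.continuous_ofReal.comp hρc).integrableOn_Icc).mono_set Ioo_subset_Icc_self
  have hρI' : IntegrableOn ρ (Ioo 0 T) := hρc.integrableOn_Icc.mono_set Ioo_subset_Icc_self
  have hfI : IntegrableOn (fun t => (ρ t : 𝕜) * f t) (Ioo 0 T) :=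
    (((RCLike.continuous_ofReal.comp hρc).continuousOn.mul hf).integrableOn_Icc).mono_set
      Ioo_subset_Icc_self
  have e : (∫ t in Ioo 0 T, (ρ t : 𝕜) * f t) - f a = ∫ t in Ioo 0 T, (ρ t : 𝕜) * (f t - f a) := by
    simp only [mul_sub]
    rw [integral_sub hfI (hρI.mul_const _), integral_mul_const, integral_ofReal, hρi]
    simp
  rw [dist_eq_norm]
  change ‖(∫ t in Ioo 0 T, (ρ t : 𝕜) * f t) - f a‖ < ε
  rw [e]
  calc _ ≤ ∫ t in Ioo 0 T, ρ t * (ε / 2) := by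
        refine norm_integral_le_of_norm_le (hρI'.mul_const _) ?_
        refine Eventually.of_forall fun t => ?_
        rw [norm_mul, RCLike.norm_ofReal, abs_of_nonneg (hρ0 t)]
        by_cases h : dist t a < δ
        · gcongr
          · exact hρ0 t
          · rw [← dist_eq_norm]; exact (hfδ h).le
        · have h0 : ρ t = 0 := by
            rw [hρ]
            simp only [mul_eq_zero]
            right
            rw [Real.dist_eq, not_lt] at h
            rcases le_abs.1 h with h | h
            · apply deriv_smoothTransition_of_one_lt
              rw [← div_lt_iff₀' hk]; linarith
            · apply deriv_smoothTransition_of_neg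
              nlinarith
          simp [h0]
    _ = ε / 2 := by rw [integral_mul_const, hρi, one_mul]
    _ < ε := half_lt_self hε

/-- Each transition starting at c is 0 at c itself and eventually 1 at every later point, which is
why the limiting interval is open on the left and closed on the right. -/
theorem tendsto_smoothTransition_sub {a b : ℝ} (hab : a ≤ b) (t : ℝ) :
    Tendsto (fun k : ℝ => Real.smoothTransition (k * (t - a)) - Real.smoothTransition (k * (t - b)))
      atTop (𝓝 (indicator (Ioc a b) (fun _ => 1) t)) := by
  have h0 : ∀ c, t ≤ c → ∀ᶠ k : ℝ in atTop, Real.smoothTransition (k * (t - c)) = 0 := by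
    intro c hc
    filter_upwards [eventually_ge_atTop (0 : ℝ)] with k hk
    exact Real.smoothTransition.zero_of_nonpos (by nlinarith)
  have h1 : ∀ c, c < t → ∀ᶠ k : ℝ in atTop, Real.smoothTransition (k * (t - c)) = 1 := by
    intro c hc
    filter_upwards [eventually_ge_atTop (1 / (t - c))] with k hk
    exact Real.smoothTransition.one_of_one_le (by rwa [div_le_iff₀ (sub_pos.2 hc)] at hk)
  apply tendsto_nhds_of_eventually_eq
  rcases le_or_gt t a with h | h
  · filter_upwards [h0 a h, h0 b (h.trans hab)] with k e1 e2
    rw [e1, e2, indicator_of_notMem (fun hm => absurd hm.1 (not_lt.2 h)), sub_zero]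
  · rcases le_or_gt t b with h' | h'
    · filter_upwards [h1 a h, h0 b h'] with k e1 e2
      rw [e1, e2, indicator_of_mem (show t ∈ Ioc a b from ⟨h, h'⟩), sub_zero]
    · filter_upwards [h1 a h, h1 b h'] with k e1 e2
      rw [e1, e2, indicator_of_notMem (fun hm => absurd hm.2 (not_le.2 h')), sub_self]

end Transition

/-! ### Distributional derivatives of continuous functions -/

namespace HasDistribDeriv

variable {𝕜 : Type*} [RCLike 𝕜] {T : ℝ} {f g : ℝ → 𝕜}

/-- Test with σ(k(t - a)) - σ(k(t - b)), which tends to the indicator of (a,b] while its derivative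
tends to δ_a - δ_b. Its support lies in [a, b + 1/k], inside (0,T) for large k. -/
theorem sub_eq_integral_of_mem_Ioo (h : HasDistribDeriv T f g) (hf : ContinuousOn f (Icc 0 T))
    (hg : IntegrableOn g (Ioo 0 T)) {a b : ℝ} (ha : 0 < a) (hab : a ≤ b) (hb : b < T) :
    f b - f a = ∫ t in a..b, g t := by
  set θ : ℝ → ℝ → ℝ := fun k t =>
    Real.smoothTransition (k * (t - a)) - Real.smoothTransition (k * (t - b)) with hθ
  have hθd : ∀ k t, deriv (θ k) t = k * deriv Real.smoothTransition (k * (t - a))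
      - k * deriv Real.smoothTransition (k * (t - b)) := fun k t =>
    ((hasDerivAt_smoothTransition_comp k a t).sub (hasDerivAt_smoothTransition_comp k b t)).deriv
  have hθs : ∀ k, ContDiff ℝ ∞ (θ k) := fun k =>
    (Real.smoothTransition.contDiff.comp (by fun_prop)).sub
      (Real.smoothTransition.contDiff.comp (by fun_prop))
  have hint : ∀ (k c : ℝ), IntegrableOn (fun t =>
      ((k * deriv Real.smoothTransition (k * (t - c)) : ℝ) : 𝕜) * f t) (Ioo 0 T) := fun k c =>
    (((RCLike.continuous_ofReal.comp (continuous_const.mul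
      (continuous_deriv_smoothTransition.comp (by fun_prop)))).continuousOn.mul
        hf).integrableOn_Icc).mono_set Ioo_subset_Icc_self
  have l1 : Tendsto (fun k : ℝ => ∫ t in Ioo 0 T, ((deriv (θ k) t : ℝ) : 𝕜) * f t) atTop
      (𝓝 (f a - f b)) := by
    refine ((tendsto_integral_deriv_smoothTransition ⟨ha, hab.trans_lt hb⟩ hf).sub
      (tendsto_integral_deriv_smoothTransition ⟨ha.trans_le hab, hb⟩ hf)).congr fun k => ?_
    rw [← integral_sub (hint k a) (hint k b)]
    refine integral_congr_ae (Eventually.of_forall fun t => ?_)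
    simp only [hθd, RCLike.ofReal_sub, sub_mul]
  have l2 : Tendsto (fun k : ℝ => ∫ t in Ioo 0 T, ((θ k t : ℝ) : 𝕜) * g t) atTop
      (𝓝 (∫ t in Ioo 0 T, ((indicator (Ioc a b) (fun _ => 1) t : ℝ) : 𝕜) * g t)) := by
    refine tendsto_integral_filter_of_dominated_convergence (fun t => ‖g t‖) ?_ ?_ hg.norm ?_
    · refine Eventually.of_forall fun k => ?_
      exact ((RCLike.continuous_ofReal.comp (hθs k).continuous).aestronglyMeasurable).mul
        hg.aestronglyMeasurable
    · refine Eventually.of_forall fun k => Eventually.of_forall fun t => ?_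
      rw [norm_mul, RCLike.norm_ofReal]
      refine mul_le_of_le_one_left (norm_nonneg _) (abs_le.2 ⟨?_, ?_⟩) <;>
      linarith [Real.smoothTransition.nonneg (k * (t - a)), Real.smoothTransition.le_one (k * (t - a)),
        Real.smoothTransition.nonneg (k * (t - b)), Real.smoothTransition.le_one (k * (t - b))]
    · refine Eventually.of_forall fun t => ?_
      exact ((RCLike.continuous_ofReal.tendsto _).comp (tendsto_smoothTransition_sub hab t)).mul_const _
  have e2 : (∫ t in Ioo 0 T, ((indicator (Ioc a b) (fun _ => 1) t : ℝ) : 𝕜) * g t)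
      = ∫ t in a..b, g t := by
    rw [intervalIntegral.integral_of_le hab]
    have : ∀ t, ((indicator (Ioc a b) (fun _ => 1) t : ℝ) : 𝕜) * g t = indicator (Ioc a b) g t := by
      intro t
      by_cases ht : t ∈ Ioc a b <;> simp [ht]
    simp only [this]
    rw [setIntegral_indicator measurableSet_Ioc, inter_eq_self_of_subset_right]
    exact fun t ht => ⟨ha.trans ht.1, ht.2.trans_lt hb⟩
  rw [e2] at l2
  have l3 := l1.congr' (f₂ := fun k : ℝ => -∫ t in Ioo 0 T, ((θ k t : ℝ) : 𝕜) * g t) <| by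
    have hk1 : Tendsto (fun k : ℝ => 1 / k) atTop (𝓝 0) := by
      simpa using tendsto_inv_atTop_zero (𝕜 := ℝ)
    filter_upwards [eventually_gt_atTop (0 : ℝ), hk1.eventually (gt_mem_nhds (sub_pos.2 hb))]
      with k hk hkT
    have hsupp : Function.support (θ k) ⊆ Icc a (b + 1 / k) := by
      intro t ht
      by_contra hn
      apply ht
      rw [mem_Icc, not_and_or, not_le, not_le] at hn
      rcases hn with hn | hn
      · simp only [hθ]
        rw [Real.smoothTransition.zero_of_nonpos, Real.smoothTransition.zero_of_nonpos, sub_zero]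
          <;> nlinarith
      · have h1 : 1 ≤ k * (t - b) := by
          rw [← div_le_iff₀' hk]; linarith
        simp only [hθ]
        rw [Real.smoothTransition.one_of_one_le, Real.smoothTransition.one_of_one_le, sub_self]
        · exact h1
        · nlinarith
    refine h (θ k) (hθs k) (HasCompactSupport.of_support_subset_isCompact isCompact_Icc hsupp) ?_
    refine (closure_minimal hsupp isClosed_Icc).trans fun t ht => ⟨ha.trans_le ht.1, ?_⟩
    linarith [ht.2]
  have := tendsto_nhds_unique l3 l2.neg
  rw [← neg_sub, this, neg_neg]

/-- In the open interval f minus the primitive of g is constant, by comparison with the midpoint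
T/2; continuity of both carries this to the endpoints. -/
theorem eq_add_integral (h : HasDistribDeriv T f g) (hf : ContinuousOn f (Icc 0 T))
    (hg : IntegrableOn g (Ioo 0 T)) {t : ℝ} (ht : t ∈ Icc 0 T) :
    f t = f 0 + ∫ s in (0:ℝ)..t, g s := by
  rcases eq_or_lt_of_le (ht.1.trans ht.2) with hT | hT
  · have : t = 0 := le_antisymm (hT ▸ ht.2) ht.1
    simp [this]
  have hgI : IntegrableOn g (uIcc 0 T) := by
    rw [uIcc_of_le hT.le]
    exact (integrableOn_Icc_iff_integrableOn_Ioo (by finiteness) (by finiteness)).2 hg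
  have hG : ContinuousOn (fun t => ∫ s in (0:ℝ)..t, g s) (Icc 0 T) := by
    have := intervalIntegral.continuousOn_primitive_interval hgI
    rwa [uIcc_of_le hT.le] at this
  have hi : ∀ x y, x ∈ Icc 0 T → y ∈ Icc 0 T → IntervalIntegrable g volume x y := fun x y hx hy =>
    (hgI.mono_set (by
      rw [uIcc_of_le hT.le]
      exact (ordConnected_Icc.uIcc_subset hx hy))).intervalIntegrable
  have key : EqOn (fun t => f t - ∫ s in (0:ℝ)..t, g s)
      (fun _ => f (T / 2) - ∫ s in (0:ℝ)..(T / 2), g s) (Ioo 0 T) := by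
    intro s hs
    have h0 : (0 : ℝ) ∈ Icc 0 T := ⟨le_rfl, hT.le⟩
    have hm : T / 2 ∈ Icc 0 T := ⟨by linarith, by linarith⟩
    have hs' := Ioo_subset_Icc_self hs
    have e : f s - f (T / 2) = ∫ r in (T / 2)..s, g r := by
      rcases le_total s (T / 2) with hc | hc
      · have := h.sub_eq_integral_of_mem_Ioo hf hg hs.1 hc (by linarith)
        rw [intervalIntegral.integral_symm, ← this, neg_sub]
      · exact h.sub_eq_integral_of_mem_Ioo hf hg (by linarith) hc hs.2
    have e2 := intervalIntegral.integral_add_adjacent_intervals (hi _ _ h0 hm) (hi _ _ hm hs')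
    simp only
    rw [← e2, ← e]
    ring
  have key2 := key.of_subset_closure (hf.sub hG) continuousOn_const Ioo_subset_Icc_self
    (by rw [closure_Ioo hT.ne])
  have e1 := key2 ht
  have e2 := key2 (show (0 : ℝ) ∈ Icc 0 T from ⟨le_rfl, hT.le⟩)
  simp only [intervalIntegral.integral_same, sub_zero] at e1 e2
  rw [e2, ← e1]
  ring

theorem of_hasDerivAt (hf : ContinuousOn f (Icc 0 T)) (hg : ContinuousOn g (Icc 0 T))
    (hd : ∀ t ∈ Ioo 0 T, HasDerivAt f (g t) t) : HasDistribDeriv T f g := by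
  intro θ hθ _ hs
  rcases le_or_gt T 0 with hT | hT
  · simp [Ioo_eq_empty_of_le hT]
  have hz : ∀ t, t ∉ Ioo 0 T → θ t = 0 := fun t ht => image_eq_zero_of_notMem_tsupport fun h => ht (hs h)
  have hθ' : Continuous (deriv θ) := hθ.continuous_deriv (by norm_num)
  have i1 : IntegrableOn (fun t => ((deriv θ t : ℝ) : 𝕜) * f t) (Ioo 0 T) :=
    (((RCLike.continuous_ofReal.comp hθ').continuousOn.mul hf).integrableOn_Icc).mono_set
      Ioo_subset_Icc_self
  have i2 : IntegrableOn (fun t => ((θ t : ℝ) : 𝕜) * g t) (Ioo 0 T) :=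
    (((RCLike.continuous_ofReal.comp hθ.continuous).continuousOn.mul hg).integrableOn_Icc).mono_set
      Ioo_subset_Icc_self
  rw [eq_neg_iff_add_eq_zero, ← integral_add i1 i2, ← integral_Ioc_eq_integral_Ioo,
    ← intervalIntegral.integral_of_le hT.le]
  rw [intervalIntegral.integral_eq_sub_of_hasDerivAt_of_le hT.le
    (f := fun t => ((θ t : ℝ) : 𝕜) * f t), hz T (by simp), hz 0 (by simp)]
  · simp
  · exact (RCLike.continuous_ofReal.comp hθ.continuous).continuousOn.mul hf
  · intro t ht
    have h1 : HasDerivAt θ (deriv θ t) t := (hθ.differentiable (by simp) t).hasDerivAt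
    have h2 := h1.smul (hd t ht)
    simp only [RCLike.real_smul_eq_coe_mul] at h2
    rw [add_comm]
    exact h2.congr_of_eventuallyEq
      (Eventually.of_forall fun s => (RCLike.real_smul_eq_coe_mul _ _).symm)
  · rw [intervalIntegrable_iff_integrableOn_Ioo_of_le hT.le]
    exact i1.add i2

theorem _root_.tendsto_integral_mul_of_tendsto_integral_norm_sub {α ι : Type*} [MeasurableSpace α]
    {μ : Measure α} {l : Filter ι} {η : α → ℝ} {C : ℝ}
    (hη : AEStronglyMeasurable η μ) (hC : ∀ t, |η t| ≤ C) {F : ι → α → 𝕜} {F' : α → 𝕜}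
    (hF : ∀ n, Integrable (F n) μ) (hF' : Integrable F' μ)
    (h : Tendsto (fun n => ∫ t, ‖F n t - F' t‖ ∂μ) l (𝓝 0)) :
    Tendsto (fun n => ∫ t, ((η t : ℝ) : 𝕜) * F n t ∂μ) l (𝓝 (∫ t, ((η t : ℝ) : 𝕜) * F' t ∂μ)) := by
  have hm : AEStronglyMeasurable (fun t => (η t : 𝕜)) μ :=
    RCLike.continuous_ofReal.comp_aestronglyMeasurable hη
  have hi : ∀ {G : α → 𝕜}, Integrable G μ → Integrable (fun t => ((η t : ℝ) : 𝕜) * G t) μ :=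
    fun hG => hG.bdd_mul hm (c := C) (Eventually.of_forall fun t => by simpa using hC t)
  rw [tendsto_iff_norm_sub_tendsto_zero]
  have h' := h.const_mul C
  rw [mul_zero] at h'
  refine squeeze_zero (fun _ => norm_nonneg _) (fun n => ?_) h'
  rw [← integral_sub (hi (hF n)) (hi hF'), ← integral_const_mul]
  refine norm_integral_le_of_norm_le (((hF n).sub hF').norm.const_mul C) ?_
  refine Eventually.of_forall fun t => ?_
  rw [← mul_sub, norm_mul, RCLike.norm_ofReal]
  gcongr
  exact hC t

theorem of_tendsto {F G : ℕ → ℝ → 𝕜} (h : ∀ n, HasDistribDeriv T (F n) (G n))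
    (hF : ∀ n, IntegrableOn (F n) (Ioo 0 T)) (hf : IntegrableOn f (Ioo 0 T))
    (hG : ∀ n, IntegrableOn (G n) (Ioo 0 T)) (hg : IntegrableOn g (Ioo 0 T))
    (hFf : Tendsto (fun n => ∫ t in Ioo 0 T, ‖F n t - f t‖) atTop (𝓝 0))
    (hGg : Tendsto (fun n => ∫ t in Ioo 0 T, ‖G n t - g t‖) atTop (𝓝 0)) :
    HasDistribDeriv T f g := by
  intro θ hθ hc hs
  have hθ' : Continuous (deriv θ) := hθ.continuous_deriv (by norm_num)
  obtain ⟨C, hC⟩ := hc.exists_bound_of_continuous hθ.continuous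
  obtain ⟨C', hC'⟩ := hc.deriv.exists_bound_of_continuous hθ'
  have l1 := tendsto_integral_mul_of_tendsto_integral_norm_sub
    hθ'.aestronglyMeasurable hC' hF hf hFf
  have l2 := tendsto_integral_mul_of_tendsto_integral_norm_sub
    hθ.continuous.aestronglyMeasurable hC hG hg hGg
  exact tendsto_nhds_unique (l1.congr fun n => h n θ hθ hc hs) l2.neg

end HasDistribDeriv

/-! ### From weak formulations to variation of constants -/

/-- Cut [0,T] into equal steps shorter than δ: the estimates telescope to ε(m(T) - m(0)), and ε → 0.
It replaces a zero-derivative argument for a function k that need not be differentiable. -/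
theorem eq_of_norm_sub_le_mul_sub {E : Type*} [NormedAddCommGroup E] {T : ℝ} (hT : 0 ≤ T)
    {k : ℝ → E} {m : ℝ → ℝ}
    (h : ∀ ε > 0, ∃ δ > 0, ∀ a b, 0 ≤ a → a ≤ b → b ≤ T → b - a < δ →
      ‖k b - k a‖ ≤ ε * (m b - m a)) : k T = k 0 := by
  have key : ∀ ε > 0, ‖k T - k 0‖ ≤ ε * (m T - m 0) := by
    intro ε hε
    obtain ⟨δ, hδ, h⟩ := h ε hε
    obtain ⟨n, hn⟩ := exists_nat_gt (T / δ)
    have hn0 : (0 : ℝ) < n := lt_of_le_of_lt (by positivity) hn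
    have hstep : T / n < δ := by
      rw [div_lt_iff₀ hδ] at hn
      rwa [div_lt_iff₀ hn0, mul_comm]
    have e : ∀ i : ℕ, i ≤ n → ‖k (i * (T / n)) - k 0‖ ≤ ε * (m (i * (T / n)) - m 0) := by
      intro i
      induction i with
      | zero => simp
      | succ i ih =>
        intro hi
        have h1 := ih (by omega)
        have hi' : ((i : ℝ) + 1) ≤ n := by exact_mod_cast hi
        have hTn : 0 ≤ T / n := by positivity
        have h2 := h (i * (T / n)) ((i + 1 : ℕ) * (T / n)) (by positivity)
          (by push_cast; nlinarith)
          (by push_cast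
              calc ((i : ℝ) + 1) * (T / n) ≤ n * (T / n) := by gcongr
                _ = T := by field_simp)
          (by push_cast; linarith)
        calc _ = ‖(k ((i + 1 : ℕ) * (T / n)) - k (i * (T / n))) + (k (i * (T / n)) - k 0)‖ := by
              congr 1; abel
          _ ≤ _ := norm_add_le _ _
          _ ≤ _ := add_le_add h2 h1
          _ = _ := by ring
    have := e n le_rfl
    rwa [mul_div_cancel₀ _ hn0.ne'] at this
  have h0 : ‖k T - k 0‖ ≤ 0 := by
    have l : Tendsto (fun ε : ℝ => ε * (m T - m 0)) (𝓝[>] 0) (𝓝 0) := by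
      have : Continuous (fun ε : ℝ => ε * (m T - m 0)) := by fun_prop
      simpa using (this.tendsto 0).mono_left nhdsWithin_le_nhds
    exact ge_of_tendsto l (eventually_mem_nhdsWithin.mono fun ε hε => key ε hε)
  rwa [norm_le_zero_iff, sub_eq_zero] at h0

theorem ContinuousOn.exists_dist_lt_of_Icc {E : Type*} [PseudoMetricSpace E] {f : ℝ → E}
    {a b : ℝ} (hf : ContinuousOn f (Icc a b)) {ε : ℝ} (hε : 0 < ε) :
    ∃ δ > 0, ∀ s ∈ Icc a b, ∀ t ∈ Icc a b, dist s t < δ → dist (f s) (f t) < ε := by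
  obtain ⟨δ, hδ, h⟩ := Metric.uniformContinuousOn_iff.1
    (isCompact_Icc.uniformContinuousOn_of_continuous hf) ε hε
  exact ⟨δ, hδ, fun s hs t ht hst => h s hs t ht hst⟩

section Mild

variable {𝕜 H U : Type*} [RCLike 𝕜] [NormedAddCommGroup H] [InnerProductSpace 𝕜 H]
  [CompleteSpace H] [NormedSpace ℝ H] [NormedAddCommGroup U] [InnerProductSpace 𝕜 U]

theorem integrableOn_inner_of_continuousOn {r u : ℝ → U} {T : ℝ} (hr : ContinuousOn r (Icc 0 T))
    (hu : IntegrableOn u (Ioo 0 T)) : IntegrableOn (fun s => inner 𝕜 (r s) (u s)) (Ioo 0 T) := by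
  obtain ⟨C, hC⟩ := isCompact_Icc.exists_bound_of_continuousOn hr
  refine (hu.norm.const_mul C).mono' (((hr.mono Ioo_subset_Icc_self).aestronglyMeasurable
    measurableSet_Ioo).inner hu.aestronglyMeasurable) ?_
  filter_upwards [ae_restrict_mem measurableSet_Ioo] with s hs
  exact (norm_inner_le_norm _ _).trans (by gcongr; exact hC s (Ioo_subset_Icc_self hs))

theorem intervalIntegrable_of_integrableOn_Ioo {E : Type*} [NormedAddCommGroup E] {f : ℝ → E}
    {T a b : ℝ} (h : IntegrableOn f (Ioo 0 T)) (ha : a ∈ Icc 0 T) (hb : b ∈ Icc 0 T) :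
    IntervalIntegrable f volume a b := by
  have : IntegrableOn f (Icc 0 T) :=
    (integrableOn_Icc_iff_integrableOn_Ioo (by finiteness) (by finiteness)).2 h
  exact (this.mono_set (ordConnected_Icc.uIcc_subset ha hb)).intervalIntegrable

/-- A weak formulation against a family of test vectors `p τ`, moving along `p' = -q`, gives the
variation of constants formula. -/
theorem inner_eq_add_integral_of_weak {T : ℝ} (hT : 0 ≤ T) {p q y : ℝ → H} {r u : ℝ → U}
    (hp : ∀ t, HasDerivAt p (-q t) t) (hq : Continuous q) (hr : Continuous r)
    (hy : ContinuousOn y (Icc 0 T)) (hu : IntegrableOn u (Ioo 0 T))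
    (heq : ∀ τ a b, 0 ≤ a → a ≤ b → b ≤ T → inner 𝕜 (p τ) (y b) - inner 𝕜 (p τ) (y a)
      = ∫ s in a..b, (inner 𝕜 (q τ) (y s) + inner 𝕜 (r τ) (u s))) :
    inner 𝕜 (p T) (y T) = inner 𝕜 (p 0) (y 0) + ∫ s in (0:ℝ)..T, inner 𝕜 (r s) (u s) := by
  obtain ⟨Cy, hCy⟩ := isCompact_Icc.exists_bound_of_continuousOn hy
  obtain ⟨Cq, hCq⟩ := isCompact_Icc.exists_bound_of_continuousOn (hq.continuousOn (s := Icc 0 T))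
  have h0 : (0 : ℝ) ∈ Icc 0 T := ⟨le_rfl, hT⟩
  have hCy0 : 0 ≤ Cy := (norm_nonneg _).trans (hCy 0 h0)
  have hCq0 : 0 ≤ Cq := (norm_nonneg _).trans (hCq 0 h0)
  have hIr := integrableOn_inner_of_continuousOn (𝕜 := 𝕜) hr.continuousOn hu
  have hIm : IntegrableOn (fun s => Cy + Cq + ‖u s‖) (Ioo 0 T) :=
    (integrableOn_const (by simp)).add hu.norm
  -- The claim is that this k has equal values at 0 and T. The density Cy + Cq + ‖u‖ of m collects
  -- the factors that multiply ε in the three error terms below.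
  have main := eq_of_norm_sub_le_mul_sub hT
    (k := fun t => inner 𝕜 (p t) (y t) - ∫ s in (0:ℝ)..t, inner 𝕜 (r s) (u s))
    (m := fun t => ∫ s in (0:ℝ)..t, (Cy + Cq + ‖u s‖)) ?_
  · simp only [intervalIntegral.integral_same, sub_zero] at main
    rw [← main]; ring
  intro ε hε
  obtain ⟨δ1, hδ1, h1⟩ := (hq.continuousOn (s := Icc 0 T)).exists_dist_lt_of_Icc hε
  obtain ⟨δ2, hδ2, h2⟩ := (hr.continuousOn (s := Icc 0 T)).exists_dist_lt_of_Icc hε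
  obtain ⟨δ3, hδ3, h3⟩ := hy.exists_dist_lt_of_Icc hε
  refine ⟨min δ1 (min δ2 δ3), by positivity, fun a b ha hab hb hd => ?_⟩
  have hd1 : b - a < δ1 := hd.trans_le (min_le_left _ _)
  have hd2 : b - a < δ2 := hd.trans_le ((min_le_right _ _).trans (min_le_left _ _))
  have hd3 : b - a < δ3 := hd.trans_le ((min_le_right _ _).trans (min_le_right _ _))
  have ham : a ∈ Icc 0 T := ⟨ha, hab.trans hb⟩
  have hbm : b ∈ Icc 0 T := ⟨ha.trans hab, hb⟩
  have hsub : uIcc a b ⊆ Icc 0 T := ordConnected_Icc.uIcc_subset ham hbm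
  have iy : IntervalIntegrable (fun s => inner 𝕜 (q a) (y s) + inner 𝕜 (r a) (u s)) volume a b :=
    ((continuousOn_const.inner (hy.mono hsub)).intervalIntegrable).add
      (intervalIntegrable_of_integrableOn_Ioo
        (integrableOn_inner_of_continuousOn continuousOn_const hu) ham hbm)
  have ir : IntervalIntegrable (fun s => inner 𝕜 (r s) (u s)) volume a b :=
    intervalIntegrable_of_integrableOn_Ioo hIr ham hbm
  have iq : IntervalIntegrable (fun s => inner 𝕜 (q s) (y b)) volume a b :=
    (hq.inner continuous_const).intervalIntegrable _ _
  have ep : inner 𝕜 (p b) (y b) - inner 𝕜 (p a) (y b) = ∫ s in a..b, -inner 𝕜 (q s) (y b) := by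
    rw [intervalIntegral.integral_eq_sub_of_hasDerivAt (f := fun s => inner 𝕜 (p s) (y b))]
    · intro s _
      have := (hp s).inner 𝕜 (hasDerivAt_const s (y b))
      simpa using this
    · exact iq.neg
  have er := intervalIntegral.integral_add_adjacent_intervals
    (intervalIntegrable_of_integrableOn_Ioo hIr h0 ham) ir
  have em := intervalIntegral.integral_add_adjacent_intervals
    (intervalIntegrable_of_integrableOn_Ioo hIm h0 ham)
    (intervalIntegrable_of_integrableOn_Ioo hIm ham hbm)
  -- The weak equation is used with the test vector frozen at the left endpoint a. What remains
  -- involves only q(a) - q(s), y(s) - y(b) and r(a) - r(s), all small by uniform continuity.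
  have e : inner 𝕜 (p b) (y b) - (∫ s in (0:ℝ)..b, inner 𝕜 (r s) (u s))
      - (inner 𝕜 (p a) (y a) - ∫ s in (0:ℝ)..a, inner 𝕜 (r s) (u s))
      = ∫ s in a..b, (-inner 𝕜 (q s) (y b) + (inner 𝕜 (q a) (y s) + inner 𝕜 (r a) (u s))
        - inner 𝕜 (r s) (u s)) := by
    have i1 : IntervalIntegrable (fun s => -inner 𝕜 (q s) (y b)) volume a b := iq.neg
    rw [intervalIntegral.integral_sub (i1.add iy) ir, intervalIntegral.integral_add i1 iy,
      ← ep, ← heq a a b ha hab hb, ← er]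
    ring
  simp only [← em, add_sub_cancel_left]
  rw [e, ← intervalIntegral.integral_const_mul]
  refine intervalIntegral.norm_integral_le_of_norm_le hab ?_
    ((intervalIntegrable_of_integrableOn_Ioo hIm ham hbm).const_mul ε)
  refine Eventually.of_forall fun s hs => ?_
  have hsm : s ∈ Icc 0 T := ⟨ha.trans hs.1.le, hs.2.trans hb⟩
  have das : dist a s ≤ b - a := by
    rw [Real.dist_eq, abs_le]; constructor <;> linarith [hs.1, hs.2]
  have dsb : dist s b ≤ b - a := by
    rw [Real.dist_eq, abs_le]; constructor <;> linarith [hs.1, hs.2]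
  have b1 := h1 a ham s hsm (das.trans_lt hd1)
  have b2 := h2 a ham s hsm (das.trans_lt hd2)
  have b3 := h3 s hsm b hbm (dsb.trans_lt hd3)
  rw [dist_eq_norm] at b1 b2 b3
  have e3 : -inner 𝕜 (q s) (y b) + (inner 𝕜 (q a) (y s) + inner 𝕜 (r a) (u s))
      - inner 𝕜 (r s) (u s) = inner 𝕜 (q a - q s) (y b) + inner 𝕜 (q a) (y s - y b)
        + inner 𝕜 (r a - r s) (u s) := by
    simp only [inner_sub_left, inner_sub_right]; ring
  rw [e3]
  calc _ ≤ ‖inner 𝕜 (q a - q s) (y b)‖ + ‖inner 𝕜 (q a) (y s - y b)‖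
        + ‖inner 𝕜 (r a - r s) (u s)‖ := norm_add₃_le
    _ ≤ ε * Cy + Cq * ε + ε * ‖u s‖ := by
        refine add_le_add (add_le_add ?_ ?_) ?_ <;> refine (norm_inner_le_norm _ _).trans ?_
        · gcongr; exact hCy b hbm
        · gcongr; exact hCq a ham
        · gcongr
    _ = ε * (Cy + Cq + ‖u s‖) := by ring

end Mild

theorem HasDistribDeriv.sub {𝕜 : Type*} [RCLike 𝕜] {T : ℝ} {f g f' g' : ℝ → 𝕜}
    (h : HasDistribDeriv T f g) (h' : HasDistribDeriv T f' g')
    (hf : IntegrableOn f (Ioo 0 T)) (hf' : IntegrableOn f' (Ioo 0 T))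
    (hg : IntegrableOn g (Ioo 0 T)) (hg' : IntegrableOn g' (Ioo 0 T)) :
    HasDistribDeriv T (fun t => f t - f' t) (fun t => g t - g' t) := by
  intro θ hθ hc hs
  have hθ' : Continuous (deriv θ) := hθ.continuous_deriv (by norm_num)
  have hi : ∀ {η : ℝ → ℝ} {k : ℝ → 𝕜}, Continuous η → HasCompactSupport η →
      IntegrableOn k (Ioo 0 T) → IntegrableOn (fun t => ((η t : ℝ) : 𝕜) * k t) (Ioo 0 T) := by
    intro η k hη hηc hk
    obtain ⟨C, hC⟩ := hηc.exists_bound_of_continuous hη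
    exact hk.bdd_mul (RCLike.continuous_ofReal.comp hη).aestronglyMeasurable (c := C)
      (Eventually.of_forall fun t => by simpa using hC t)
  simp only [mul_sub]
  rw [integral_sub (hi hθ' hc.deriv hf) (hi hθ' hc.deriv hf'),
    integral_sub (hi hθ.continuous hc hg) (hi hθ.continuous hc hg'), h θ hθ hc hs, h' θ hθ hc hs]
  ring

/-! ### Variation of constants for the state and adjoint equations -/

namespace C0Group

variable {𝕜 H U : Type*} [RCLike 𝕜] [NormedAddCommGroup H] [InnerProductSpace 𝕜 H]
  [CompleteSpace H] [NormedAddCommGroup U] [InnerProductSpace 𝕜 U] [CompleteSpace U]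

theorem _root_.ContinuousOn.integrableOn_Ioo {E : Type*} [NormedAddCommGroup E] {f : ℝ → E}
    {a b : ℝ} (hf : ContinuousOn f (Icc a b)) : IntegrableOn f (Ioo a b) :=
  hf.integrableOn_Icc.mono_set Ioo_subset_Icc_self

theorem _root_.MeasureTheory.MemLp.integrableOn_Ioo {u : ℝ → U} {T : ℝ}
    (hu : MemLp u 2 (volume.restrict (Ioo 0 T))) : IntegrableOn u (Ioo 0 T) :=
  hu.integrable (by norm_num)

theorem IsAdjointWeakSolution.sub {S : C0Group 𝕜 H} {T : ℝ} {z₀ z₀' : H} {g g' z z' : ℝ → H}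
    (h : S.IsAdjointWeakSolution T z₀ g z) (h' : S.IsAdjointWeakSolution T z₀' g' z') :
    S.IsAdjointWeakSolution T (z₀ - z₀') (fun t => g t - g' t) (fun t => z t - z' t) where
  source := h.source.sub h'.source
  continuousOn := h.continuousOn.sub h'.continuousOn
  initial := by simp only [h.initial, h'.initial]
  equation φ := by
    have i : ∀ {z : ℝ → H} (x : H), ContinuousOn z (Icc 0 T) →
        IntegrableOn (fun t => inner 𝕜 x (z t)) (Ioo 0 T) := fun x hz =>
      (continuousOn_const.inner hz).integrableOn_Ioo
    have i' : ∀ {g : ℝ → H} (x : H), IntegrableOn g (Ioo 0 T) →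
        IntegrableOn (fun t => inner 𝕜 x (g t)) (Ioo 0 T) := fun x hg =>
      integrableOn_inner_of_continuousOn continuousOn_const hg
    have := (h.equation φ).sub (h'.equation φ) (i _ h.continuousOn) (i _ h'.continuousOn)
      ((i _ h.continuousOn).neg.add (i' _ h.source))
      ((i _ h'.continuousOn).neg.add (i' _ h'.source))
    convert this using 2 with t t
    · rw [inner_sub_right]
    · simp only [inner_sub_right]; ring

variable [NormedSpace ℝ H] [IsScalarTower ℝ 𝕜 H]

/-- Tested against the moving vector S(t - s)*φ, the drift term cancels and only the control term
survives. This gives uniqueness of the state and links controllability to the observation. -/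
theorem IsWeakSolution.inner_eq {S : C0Group 𝕜 H} {B : U →L[𝕜] S.DAdjDual} {T : ℝ} {y₀ : H}
    {u : ℝ → U} {y : ℝ → H} (h : S.IsWeakSolution B T y₀ u y) {t : ℝ} (ht : t ∈ Icc 0 T)
    (φ : S.DAdj) : inner 𝕜 (S.incl φ) (y t) = inner 𝕜 (S.adj t (S.incl φ)) y₀
      + ∫ s in (0:ℝ)..t, inner 𝕜 (S.Bstar B (S.adjApply (t - s) φ)) (u s) := by
  have hsub : Icc 0 t ⊆ Icc 0 T := Icc_subset_Icc_right ht.2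
  have hu := h.control.integrableOn_Ioo
  have hcont : Continuous fun s => S.adjApply (t - s) φ :=
    (S.continuous_adjApply φ).comp (continuous_const.sub continuous_id)
  have := inner_eq_add_integral_of_weak (𝕜 := 𝕜) (T := t) ht.1
    (p := fun s => S.adj (t - s) (S.incl φ)) (q := fun s => S.adj (t - s) (S.Astar φ))
    (r := fun s => S.Bstar B (S.adjApply (t - s) φ)) (y := y) (u := u)
    (fun s => (S.hasDerivAt_adj φ (t - s)).comp_const_sub t s)
    ((S.adj.continuous_apply _).comp (continuous_const.sub continuous_id))
    ((S.BstarL B).continuous.comp hcont) (h.continuousOn.mono hsub)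
    (hu.mono_set (Ioo_subset_Ioo_right ht.2))
    (fun τ a b ha hab hb => by
      have hI : IntegrableOn (fun s => inner 𝕜 (S.Astar (S.adjApply (t - τ) φ)) (y s)
          + inner 𝕜 (S.Bstar B (S.adjApply (t - τ) φ)) (u s)) (Ioo 0 T) :=
        ((continuousOn_const.inner h.continuousOn).integrableOn_Ioo).add
          (integrableOn_inner_of_continuousOn continuousOn_const hu)
      have hc : ContinuousOn (fun s => inner 𝕜 (S.incl (S.adjApply (t - τ) φ)) (y s)) (Icc 0 T) :=
        continuousOn_const.inner h.continuousOn
      have ham : a ∈ Icc 0 T := hsub ⟨ha, hab.trans hb⟩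
      have hbm : b ∈ Icc 0 T := hsub ⟨ha.trans hab, hb⟩
      have e1 := (h.equation (S.adjApply (t - τ) φ)).eq_add_integral hc hI ham
      have e2 := (h.equation (S.adjApply (t - τ) φ)).eq_add_integral hc hI hbm
      have e3 := intervalIntegral.integral_add_adjacent_intervals
        (intervalIntegrable_of_integrableOn_Ioo hI ⟨le_rfl, ham.1.trans ham.2⟩ ham)
        (intervalIntegrable_of_integrableOn_Ioo hI ham hbm)
      change inner 𝕜 (S.incl (S.adjApply (t - τ) φ)) (y b)
        - inner 𝕜 (S.incl (S.adjApply (t - τ) φ)) (y a) = _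
      rw [e1, e2, ← e3]
      simp only [add_sub_add_left_eq_sub, add_sub_cancel_left]
      rfl)
  simpa only [sub_self, sub_zero, S.adj.apply_zero, h.initial] using this

theorem IsWeakSolution.eqOn {S : C0Group 𝕜 H} {B : U →L[𝕜] S.DAdjDual} {T : ℝ} {y₀ : H}
    {u u' : ℝ → U} {y y' : ℝ → H} (h : S.IsWeakSolution B T y₀ u y)
    (h' : S.IsWeakSolution B T y₀ u' y') (hu : u =ᵐ[volume.restrict (Ioo 0 T)] u') :
    EqOn y y' (Icc 0 T) := by
  intro t ht
  apply S.eq_of_inner_incl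
  intro φ
  rw [h.inner_eq ht, h'.inner_eq ht]
  congr 1
  rw [intervalIntegral.integral_of_le ht.1, intervalIntegral.integral_of_le ht.1,
    integral_Ioc_eq_integral_Ioo, integral_Ioc_eq_integral_Ioo]
  refine integral_congr_ae ?_
  filter_upwards [ae_restrict_of_ae_restrict_of_subset (Ioo_subset_Ioo_right ht.2) hu] with s hs
  rw [hs]

/-- The homogeneous evolution is S(-t)*, so the test vector S(s)φ undoes it; the formula is
therefore stated for S(t)*z(t). -/
theorem IsAdjointWeakSolution.adj_apply_eq {S : C0Group 𝕜 H} {T : ℝ} {z₀ : H} {g z : ℝ → H}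
    (h : S.IsAdjointWeakSolution T z₀ g z) (hg : ContinuousOn g (Icc 0 T)) {t : ℝ}
    (ht : t ∈ Icc 0 T) : S.adj t (z t) = z₀ + ∫ s in (0:ℝ)..t, S.adj s (g s) := by
  have hsub : Icc 0 t ⊆ Icc 0 T := Icc_subset_Icc_right ht.2
  have hi : IntervalIntegrable (fun s => S.adj s (g s)) volume 0 t := by
    apply ContinuousOn.intervalIntegrable
    rw [uIcc_of_le ht.1]
    exact S.adj.continuousOn_apply_apply continuousOn_id (hg.mono hsub)
  apply S.eq_of_inner_domain
  intro φ
  rw [inner_add_right, ← inner_intervalIntegral_right hi]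
  have := inner_eq_add_integral_of_weak (𝕜 := 𝕜) (T := t) ht.1
    (p := fun s => S s (φ : H)) (q := fun s => -S s (S.generator φ))
    (r := fun s => S s (φ : H)) (y := z) (u := g)
    (fun s => by rw [neg_neg]; exact S.hasDerivAt_apply φ s)
    (S.continuous_apply _).neg (S.continuous_apply _) (h.continuousOn.mono hsub)
    (h.source.mono_set (Ioo_subset_Ioo_right ht.2))
    (fun τ a b ha hab hb => by
      set ψ : S.generator.domain := ⟨S τ (φ : H), S.apply_mem_domain τ φ⟩ with hψ
      have hI : IntegrableOn (fun s => -inner 𝕜 (S.generator ψ) (z s)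
          + inner 𝕜 (ψ : H) (g s)) (Ioo 0 T) :=
        ((continuousOn_const.inner h.continuousOn).neg.integrableOn_Ioo).add
          (integrableOn_inner_of_continuousOn continuousOn_const h.source)
      have hc : ContinuousOn (fun s => inner 𝕜 (ψ : H) (z s)) (Icc 0 T) :=
        continuousOn_const.inner h.continuousOn
      have ham : a ∈ Icc 0 T := hsub ⟨ha, hab.trans hb⟩
      have hbm : b ∈ Icc 0 T := hsub ⟨ha.trans hab, hb⟩
      have e1 := (h.equation ψ).eq_add_integral hc hI ham
      have e2 := (h.equation ψ).eq_add_integral hc hI hbm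
      have e3 := intervalIntegral.integral_add_adjacent_intervals
        (intervalIntegrable_of_integrableOn_Ioo hI ⟨le_rfl, ham.1.trans ham.2⟩ ham)
        (intervalIntegrable_of_integrableOn_Ioo hI ham hbm)
      change inner 𝕜 (ψ : H) (z b) - inner 𝕜 (ψ : H) (z a) = _
      rw [e1, e2, ← e3]
      simp only [add_sub_add_left_eq_sub, add_sub_cancel_left, inner_neg_left]
      rw [hψ, S.generator_apply])
  rw [S.apply_zero, h.initial] at this
  rw [S.adj_apply, ContinuousLinearMap.adjoint_inner_right, this]
  congr 1
  exact intervalIntegral.integral_congr fun s _ =>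
    (ContinuousLinearMap.adjoint_inner_right _ _ _).symm

/-- From z(t) = S(-t)*(z₀ + ∫₀ᵗ S(s)*g ds). Both S(-t)* and S(s)* occur, so the group is bounded on
[-T,T], and twice, hence M(1 + M). -/
theorem IsAdjointWeakSolution.exists_norm_le (S : C0Group 𝕜 H) (T : ℝ) : ∃ C : ℝ, 0 ≤ C ∧
    ∀ (z₀ : H) (g z : ℝ → H), S.IsAdjointWeakSolution T z₀ g z → ContinuousOn g (Icc 0 T) →
      ∀ t ∈ Icc 0 T, ‖z t‖ ≤ C * (‖z₀‖ + ∫ s in Ioo 0 T, ‖g s‖) := by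
  obtain ⟨M, hM0, hM⟩ := S.adj.exists_bound_Icc (-T) T
  refine ⟨M * (1 + M), by positivity, fun z₀ g z h hg t ht => ?_⟩
  have hsub : Icc 0 t ⊆ Icc 0 T := Icc_subset_Icc_right ht.2
  have e := h.adj_apply_eq hg ht
  have ez : z t = S.adj (-t) (S.adj t (z t)) := by
    rw [← S.adj.apply_add, neg_add_cancel, S.adj.apply_zero]
  have hI : ‖∫ s in (0:ℝ)..t, S.adj s (g s)‖ ≤ M * ∫ s in Ioo 0 T, ‖g s‖ := by
    rw [intervalIntegral.integral_of_le ht.1, integral_Ioc_eq_integral_Ioo, ← integral_const_mul]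
    have hgi : IntegrableOn (fun s => M * ‖g s‖) (Ioo 0 T) := h.source.norm.const_mul M
    calc _ ≤ ∫ s in Ioo 0 t, M * ‖g s‖ := by
          refine norm_integral_le_of_norm_le (hgi.mono_set (Ioo_subset_Ioo_right ht.2)) ?_
          filter_upwards [ae_restrict_mem measurableSet_Ioo] with s hs
          refine ((S.adj s).le_opNorm _).trans ?_
          gcongr
          exact hM s ⟨by linarith [hs.1, hs.2, ht.2], by linarith [hs.1, hs.2, ht.2]⟩
      _ ≤ _ := setIntegral_mono_set hgi (Eventually.of_forall fun s => by positivity)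
          (Ioo_subset_Ioo_right ht.2).eventuallyLE
  have hI0 : 0 ≤ ∫ s in Ioo 0 T, ‖g s‖ := integral_nonneg fun s => norm_nonneg _
  rw [ez, e]
  calc _ ≤ M * ‖z₀ + ∫ s in (0:ℝ)..t, S.adj s (g s)‖ :=
        ((S.adj (-t)).le_opNorm _).trans (by
          gcongr; exact hM _ ⟨by linarith [ht.2], by linarith [ht.1, ht.2]⟩)
    _ ≤ M * (‖z₀‖ + M * ∫ s in Ioo 0 T, ‖g s‖) := by
        gcongr; exact (norm_add_le _ _).trans (by gcongr)
    _ ≤ _ := by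
        rw [mul_assoc]
        gcongr
        nlinarith [norm_nonneg z₀]

end C0Group

/-! ### Functional analysis: inequalities by duality, coercive operators -/

/-- Uniform boundedness for the functionals ⟨F v, ·⟩ with ‖N v‖ ≤ 1. It serves twice with exchanged
roles: F the observation and N the inclusion for admissibility, the reverse for controllability. -/
theorem exists_norm_le_of_inner_bounded {𝕜 V X G : Type*} [RCLike 𝕜] [AddCommGroup V] [Module 𝕜 V]
    [NormedAddCommGroup X] [InnerProductSpace 𝕜 X] [CompleteSpace X] [NormedAddCommGroup G]
    [NormedSpace 𝕜 G] (F : V →ₗ[𝕜] X) (N : V →ₗ[𝕜] G)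
    (h : ∀ x : X, ∃ c : ℝ, 0 ≤ c ∧ ∀ v, ‖inner 𝕜 (F v) x‖ ≤ c * ‖N v‖) :
    ∃ C : ℝ, 0 ≤ C ∧ ∀ v, ‖F v‖ ≤ C * ‖N v‖ := by
  obtain ⟨C, hC⟩ := banach_steinhaus (g := fun v : {v : V // ‖N v‖ ≤ 1} => innerSL 𝕜 (F v))
    fun x => by
      obtain ⟨c, hc0, hc⟩ := h x
      exact ⟨c, fun v => (hc v).trans (mul_le_of_le_one_right hc0 v.2)⟩
  have hC' : ∀ v, ‖N v‖ ≤ 1 → ‖F v‖ ≤ C := fun v hv => by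
    simpa only [innerSL_apply_norm] using hC ⟨v, hv⟩
  have hC0 : 0 ≤ C := (norm_nonneg _).trans (hC' 0 (by simp))
  refine ⟨C, hC0, fun v => ?_⟩
  by_cases hv : ‖N v‖ = 0
  -- If N v = 0, all multiples of v stay in the unit ball of N, which forces F v = 0.
  · have hk : ∀ k : ℕ, k * ‖F v‖ ≤ C := fun k => by
      have := hC' ((k : 𝕜) • v) (by rw [map_smul, norm_smul, hv, mul_zero]; norm_num)
      rwa [map_smul, norm_smul, RCLike.norm_natCast] at this
    rw [hv, mul_zero]
    by_contra hF
    rw [not_le] at hF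
    obtain ⟨k, hk'⟩ := exists_nat_gt (C / ‖F v‖)
    rw [div_lt_iff₀ hF] at hk'
    linarith [hk k]
  · have := hC' (((‖N v‖⁻¹ : ℝ) : 𝕜) • v) (by
      rw [map_smul, norm_smul, RCLike.norm_ofReal, abs_of_nonneg (by positivity),
        inv_mul_cancel₀ hv])
    rw [map_smul, norm_smul, RCLike.norm_ofReal, abs_of_nonneg (by positivity),
      inv_mul_le_iff₀ (lt_of_le_of_ne (norm_nonneg _) (Ne.symm hv))] at this
    linarith

theorem Continuous.memLp_restrict_Ioo {E : Type*} [NormedAddCommGroup E]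
    {f : ℝ → E} (hf : Continuous f) (T : ℝ) : MemLp f 2 (volume.restrict (Ioo 0 T)) := by
  obtain ⟨C, hC⟩ := isCompact_Icc.exists_bound_of_continuousOn (hf.continuousOn (s := Icc 0 T))
  refine MemLp.of_bound hf.aestronglyMeasurable.restrict C ?_
  filter_upwards [ae_restrict_mem measurableSet_Ioo] with s hs
  exact hC s (Ioo_subset_Icc_self hs)

/-- The Lax–Milgram argument: coercivity bounds G below, so it is injective with closed range, and a
vector y orthogonal to the range has ⟨Gy, y⟩ = 0, hence y = 0. -/
theorem exists_equiv_of_coercive {𝕜 H : Type*} [RCLike 𝕜] [NormedAddCommGroup H]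
    [InnerProductSpace 𝕜 H] [CompleteSpace H] (G : H →L[𝕜] H) {c : ℝ} (hc : 0 < c)
    (h : ∀ x, c * ‖x‖ ^ 2 ≤ RCLike.re (inner 𝕜 (G x) x)) : ∃ Q : H ≃L[𝕜] H, ∀ x, Q x = G x := by
  have h1 : ∀ x, ‖x‖ ≤ c⁻¹ * ‖G x‖ := by
    intro x
    rw [le_inv_mul_iff₀ hc]
    by_cases hx : ‖x‖ = 0
    · rw [hx, mul_zero]; positivity
    · have h2 : c * ‖x‖ ^ 2 ≤ ‖G x‖ * ‖x‖ :=
        (h x).trans ((RCLike.re_le_norm _).trans (norm_inner_le_norm _ _))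
      have hx' : 0 < ‖x‖ := lt_of_le_of_ne (norm_nonneg _) (Ne.symm hx)
      rw [sq, ← mul_assoc] at h2
      exact le_of_mul_le_mul_right h2 hx'
  have hanti : AntilipschitzWith (Real.toNNReal c⁻¹) G :=
    AddMonoidHomClass.antilipschitz_of_bound G fun x => by
      rw [Real.coe_toNNReal _ (by positivity)]; exact h1 x
  have hker : LinearMap.ker G.toLinearMap = ⊥ := LinearMap.ker_eq_bot.2 hanti.injective
  have hclosed : IsClosed (LinearMap.range G.toLinearMap : Set H) := by
    have := hanti.isClosed_range G.uniformContinuous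
    exact this
  have hrange : LinearMap.range G.toLinearMap = ⊤ := by
    have hcomp := (Submodule.topologicalClosure_eq_top_iff
      (K := LinearMap.range G.toLinearMap)).2 (by
        rw [Submodule.eq_bot_iff]
        intro y hy
        have h0 : inner 𝕜 (G y) y = 0 := hy _ (LinearMap.mem_range_self G.toLinearMap y)
        have h2 := h y
        rw [h0, map_zero] at h2
        have : ‖y‖ ^ 2 = 0 := le_antisymm (by nlinarith [sq_nonneg ‖y‖]) (sq_nonneg _)
        exact norm_eq_zero.1 (pow_eq_zero_iff (two_ne_zero) |>.1 this))
    rwa [hclosed.submodule_topologicalClosure_eq] at hcomp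
  exact ⟨ContinuousLinearEquiv.ofBijective G hker hrange, fun x => rfl⟩

/-! ### Observation maps, Gramians and observability -/

namespace C0Group

variable {𝕜 H U : Type*} [RCLike 𝕜] [NormedAddCommGroup H] [InnerProductSpace 𝕜 H]
  [CompleteSpace H] [NormedAddCommGroup U] [InnerProductSpace 𝕜 U] [CompleteSpace U]

theorem adjApply_adjApply (S : C0Group 𝕜 H) (s t : ℝ) (φ : S.DAdj) :
    S.adjApply s (S.adjApply t φ) = S.adjApply (s + t) φ := by
  have h : ∀ x : H, (S s).adjoint ((S t).adjoint x) = (S (s + t)).adjoint x := fun x => by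
    rw [add_comm, S.map_add', ContinuousLinearMap.adjoint_comp]; rfl
  exact S.DAdj_ext (h _) (h _)

theorem adjApply_add_smul (S : C0Group 𝕜 H) (t : ℝ) (φ ψ : S.DAdj) (c : 𝕜) :
    S.adjApply t (c • φ + ψ) = c • S.adjApply t φ + S.adjApply t ψ := by
  have h : ∀ x y : H, (S t).adjoint (c • x + y) = c • (S t).adjoint x + (S t).adjoint y :=
    fun x y => by rw [map_add, map_smul]
  exact S.DAdj_ext (h _ _) (h _ _)

variable [NormedSpace ℝ H] [IsScalarTower ℝ 𝕜 H]

theorem continuous_obsFun (S : C0Group 𝕜 H) (B : U →L[𝕜] S.DAdjDual) {a m : ℝ → ℝ}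
    (ha : Continuous a) (hm : Continuous m) (φ : S.DAdj) :
    Continuous fun s => (m s : 𝕜) • S.Bstar B (S.adjApply (a s) φ) :=
  (RCLike.continuous_ofReal.comp hm).smul
    ((S.BstarL B).continuous.comp ((S.continuous_adjApply φ).comp ha))

theorem memLp_obsFun (S : C0Group 𝕜 H) (B : U →L[𝕜] S.DAdjDual) (T : ℝ) (a m : C(ℝ, ℝ))
    (φ : S.DAdj) : MemLp (fun s => (m s : 𝕜) • S.Bstar B (S.adjApply (a s) φ)) 2
      (volume.restrict (Ioo 0 T)) :=
  (S.continuous_obsFun B a.continuous m.continuous φ).memLp_restrict_Ioo T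

/-- The weighted observation `φ ↦ m(s) B* S(a(s))* φ` with values in `L²((0,T); U)`. -/
def obs (S : C0Group 𝕜 H) (B : U →L[𝕜] S.DAdjDual) (T : ℝ) (a m : C(ℝ, ℝ)) :
    S.DAdj →ₗ[𝕜] Lp U 2 (volume.restrict (Ioo 0 T)) where
  toFun φ := (S.memLp_obsFun B T a m φ).toLp _
  map_add' φ ψ := by
    rw [← MemLp.toLp_add]
    congr 1
    funext s
    have := S.adjApply_add_smul (a s) φ ψ 1
    rw [one_smul, one_smul] at this
    simp only [Pi.add_apply, this, ← BstarL_apply, map_add, smul_add]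
  map_smul' c φ := by
    rw [RingHom.id_apply, ← MemLp.toLp_const_smul]
    congr 1
    funext s
    have := S.adjApply_add_smul (a s) φ 0 c
    have h0 : S.adjApply (a s) 0 = 0 := by
      simpa using S.adjApply_add_smul (a s) (0 : S.DAdj) 0 (-1)
    rw [h0, add_zero, add_zero] at this
    simp only [Pi.smul_apply, this, ← BstarL_apply, map_smul]
    rw [smul_comm]

theorem obs_ae (S : C0Group 𝕜 H) (B : U →L[𝕜] S.DAdjDual) (T : ℝ) (a m : C(ℝ, ℝ)) (φ : S.DAdj) :
    S.obs B T a m φ =ᵐ[volume.restrict (Ioo 0 T)]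
      fun s => (m s : 𝕜) • S.Bstar B (S.adjApply (a s) φ) :=
  (S.memLp_obsFun B T a m φ).coeFn_toLp

theorem inner_obs_toLp (S : C0Group 𝕜 H) (B : U →L[𝕜] S.DAdjDual) (T : ℝ) (a m : C(ℝ, ℝ))
    (φ : S.DAdj) (u : Lp U 2 (volume.restrict (Ioo 0 T))) :
    inner 𝕜 (S.obs B T a m φ) u
      = ∫ s in Ioo 0 T, (m s : 𝕜) * inner 𝕜 (S.Bstar B (S.adjApply (a s) φ)) (u s) := by
  rw [L2.inner_def]
  refine integral_congr_ae ?_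
  filter_upwards [S.obs_ae B T a m φ] with s hs
  rw [hs, inner_smul_left, RCLike.conj_ofReal]

theorem inner_obs_obs (S : C0Group 𝕜 H) (B : U →L[𝕜] S.DAdjDual) (T : ℝ) (a m : C(ℝ, ℝ))
    (φ ψ : S.DAdj) : inner 𝕜 (S.obs B T a m φ) (S.obs B T a m ψ)
      = ∫ s in Ioo 0 T, ((m s ^ 2 : ℝ) : 𝕜) * inner 𝕜 (S.Bstar B (S.adjApply (a s) φ))
          (S.Bstar B (S.adjApply (a s) ψ)) := by
  rw [inner_obs_toLp]
  refine integral_congr_ae ?_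
  filter_upwards [S.obs_ae B T a m ψ] with s hs
  rw [hs, inner_smul_right]
  push_cast
  ring

theorem norm_obs_sq (S : C0Group 𝕜 H) (B : U →L[𝕜] S.DAdjDual) (T : ℝ) (a m : C(ℝ, ℝ))
    (φ : S.DAdj) : ‖S.obs B T a m φ‖ ^ 2
      = ∫ s in Ioo 0 T, m s ^ 2 * ‖S.Bstar B (S.adjApply (a s) φ)‖ ^ 2 := by
  have h := S.inner_obs_obs B T a m φ φ
  rw [inner_self_eq_norm_sq_to_K] at h
  have e : ∀ s, ((m s ^ 2 : ℝ) : 𝕜) * inner 𝕜 (S.Bstar B (S.adjApply (a s) φ))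
          (S.Bstar B (S.adjApply (a s) φ))
      = ((m s ^ 2 * ‖S.Bstar B (S.adjApply (a s) φ)‖ ^ 2 : ℝ) : 𝕜) := fun s => by
    rw [inner_self_eq_norm_sq_to_K]; push_cast; rfl
  simp only [e] at h
  rw [integral_ofReal] at h
  exact_mod_cast h

/-- The observation is the transpose of u ↦ ∫₀ᵀ S(T - s)Bu(s) ds: its pairing with u is ⟨φ, Φ(T)⟩
with Φ(T) ∈ H by admissibility. -/
theorem IsAdmissible.exists_norm_obs_le {S : C0Group 𝕜 H} {B : U →L[𝕜] S.DAdjDual}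
    (hB : S.IsAdmissible B) {T : ℝ} (hT : 0 < T) : ∃ C : ℝ, 0 ≤ C ∧ ∀ φ : S.DAdj,
      ‖S.obs B T (.const ℝ T - .id ℝ) 1 φ‖ ≤ C * ‖S.incl φ‖ := by
  have key := exists_norm_le_of_inner_bounded (S.obs B T (.const ℝ T - .id ℝ) 1)
    S.inclL.toLinearMap
  refine key fun u => ?_
  obtain ⟨Φ, -, hΦ⟩ := hB T hT u (Lp.memLp u)
  refine ⟨‖Φ T‖, norm_nonneg _, fun φ => ?_⟩
  have e : inner 𝕜 (S.obs B T (.const ℝ T - .id ℝ) 1 φ) u = inner 𝕜 (S.incl φ) (Φ T) := by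
    rw [hΦ T ⟨hT.le, le_rfl⟩, inner_obs_toLp]
    refine integral_congr_ae (Eventually.of_forall fun s => ?_)
    simp [inner_Bstar]
  rw [e, mul_comm]
  exact norm_inner_le_norm _ _

/-- Here the group property enters: replacing φ by S(-T)*φ, an invertible change, converts S(T - s)*
into the S(-s)* of the Gramian. -/
theorem obs_const_sub_adjApply (S : C0Group 𝕜 H) (B : U →L[𝕜] S.DAdjDual) (T : ℝ) (m : C(ℝ, ℝ))
    (φ : S.DAdj) : S.obs B T (.const ℝ T - .id ℝ) m (S.adjApply (-T) φ)
      = S.obs B T (-.id ℝ) m φ := by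
  refine MemLp.toLp_congr (S.memLp_obsFun B T _ m _) (S.memLp_obsFun B T _ m _) (Eventually.of_forall fun s => ?_)
  simp only [adjApply_adjApply]
  congr 3
  simp only [ContinuousMap.sub_apply, ContinuousMap.const_apply, ContinuousMap.id_apply,
    ContinuousMap.neg_apply]
  ring

theorem IsAdmissible.exists_norm_obs_neg_le {S : C0Group 𝕜 H} {B : U →L[𝕜] S.DAdjDual}
    (hB : S.IsAdmissible B) {T : ℝ} (hT : 0 < T) (m : C(ℝ, ℝ)) : ∃ C : ℝ, ∀ φ : S.DAdj,
      ‖S.obs B T (-.id ℝ) m φ‖ ≤ C * ‖S.incl φ‖ := by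
  obtain ⟨C, hC0, hC⟩ := hB.exists_norm_obs_le hT
  obtain ⟨K, hK⟩ := isCompact_Icc.exists_bound_of_continuousOn
    (m.continuous.continuousOn (s := Icc 0 T))
  have hK0 : 0 ≤ K := (norm_nonneg _).trans (hK 0 ⟨le_rfl, hT.le⟩)
  refine ⟨K * (C * ‖S.adj (-T)‖), fun φ => ?_⟩
  have h1 : ‖S.obs B T (-.id ℝ) m φ‖ ≤ K * ‖S.obs B T (-.id ℝ) 1 φ‖ := by
    refine Lp.norm_le_mul_norm_of_ae_le_mul ?_
    filter_upwards [S.obs_ae B T (-.id ℝ) m φ, S.obs_ae B T (-.id ℝ) 1 φ,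
      ae_restrict_mem measurableSet_Ioo] with s h1 h2 hs
    rw [h1, h2, norm_smul, RCLike.norm_ofReal]
    simp only [ContinuousMap.one_apply, RCLike.ofReal_one, one_smul]
    gcongr
    exact hK s (Ioo_subset_Icc_self hs)
  refine h1.trans ?_
  rw [← obs_const_sub_adjApply, mul_assoc, mul_assoc]
  gcongr
  refine (hC _).trans ?_
  gcongr
  exact (S.adj (-T)).le_opNorm _

/-- The weighted controllability Gramian `∫₀ᵀ m(s)² S(-s) B B* S(-s)* ds`. -/
theorem IsAdmissible.exists_gramian {S : C0Group 𝕜 H} {B : U →L[𝕜] S.DAdjDual}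
    (hB : S.IsAdmissible B) {T : ℝ} (hT : 0 < T) (m : C(ℝ, ℝ)) :
    ∃ G : H →L[𝕜] H, G.IsPositive ∧ ∀ φ ψ : S.DAdj, inner 𝕜 (G (S.incl φ)) (S.incl ψ)
      = ∫ s in Ioo 0 T, ((m s ^ 2 : ℝ) : 𝕜) * inner 𝕜 (S.Bstar B (S.adjApply (-s) φ))
          (S.Bstar B (S.adjApply (-s) ψ)) := by
  -- The observation is bounded for the norm of H on the dense space D(A*), so it extends to H; the
  -- Gramian is Ψ*Ψ, positive by construction.
  set Ψ := (S.obs B T (-.id ℝ) m).extendOfNorm S.inclL.toLinearMap with hΨ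
  have e : ∀ φ, Ψ (S.incl φ) = S.obs B T (-.id ℝ) m φ :=
    LinearMap.extendOfNorm_eq S.denseRange_incl (hB.exists_norm_obs_neg_le hT m)
  refine ⟨Ψ.adjoint.comp Ψ, ContinuousLinearMap.isPositive_adjoint_comp_self Ψ, fun φ ψ => ?_⟩
  rw [ContinuousLinearMap.comp_apply, ContinuousLinearMap.adjoint_inner_left, e, e, inner_obs_obs]
  rfl

/-- If u steers 0 to y₁, then ⟨φ, y₁⟩ is the pairing of the observation of φ with u, hence at most
‖u‖ times its norm. The constant depends on y₁; uniform boundedness removes this dependence. -/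
theorem IsExactlyControllable.exists_norm_le_obs {S : C0Group 𝕜 H} {B : U →L[𝕜] S.DAdjDual} {T : ℝ}
    (hC : S.IsExactlyControllable B T) (hT : 0 < T) : ∃ C : ℝ, 0 ≤ C ∧ ∀ φ : S.DAdj,
      ‖S.incl φ‖ ≤ C * ‖S.obs B T (.const ℝ T - .id ℝ) 1 φ‖ := by
  have key := exists_norm_le_of_inner_bounded S.inclL.toLinearMap
    (S.obs B T (.const ℝ T - .id ℝ) 1)
  refine key fun y₁ => ?_
  obtain ⟨u, y, hy, hyT⟩ := hC 0 y₁
  refine ⟨‖hy.control.toLp u‖, norm_nonneg _, fun φ => ?_⟩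
  have e : inner 𝕜 (S.obs B T (.const ℝ T - .id ℝ) 1 φ) (hy.control.toLp u)
      = inner 𝕜 (S.incl φ) y₁ := by
    rw [← hyT, hy.inner_eq ⟨hT.le, le_rfl⟩, inner_zero_right, zero_add, inner_obs_toLp,
      intervalIntegral.integral_of_le hT.le, integral_Ioc_eq_integral_Ioo]
    refine integral_congr_ae ?_
    filter_upwards [hy.control.coeFn_toLp] with s hs
    rw [hs]
    simp
  change ‖inner 𝕜 (S.incl φ) y₁‖ ≤ _
  rw [← e, mul_comm]
  exact norm_inner_le_norm _ _

theorem IsExactlyControllable.exists_le_integral {S : C0Group 𝕜 H} {B : U →L[𝕜] S.DAdjDual} {T : ℝ}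
    (hC : S.IsExactlyControllable B T) (hT : 0 < T) : ∃ c : ℝ, 0 < c ∧ ∀ φ : S.DAdj,
      c * ‖S.incl φ‖ ^ 2 ≤ ∫ s in Ioo 0 T, ‖S.Bstar B (S.adjApply (-s) φ)‖ ^ 2 := by
  obtain ⟨C, hC0, hC⟩ := hC.exists_norm_le_obs hT
  -- The factor ‖S(T)*‖ is the cost of passing from S(T - s)* to S(-s)*; adding 1 makes K
  -- invertible.
  set K := ‖S.adj T‖ * C + 1 with hK
  have hK0 : 0 < K := by positivity
  refine ⟨(K ^ 2)⁻¹, by positivity, fun φ => ?_⟩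
  rw [inv_mul_le_iff₀ (by positivity)]
  have h1 := hC (S.adjApply (-T) φ)
  rw [obs_const_sub_adjApply] at h1
  have h2 : S.incl φ = S.adj T (S.incl (S.adjApply (-T) φ)) := by
    change _ = S.adj T (S.adj (-T) _)
    rw [← S.adj.apply_add, add_neg_cancel, S.adj.apply_zero]
  have h3 : ‖S.incl φ‖ ≤ K * ‖S.obs B T (-.id ℝ) 1 φ‖ := by
    rw [h2]
    refine ((S.adj T).le_opNorm _).trans ?_
    calc _ ≤ ‖S.adj T‖ * (C * ‖S.obs B T (-.id ℝ) 1 φ‖) := by gcongr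
      _ ≤ _ := by rw [hK]; nlinarith [norm_nonneg (S.obs B T (-.id ℝ) 1 φ)]
  have h4 := pow_le_pow_left₀ (norm_nonneg _) h3 2
  rw [mul_pow, norm_obs_sq] at h4
  simpa using h4

end C0Group

/-! ### The weighted Gramian and the Riccati identity -/

theorem hasDerivAt_integral_moving {E : Type*} [NormedAddCommGroup E] [NormedSpace ℝ E]
    [CompleteSpace E] {F : ℝ → E} (hF : Continuous F) (L : ℝ) :
    HasDerivAt (fun h : ℝ => ∫ s in h..(L + h), F s) (F L - F 0) 0 := by
  have hi : ∀ a b, IntervalIntegrable F volume a b := fun a b => hF.intervalIntegrable a b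
  have h1 : HasDerivAt (fun h : ℝ => ∫ s in (0:ℝ)..(L + h), F s) (F L) 0 := by
    have h := intervalIntegral.integral_hasDerivAt_right (hi 0 (L + 0))
      (hF.stronglyMeasurableAtFilter _ _) hF.continuousAt
    simpa using HasDerivAt.comp_const_add L 0 h
  have h2 : HasDerivAt (fun h : ℝ => ∫ s in (0:ℝ)..h, F s) (F 0) 0 :=
    intervalIntegral.integral_hasDerivAt_right (hi 0 0)
      (hF.stronglyMeasurableAtFilter _ _) hF.continuousAt
  refine (h1.sub h2).congr_of_eventuallyEq (Eventually.of_forall fun h => ?_)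
  simp only [Pi.sub_apply]
  rw [intervalIntegral.integral_interval_sub_left (hi _ _) (hi _ _)]

namespace C0Group

variable {𝕜 H U : Type*} [RCLike 𝕜] [NormedAddCommGroup H] [InnerProductSpace 𝕜 H]
  [CompleteSpace H] [NormedAddCommGroup U] [InnerProductSpace 𝕜 U] [CompleteSpace U]
  [NormedSpace ℝ H] [IsScalarTower ℝ 𝕜 H]

/-- Komornik's weight `e(s) = exp(-2 lam s) (1 - s/L)` on `[0, L]`. -/
theorem gramian_riccati_identity (S : C0Group 𝕜 H) (B : U →L[𝕜] S.DAdjDual) {L lam : ℝ} (hL : 0 < L)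
    {G G' : H →L[𝕜] H}
    (hG : ∀ φ ψ : S.DAdj, inner 𝕜 (G (S.incl φ)) (S.incl ψ)
      = ∫ s in (0:ℝ)..L, ((Real.exp (-(2 * lam * s)) * (1 - s / L) : ℝ) : 𝕜) *
        inner 𝕜 (S.Bstar B (S.adjApply (-s) φ)) (S.Bstar B (S.adjApply (-s) ψ)))
    (hG' : ∀ φ ψ : S.DAdj, inner 𝕜 (G' (S.incl φ)) (S.incl ψ)
      = ∫ s in (0:ℝ)..L, ((Real.exp (-(2 * lam * s)) / L : ℝ) : 𝕜) *
        inner 𝕜 (S.Bstar B (S.adjApply (-s) φ)) (S.Bstar B (S.adjApply (-s) ψ)))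
    (φ ψ : S.DAdj) :
    inner 𝕜 (G (S.incl φ)) (S.Astar ψ) + inner 𝕜 (G (S.Astar φ)) (S.incl ψ)
      - inner 𝕜 (S.Bstar B φ) (S.Bstar B ψ) + inner 𝕜 (G' (S.incl φ)) (S.incl ψ)
      + 2 * (lam : 𝕜) * inner 𝕜 (G (S.incl φ)) (S.incl ψ) = 0 := by
  set f : ℝ → 𝕜 := fun s =>
    inner 𝕜 (S.Bstar B (S.adjApply (-s) φ)) (S.Bstar B (S.adjApply (-s) ψ)) with hf
  have hfc : Continuous f :=
    ((S.BstarL B).continuous.comp ((S.continuous_adjApply φ).comp continuous_neg)).inner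
      ((S.BstarL B).continuous.comp ((S.continuous_adjApply ψ).comp continuous_neg))
  set E : ℝ → 𝕜 := fun s => ((Real.exp (-(2 * lam * s)) * (1 - s / L) : ℝ) : 𝕜) * f s with hE
  set K : ℝ → 𝕜 := fun s => ((Real.exp (-(2 * lam * s)) / L : ℝ) : 𝕜) * f s with hK
  have hEc : Continuous E := (RCLike.continuous_ofReal.comp (by fun_prop)).mul hfc
  have hKc : Continuous K := (RCLike.continuous_ofReal.comp (by fun_prop)).mul hfc
  -- The function h ↦ ⟨G S(-h)*φ, S(-h)*ψ⟩ is differentiated at 0 in two ways; equating the results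
  -- is the Riccati identity. First, by the product rule.
  have hLHS : HasDerivAt (fun h : ℝ => inner 𝕜 (G (S.adj (-h) (S.incl φ))) (S.adj (-h) (S.incl ψ)))
      (-(inner 𝕜 (G (S.incl φ)) (S.Astar ψ) + inner 𝕜 (G (S.Astar φ)) (S.incl ψ))) 0 := by
    have h1 : ∀ χ : S.DAdj, HasDerivAt (fun h => S.adj (-h) (S.incl χ)) (-S.Astar χ) 0 := by
      intro χ
      have h := S.hasDerivAt_adj χ (0 - 0)
      have h' := h.comp_const_sub 0 0
      simpa [S.adj.apply_zero] using h'
    have h2 : HasDerivAt (fun h => G (S.adj (-h) (S.incl φ))) (G (-S.Astar φ)) 0 :=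
      (G.hasFDerivAt.restrictScalars ℝ).comp_hasDerivAt (0 : ℝ) (h1 φ)
    have h3 := h2.inner 𝕜 (h1 ψ)
    simp only [neg_zero, S.adj.apply_zero, map_neg, inner_neg_left, inner_neg_right] at h3
    rw [neg_add]
    exact h3
  -- Second, by translating the integration variable: e(s - h) = exp(2λh)(e(s) + h exp(-2λs)/L), so
  -- h survives only in explicit factors and in the limits of integration.
  have hshift : ∀ h : ℝ, inner 𝕜 (G (S.adj (-h) (S.incl φ))) (S.adj (-h) (S.incl ψ))
      = ((Real.exp (2 * lam * h) : ℝ) : 𝕜) * ((∫ s in h..(L + h), E s)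
        + (h : 𝕜) * ∫ s in h..(L + h), K s) := by
    intro h
    have e1 := hG (S.adjApply (-h) φ) (S.adjApply (-h) ψ)
    have e2 := intervalIntegral.integral_comp_add_right (a := 0) (b := L)
      (fun s => ((Real.exp (-(2 * lam * (s - h))) * (1 - (s - h) / L) : ℝ) : 𝕜) * f s) h
    rw [zero_add] at e2
    have hKi : IntervalIntegrable (fun s => (h : 𝕜) * K s) volume h (L + h) :=
      (continuous_const.mul hKc).intervalIntegrable _ _
    change inner 𝕜 (G (S.incl (S.adjApply (-h) φ))) (S.incl (S.adjApply (-h) ψ)) = _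
    rw [e1, ← intervalIntegral.integral_const_mul, ← intervalIntegral.integral_add
      (hEc.intervalIntegrable _ _) hKi,
      ← intervalIntegral.integral_const_mul]
    calc _ = _ := intervalIntegral.integral_congr fun s _ => by
          simp only [hf, adjApply_adjApply, neg_add, add_sub_cancel_right]
      _ = _ := e2
      _ = _ := intervalIntegral.integral_congr fun s _ => by
          have : Real.exp (-(2 * lam * (s - h)))
              = Real.exp (2 * lam * h) * Real.exp (-(2 * lam * s)) := by
            rw [← Real.exp_add]; congr 1; ring
          simp only [hE, hK, this]
          push_cast
          have hL' : (L : 𝕜) ≠ 0 := by exact_mod_cast hL.ne'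
          field_simp
          ring
  have hRHS : HasDerivAt (fun h : ℝ => ((Real.exp (2 * lam * h) : ℝ) : 𝕜) *
      ((∫ s in h..(L + h), E s) + (h : 𝕜) * ∫ s in h..(L + h), K s))
      (2 * (lam : 𝕜) * (∫ s in (0:ℝ)..L, E s) + ((E L - E 0) + ∫ s in (0:ℝ)..L, K s)) 0 := by
    have h1 : HasDerivAt (fun h : ℝ => ((Real.exp (2 * lam * h) : ℝ) : 𝕜)) (2 * (lam : 𝕜)) 0 := by
      have h := ((hasDerivAt_id (0 : ℝ)).const_mul (2 * lam)).exp
      have h' := (RCLike.ofRealCLM (K := 𝕜)).hasFDerivAt.comp_hasDerivAt (0 : ℝ) h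
      simp only [id_eq, mul_zero, Real.exp_zero, one_mul, mul_one, RCLike.ofRealCLM_apply] at h'
      push_cast at h'
      exact h'
    have h2 : HasDerivAt (fun h : ℝ => (h : 𝕜)) 1 0 := by
      have h' := (RCLike.ofRealCLM (K := 𝕜)).hasFDerivAt.comp_hasDerivAt (0 : ℝ) (hasDerivAt_id _)
      simp only [RCLike.ofRealCLM_apply, RCLike.ofReal_one] at h'
      exact h'
    have h3 := h1.mul ((hasDerivAt_integral_moving hEc L).add
      (h2.mul (hasDerivAt_integral_moving hKc L)))
    refine HasDerivAt.congr_deriv h3 ?_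
    simp
  have hkey := hLHS.unique (hRHS.congr_of_eventuallyEq (Eventually.of_forall hshift))
  -- Boundary terms: the weight vanishes at L, which removes the far end, and equals 1 at 0, which
  -- leaves ⟨B*φ, B*ψ⟩.
  have hEL : E L = 0 := by
    simp only [hE, div_self hL.ne', sub_self, mul_zero, RCLike.ofReal_zero, zero_mul]
  have hE0 : E 0 = inner 𝕜 (S.Bstar B φ) (S.Bstar B ψ) := by
    have h0 : ∀ χ : S.DAdj, S.adjApply 0 χ = χ := fun χ =>
      S.DAdj_ext (S.adj.apply_zero _) (S.adj.apply_zero _)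
    simp [hE, hf, h0]
  rw [hEL, hE0] at hkey
  rw [hG φ ψ, hG' φ ψ]
  linear_combination -hkey

/-- With R = Q⁻¹G'Q⁻¹ the term ⟨RQx, Qy⟩ is ⟨G'x, y⟩, so the Gramian identity is the Riccati
identity; R inherits positivity from G' because Q⁻¹ is symmetric. -/
theorem exists_isRiccatiTriple (S : C0Group 𝕜 H) (B : U →L[𝕜] S.DAdjDual) (hB : S.IsAdmissible B)
    (hC : ∃ T : ℝ, 0 < T ∧ S.IsExactlyControllable B T) (lam : ℝ) (hlam : 0 < lam) :
    ∃ (Q : H ≃L[𝕜] H) (R : H →L[𝕜] H),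
      S.IsRiccatiTriple B lam Q R (ContinuousLinearMap.id 𝕜 U) := by
  obtain ⟨T, hT, hC⟩ := hC
  -- The weight vanishes at L, so the horizon is doubled: on (0,T), where observability is used, it
  -- is at least exp(-2λT)/2, the κ below.
  set L := 2 * T with hLdef
  have hL : 0 < L := by positivity
  -- The Gramian carries the square of m, hence square roots of the two weights; the first weight is
  -- nonnegative only up to L.
  let m : C(ℝ, ℝ) := ⟨fun s => Real.sqrt (Real.exp (-(2 * lam * s)) * (1 - s / L)), by fun_prop⟩
  let m' : C(ℝ, ℝ) := ⟨fun s => Real.sqrt (Real.exp (-(2 * lam * s)) / L), by fun_prop⟩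
  have hm : ∀ s ∈ Ioo 0 L, m s ^ 2 = Real.exp (-(2 * lam * s)) * (1 - s / L) := fun s hs =>
    Real.sq_sqrt (mul_nonneg (Real.exp_pos _).le
      (sub_nonneg.2 ((div_le_one hL).2 hs.2.le)))
  have hm' : ∀ s, m' s ^ 2 = Real.exp (-(2 * lam * s)) / L := fun s =>
    Real.sq_sqrt (by positivity)
  obtain ⟨G, hGpos, hG⟩ := hB.exists_gramian hL m
  obtain ⟨G', hGpos', hG'⟩ := hB.exists_gramian hL m'
  have hGi : ∀ φ ψ : S.DAdj, inner 𝕜 (G (S.incl φ)) (S.incl ψ)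
      = ∫ s in (0:ℝ)..L, ((Real.exp (-(2 * lam * s)) * (1 - s / L) : ℝ) : 𝕜) *
        inner 𝕜 (S.Bstar B (S.adjApply (-s) φ)) (S.Bstar B (S.adjApply (-s) ψ)) := fun φ ψ => by
    rw [hG, intervalIntegral.integral_of_le hL.le, integral_Ioc_eq_integral_Ioo]
    exact setIntegral_congr_fun measurableSet_Ioo fun s hs => by simp only [hm s hs]
  have hGi' : ∀ φ ψ : S.DAdj, inner 𝕜 (G' (S.incl φ)) (S.incl ψ)
      = ∫ s in (0:ℝ)..L, ((Real.exp (-(2 * lam * s)) / L : ℝ) : 𝕜) *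
        inner 𝕜 (S.Bstar B (S.adjApply (-s) φ)) (S.Bstar B (S.adjApply (-s) ψ)) := fun φ ψ => by
    rw [hG', intervalIntegral.integral_of_le hL.le, integral_Ioc_eq_integral_Ioo]
    exact setIntegral_congr_fun measurableSet_Ioo fun s hs => by simp only [hm' s]
  obtain ⟨c, hc, hobs⟩ := hC.exists_le_integral hT
  set κ := Real.exp (-(2 * lam * T)) * (1 / 2) with hκ
  have hκ0 : 0 < κ := by positivity
  have hsym : ∀ x y, inner 𝕜 (G x) y = inner 𝕜 x (G y) := hGpos.isSymmetric
  have hcoer : ∀ x, κ * c * ‖x‖ ^ 2 ≤ RCLike.re (inner 𝕜 (G x) x) := by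
    intro x
    refine S.denseRange_incl.induction_on (p := fun x =>
      κ * c * ‖x‖ ^ 2 ≤ RCLike.re (inner 𝕜 (G x) x)) x
      (isClosed_le (by fun_prop) (RCLike.continuous_re.comp (by fun_prop))) fun φ => ?_
    have hb : Continuous fun s => ‖S.Bstar B (S.adjApply (-s) φ)‖ ^ 2 :=
      (((S.BstarL B).continuous.comp ((S.continuous_adjApply φ).comp continuous_neg)).norm).pow 2
    have e : RCLike.re (inner 𝕜 (G (S.incl φ)) (S.incl φ))
        = ∫ s in Ioo 0 L, m s ^ 2 * ‖S.Bstar B (S.adjApply (-s) φ)‖ ^ 2 := by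
      rw [hG, ← RCLike.ofReal_re (K := 𝕜) (∫ s in Ioo 0 L, _), ← integral_ofReal]
      congr 2
      funext s
      rw [inner_self_eq_norm_sq_to_K]
      push_cast
      rfl
    have hint : IntegrableOn (fun s => m s ^ 2 * ‖S.Bstar B (S.adjApply (-s) φ)‖ ^ 2) (Ioo 0 L) :=
      ((m.continuous.pow 2).mul hb).continuousOn.integrableOn_Ioo
    rw [e]
    calc κ * c * ‖S.incl φ‖ ^ 2
        ≤ κ * ∫ s in Ioo 0 T, ‖S.Bstar B (S.adjApply (-s) φ)‖ ^ 2 := by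
          rw [mul_assoc]; gcongr; exact hobs φ
      _ = ∫ s in Ioo 0 T, κ * ‖S.Bstar B (S.adjApply (-s) φ)‖ ^ 2 := (integral_const_mul _ _).symm
      _ ≤ ∫ s in Ioo 0 T, m s ^ 2 * ‖S.Bstar B (S.adjApply (-s) φ)‖ ^ 2 := by
          refine setIntegral_mono_on (continuous_const.mul hb).continuousOn.integrableOn_Ioo
            (hint.mono_set (Ioo_subset_Ioo_right (by linarith))) measurableSet_Ioo fun s hs => ?_
          gcongr
          rw [hm s ⟨hs.1, by linarith [hs.2]⟩, hκ]
          gcongr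
          · exact hs.2.le
          · rw [le_sub_comm, div_le_iff₀ hL]
            linarith [hs.2]
      _ ≤ _ := setIntegral_mono_set hint (Eventually.of_forall fun s => by positivity)
          (Ioo_subset_Ioo_right (by linarith)).eventuallyLE
  obtain ⟨Q, hQ⟩ := exists_equiv_of_coercive G (mul_pos hκ0 hc) hcoer
  have hQsym : ∀ x y, inner 𝕜 (Q x) y = inner 𝕜 x (Q y) := fun x y => by rw [hQ, hQ, hsym]
  have hQis : ∀ x y, inner 𝕜 (Q.symm x) y = inner 𝕜 x (Q.symm y) := fun x y => by
    have := hQsym (Q.symm x) (Q.symm y)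
    rw [Q.apply_symm_apply, Q.apply_symm_apply] at this
    exact this.symm
  have hadj : (Q.symm : H →L[𝕜] H).adjoint = (Q.symm : H →L[𝕜] H) :=
    ((ContinuousLinearMap.eq_adjoint_iff _ _).2 hQis).symm
  refine ⟨Q, (Q.symm : H →L[𝕜] H) ∘L G' ∘L (Q.symm : H →L[𝕜] H), hQsym,
    ⟨κ * c, mul_pos hκ0 hc, fun x => by rw [hQ]; exact hcoer x⟩, ?_,
    ContinuousLinearMap.isPositive_one, fun x y => ?_⟩
  · have := hGpos'.conj_adjoint (Q.symm : H →L[𝕜] H)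
    rwa [hadj] at this
  · have e1 : inner 𝕜 (((Q.symm : H →L[𝕜] H) ∘L G' ∘L (Q.symm : H →L[𝕜] H)) (Q (S.incl x)))
        (Q (S.incl y)) = inner 𝕜 (G' (S.incl x)) (S.incl y) := by
      change inner 𝕜 (Q.symm (G' (Q.symm (Q (S.incl x))))) _ = _
      rw [Q.symm_apply_apply, hQis, Q.symm_apply_apply]
    rw [e1, ← hQsym (S.Astar x), hQ, hQ]
    exact S.gramian_riccati_identity B hL hGi hGi' x y

end C0Group

/-! ### Bounded perturbations of the group -/

theorem integral_exp_neg_mul_sub_le {ν τ : ℝ} (hν : 0 < ν) :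
    ∫ s in (0:ℝ)..τ, Real.exp (-(ν * (τ - s))) ≤ 1 / ν := by
  have hd : ∀ s ∈ uIcc 0 τ, HasDerivAt (fun s => Real.exp (-(ν * (τ - s))) / ν)
      (Real.exp (-(ν * (τ - s)))) s := by
    intro s _
    have h1 : HasDerivAt (fun s => -(ν * (τ - s))) ν s := by
      have := (((hasDerivAt_id s).const_sub τ).const_mul ν).neg
      exact HasDerivAt.congr_deriv this (by ring)
    have h2 := h1.exp.div_const ν
    rwa [mul_div_cancel_right₀ _ hν.ne'] at h2
  rw [intervalIntegral.integral_eq_sub_of_hasDerivAt hd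
    (Continuous.intervalIntegrable (by fun_prop) _ _)]
  have : 0 ≤ Real.exp (-(ν * (τ - 0))) / ν := by positivity
  simp only [sub_self, mul_zero, neg_zero, Real.exp_zero]
  linarith

namespace C0Group

variable {𝕜 H : Type*} [RCLike 𝕜] [NormedAddCommGroup H] [InnerProductSpace 𝕜 H]

/-- The time-reversed group `t ↦ S(-t)`. -/
def rev (S : C0Group 𝕜 H) : C0Group 𝕜 H where
  toFun t := S (-t)
  map_zero' := by rw [neg_zero, S.map_zero']
  map_add' s t := by rw [neg_add, S.map_add']
  tendsto_zero' x := (S.tendsto_zero' x).comp (by simpa using (continuous_neg (G := ℝ)).tendsto 0)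

variable [CompleteSpace H] [NormedSpace ℝ H] [IsScalarTower ℝ 𝕜 H]

/-- In the norm weighted by exp(-(w + ν)t) with ν = 2M‖P‖ + 1, the Volterra operator has norm at
most M‖P‖/ν, below 1/2. This makes the fixed point global in one step. -/
theorem norm_convolution_le (G : C0Group 𝕜 H) (P : H →L[𝕜] H) {M w : ℝ} (hM : 0 ≤ M)
    (hG : ∀ t, 0 ≤ t → ‖G t‖ ≤ M * Real.exp (w * t)) {x : ℝ → H} (hx : Continuous x) {b : ℝ}
    (hb : ∀ t, ‖x t‖ ≤ b) {τ : ℝ} (hτ : 0 ≤ τ) :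
    ‖Real.exp (-((w + (2 * M * ‖P‖ + 1)) * τ)) • G τ (∫ s in (0:ℝ)..τ,
      G (-s) (P (Real.exp ((w + (2 * M * ‖P‖ + 1)) * s) • x s)))‖ ≤ b / 2 := by
  set ν := 2 * M * ‖P‖ + 1 with hν
  have hν0 : 0 < ν := by positivity
  have hb0 : 0 ≤ b := (norm_nonneg _).trans (hb 0)
  have hfc : Continuous fun s => P (Real.exp ((w + ν) * s) • x s) :=
    P.continuous.comp (by fun_prop)
  have hi : IntervalIntegrable (fun s => G (-s) (P (Real.exp ((w + ν) * s) • x s))) volume 0 τ :=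
    (G.continuous_apply_apply continuous_neg hfc).intervalIntegrable _ _
  rw [← ContinuousLinearMap.intervalIntegral_comp_comm (G τ) hi, ← intervalIntegral.integral_smul]
  have key : ‖∫ s in (0:ℝ)..τ, Real.exp (-((w + ν) * τ)) • G τ (G (-s)
      (P (Real.exp ((w + ν) * s) • x s)))‖
      ≤ ∫ s in (0:ℝ)..τ, M * ‖P‖ * b * Real.exp (-(ν * (τ - s))) := by
    refine intervalIntegral.norm_integral_le_of_norm_le hτ (Eventually.of_forall fun s hs => ?_)
      (Continuous.intervalIntegrable (by fun_prop) _ _)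
    rw [← G.apply_add, norm_smul, Real.norm_eq_abs, abs_of_pos (Real.exp_pos _)]
    have h1 : ‖G (τ + -s)‖ ≤ M * Real.exp (w * (τ + -s)) := hG _ (by linarith [hs.2])
    have h2 : ‖P (Real.exp ((w + ν) * s) • x s)‖ ≤ ‖P‖ * (Real.exp ((w + ν) * s) * b) := by
      refine (P.le_opNorm _).trans ?_
      rw [norm_smul, Real.norm_eq_abs, abs_of_pos (Real.exp_pos _)]
      gcongr
      exact hb s
    calc _ ≤ Real.exp (-((w + ν) * τ)) * ((M * Real.exp (w * (τ + -s))) *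
          (‖P‖ * (Real.exp ((w + ν) * s) * b))) := by
          gcongr
          exact ((G (τ + -s)).le_opNorm _).trans (by gcongr)
      _ = M * ‖P‖ * b * (Real.exp (-((w + ν) * τ)) * Real.exp (w * (τ + -s))
          * Real.exp ((w + ν) * s)) := by ring
      _ = _ := by
          rw [← Real.exp_add, ← Real.exp_add]
          congr 2
          ring
  refine key.trans ?_
  rw [intervalIntegral.integral_const_mul]
  calc _ ≤ M * ‖P‖ * b * (1 / ν) := by
        gcongr; exact integral_exp_neg_mul_sub_le hν0
    _ ≤ b / 2 := by
        rw [mul_one_div, div_le_iff₀ hν0, hν]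
        nlinarith

theorem continuous_primitive_comp (G : C0Group 𝕜 H) {f : ℝ → H} (hf : Continuous f) :
    Continuous fun t : ℝ => ∫ s in (0:ℝ)..t, G (-s) (f s) :=
  intervalIntegral.continuous_primitive
    (fun _ _ => (G.continuous_apply_apply continuous_neg hf).intervalIntegrable _ _) 0

open BoundedContinuousFunction in
/-- Mild solutions of `z' = (A + P) z` for a bounded perturbation `P` exist globally. -/
theorem exists_mild_solution (G : C0Group 𝕜 H) (P : H →L[𝕜] H) (z₀ : H) :
    ∃ z : ℝ → H, Continuous z ∧ ∀ t, 0 ≤ t →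
      z t = G t (z₀ + ∫ s in (0:ℝ)..t, G (-s) (P (z s))) := by
  obtain ⟨M, w, hM, hw, hG⟩ := G.exists_growth_bound
  set μ := w + (2 * M * ‖P‖ + 1) with hμ
  have hwμ : w ≤ μ := by rw [hμ]; have := norm_nonneg P; nlinarith [mul_nonneg hM this]
  have hfc : ∀ x : ℝ →ᵇ H, Continuous fun s => P (Real.exp (μ * s) • x s) := fun x =>
    P.continuous.comp ((by fun_prop : Continuous fun s => Real.exp (μ * s)).smul x.continuous)
  -- The unknown is x(t) = exp(-μt)z(t). Replacing t by max(t,0) extends it as a constant to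
  -- negative times, so that it lives in the bounded continuous functions on ℝ.
  set F : (ℝ →ᵇ H) → ℝ → H := fun x t => Real.exp (-(μ * max t 0)) •
    G (max t 0) (z₀ + ∫ s in (0:ℝ)..(max t 0), G (-s) (P (Real.exp (μ * s) • x s))) with hF
  have hFc : ∀ x, Continuous (F x) := fun x =>
    (by fun_prop : Continuous fun t => Real.exp (-(μ * max t 0))).smul
      (G.continuous_apply_apply (by fun_prop) (continuous_const.add
        ((G.continuous_primitive_comp (hfc x)).comp (by fun_prop))))
  have hFb : ∀ x t, ‖F x t‖ ≤ M * ‖z₀‖ + ‖x‖ / 2 := by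
    intro x t
    have h0 : 0 ≤ max t 0 := le_max_right _ _
    simp only [hF]
    rw [map_add, smul_add]
    refine (norm_add_le _ _).trans (add_le_add ?_
      (G.norm_convolution_le P hM hG x.continuous x.norm_coe_le_norm h0))
    rw [norm_smul, Real.norm_eq_abs, abs_of_pos (Real.exp_pos _)]
    calc _ ≤ Real.exp (-(μ * max t 0)) * ((M * Real.exp (w * max t 0)) * ‖z₀‖) := by
          gcongr
          exact ((G _).le_opNorm _).trans (by gcongr; exact hG _ h0)
      _ = M * ‖z₀‖ * Real.exp (-(μ * max t 0) + w * max t 0) := by rw [Real.exp_add]; ring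
      _ ≤ M * ‖z₀‖ * 1 := by
          gcongr
          rw [Real.exp_le_one_iff]
          nlinarith
      _ = _ := mul_one _
  set Φ : (ℝ →ᵇ H) → (ℝ →ᵇ H) := fun x => ofNormedAddCommGroup (F x) (hFc x) _ (hFb x) with hΦ
  have hcontr : ContractingWith (1 / 2) Φ := by
    refine ⟨by norm_num, LipschitzWith.of_dist_le_mul fun x y => ?_⟩
    rw [dist_eq_norm, dist_eq_norm, BoundedContinuousFunction.norm_le (by positivity)]
    intro t
    have h0 : 0 ≤ max t 0 := le_max_right _ _
    have hb := G.norm_convolution_le P hM hG (x - y).continuous (x - y).norm_coe_le_norm h0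
    have e : (Φ x - Φ y) t = Real.exp (-(μ * max t 0)) • G (max t 0)
        (∫ s in (0:ℝ)..(max t 0), G (-s) (P (Real.exp (μ * s) • (x - y) s))) := by
      have hi : ∀ x : ℝ →ᵇ H, IntervalIntegrable (fun s => G (-s) (P (Real.exp (μ * s) • x s)))
          volume 0 (max t 0) := fun x =>
        (G.continuous_apply_apply continuous_neg (hfc x)).intervalIntegrable _ _
      change F x t - F y t = _
      simp only [hF]
      rw [← smul_sub, ← map_sub, add_sub_add_left_eq_sub, ← intervalIntegral.integral_sub (hi x) (hi y)]
      simp only [BoundedContinuousFunction.coe_sub, Pi.sub_apply, smul_sub, map_sub]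
    rw [e]
    refine hb.trans (le_of_eq ?_)
    push_cast
    ring
  set x := hcontr.fixedPoint Φ with hx
  have hfix : ∀ t, x t = F x t := fun t => by
    have := hcontr.fixedPoint_isFixedPt
    exact (congrArg (fun f : ℝ →ᵇ H => f t) this).symm
  refine ⟨fun t => Real.exp (μ * t) • x t,
    (by fun_prop : Continuous fun s => Real.exp (μ * s)).smul x.continuous, fun t ht => ?_⟩
  beta_reduce
  rw [hfix t]
  simp only [hF, max_eq_left ht]
  rw [smul_smul, ← Real.exp_add, add_neg_cancel, Real.exp_zero, one_smul]

/-- Take the mild solution for the group S(-t)*. Moving the group onto φ ∈ D(A) gives ⟨φ, z(t)⟩ =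
⟨S(-t)φ, z₀ + ∫₀ᵗ S(s)*Pz ds⟩, where both factors are differentiable. -/
theorem exists_adjointWeakSolution (S : C0Group 𝕜 H) (P : H →L[𝕜] H) (z₀ : H) :
    ∃ z : ℝ → H, Continuous z ∧ ∀ T, S.IsAdjointWeakSolution T z₀ (fun t => P (z t)) z := by
  obtain ⟨z, hz, hmild⟩ := S.adj.rev.exists_mild_solution P z₀
  have hmild' : ∀ t, 0 ≤ t → z t = S.adj (-t) (z₀ + ∫ s in (0:ℝ)..t, S.adj s (P (z s))) := by
    intro t ht
    have := hmild t ht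
    simp only [rev, neg_neg] at this
    exact this
  have hc : Continuous fun s => S.adj s (P (z s)) :=
    S.adj.continuous_apply_apply continuous_id (P.continuous.comp hz)
  refine ⟨z, hz, fun T => ⟨(P.continuous.comp hz).continuousOn.integrableOn_Ioo, hz.continuousOn,
    ?_, fun φ => ?_⟩⟩
  · rw [hmild' 0 le_rfl]
    simp [S.adj.apply_zero]
  · have hPz : Continuous fun t => P (z t) := P.continuous.comp hz
    refine HasDistribDeriv.of_hasDerivAt (continuous_const.inner hz).continuousOn
      ((continuous_const.inner hz).neg.add (continuous_const.inner hPz)).continuousOn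
      fun t ht => ?_
    have h1 : HasDerivAt (fun t => S (-t) (φ : H)) (-S (-t) (S.generator φ)) t := by
      have h := S.hasDerivAt_apply φ (0 - t)
      have := h.comp_const_sub 0 t
      simpa only [zero_sub] using this
    have h2 : HasDerivAt (fun t : ℝ => z₀ + ∫ s in (0:ℝ)..t, S.adj s (P (z s)))
        (S.adj t (P (z t))) t :=
      (intervalIntegral.integral_hasDerivAt_right (hc.intervalIntegrable _ _)
        (hc.stronglyMeasurableAtFilter _ _) hc.continuousAt).const_add z₀
    have h3 := h1.inner 𝕜 h2
    have e : ∀ (x v : H), inner 𝕜 (S (-t) x) v = inner 𝕜 x (S.adj (-t) v) := fun x v =>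
      (ContinuousLinearMap.adjoint_inner_right _ _ _).symm
    rw [inner_neg_left, e, e, ← hmild' t ht.1.le, ← S.adj.apply_add, neg_add_cancel,
      S.adj.apply_zero, add_comm] at h3
    refine h3.congr_of_eventuallyEq ?_
    filter_upwards [Ioi_mem_nhds ht.1] with s hs
    rw [hmild' s (le_of_lt hs)]
    exact ContinuousLinearMap.adjoint_inner_right _ _ _

end C0Group

/-! ### The energy ⟨Qz, z⟩ along the adjoint equation -/

namespace C0Group

variable {𝕜 H U : Type*} [RCLike 𝕜] [NormedAddCommGroup H] [InnerProductSpace 𝕜 H]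
  [CompleteSpace H] [NormedAddCommGroup U] [InnerProductSpace 𝕜 U] [CompleteSpace U]
  [NormedSpace ℝ H] [IsScalarTower ℝ 𝕜 H]

theorem continuous_incl (S : C0Group 𝕜 H) : Continuous S.incl := S.inclL.continuous
theorem continuous_Astar (S : C0Group 𝕜 H) : Continuous S.Astar := S.AstarL.continuous
theorem continuous_Bstar (S : C0Group 𝕜 H) (B : U →L[𝕜] S.DAdjDual) : Continuous (S.Bstar B) :=
  (S.BstarL B).continuous

/-- For z continuous into D(A*) the right-hand side -A*z + g is continuous in H, so the integrated
equation holds in H and can be differentiated. -/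
theorem IsAdjointWeakSolution.hasDerivAt {S : C0Group 𝕜 H} {T : ℝ} {z₀ : H} {g : ℝ → H}
    {z : ℝ → S.DAdj} (h : S.IsAdjointWeakSolution T z₀ g (fun t => S.incl (z t)))
    (hz : ContinuousOn z (Icc 0 T)) (hg : ContinuousOn g (Icc 0 T)) {t : ℝ} (ht : t ∈ Ioo 0 T) :
    HasDerivAt (fun t => S.incl (z t)) (-S.Astar (z t) + g t) t := by
  have hF : ContinuousOn (fun t => -S.Astar (z t) + g t) (Icc 0 T) :=
    (S.continuous_Astar.comp_continuousOn hz).neg.add hg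
  have e : ∀ t ∈ Icc 0 T, S.incl (z t) = z₀ + ∫ s in (0:ℝ)..t, (-S.Astar (z s) + g s) := by
    intro t ht
    have hi : IntervalIntegrable (fun t => -S.Astar (z t) + g t) volume 0 t :=
      intervalIntegrable_of_integrableOn_Ioo hF.integrableOn_Ioo ⟨le_rfl, ht.1.trans ht.2⟩ ht
    apply S.eq_of_inner_domain
    intro φ
    have e1 := (h.equation φ).eq_add_integral (continuousOn_const.inner h.continuousOn)
      (((continuousOn_const.inner h.continuousOn).neg.integrableOn_Ioo).add
        (continuousOn_const.inner hg).integrableOn_Ioo) ht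
    rw [inner_add_right, ← inner_intervalIntegral_right hi, e1, h.initial]
    congr 1
    refine intervalIntegral.integral_congr fun s _ => ?_
    simp only [inner_add_right, inner_neg_right, inner_generator_incl]
  have h1 := (intervalIntegral.integral_hasDerivAt_right (intervalIntegrable_of_integrableOn_Ioo
    hF.integrableOn_Ioo ⟨le_rfl, (ht.1.trans ht.2).le⟩ (Ioo_subset_Icc_self ht))
    ((hF.mono Ioo_subset_Icc_self).stronglyMeasurableAtFilter isOpen_Ioo t ht)
    (hF.continuousAt (Icc_mem_nhds ht.1 ht.2))).const_add z₀
  refine h1.congr_of_eventuallyEq ?_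
  filter_upwards [Icc_mem_nhds ht.1 ht.2] with s hs using e s hs

theorem IsRiccatiTriple.re_identity {S : C0Group 𝕜 H} {B : U →L[𝕜] S.DAdjDual} {lam : ℝ}
    {Q : H ≃L[𝕜] H} {R : H →L[𝕜] H}
    (hQ : S.IsRiccatiTriple B lam Q R (ContinuousLinearMap.id 𝕜 U)) (x : S.DAdj) :
    2 * RCLike.re (inner 𝕜 (Q (S.incl x)) (S.Astar x)) = ‖S.Bstar B x‖ ^ 2
      - RCLike.re (inner 𝕜 (R (Q (S.incl x))) (Q (S.incl x)))
      - 2 * lam * RCLike.re (inner 𝕜 (Q (S.incl x)) (S.incl x)) := by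
  have h := congrArg RCLike.re (hQ.identity x x)
  have e1 : RCLike.re (inner 𝕜 (S.Astar x) (Q (S.incl x)))
      = RCLike.re (inner 𝕜 (Q (S.incl x)) (S.Astar x)) := inner_re_symm _ _
  have e2 : RCLike.re (inner 𝕜 (S.Bstar B x) (S.Bstar B x)) = ‖S.Bstar B x‖ ^ 2 :=
    inner_self_eq_norm_sq _
  have e3 : RCLike.re (2 * (lam : 𝕜) * inner 𝕜 (Q (S.incl x)) (S.incl x))
      = 2 * lam * RCLike.re (inner 𝕜 (Q (S.incl x)) (S.incl x)) := by
    have : (2 * (lam : 𝕜)) = ((2 * lam : ℝ) : 𝕜) := by push_cast; rfl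
    rw [this, RCLike.re_ofReal_mul]
  simp only [map_add, map_sub, ContinuousLinearMap.id_apply, map_zero] at h
  rw [e1, e2, e3] at h
  linarith

/-- The right-hand side of the energy identity for the quadratic form of `Q`. -/
def energyRate (Q : H ≃L[𝕜] H) (R : H →L[𝕜] H) (β : ℝ) (x g : H) : ℝ :=
  β * RCLike.re (inner 𝕜 (Q x) x) + RCLike.re (inner 𝕜 (R (Q x)) (Q x))
    + 2 * RCLike.re (inner 𝕜 (Q x) g)

theorem continuous_energyRate (Q : H ≃L[𝕜] H) (R : H →L[𝕜] H) (β : ℝ) :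
    Continuous fun p : H × H => energyRate Q R β p.1 p.2 := by
  have hQ : Continuous fun p : H × H => Q p.1 := Q.continuous.comp continuous_fst
  exact ((continuous_const.mul (RCLike.continuous_re.comp (hQ.inner continuous_fst))).add
    (RCLike.continuous_re.comp ((R.continuous.comp hQ).inner hQ))).add
    (continuous_const.mul (RCLike.continuous_re.comp (hQ.inner continuous_snd)))

theorem exists_abs_energyRate_le (Q : H ≃L[𝕜] H) (R : H →L[𝕜] H) (β : ℝ) :
    ∃ K : ℝ, 0 ≤ K ∧ ∀ x g, |energyRate Q R β x g| ≤ K * (‖x‖ ^ 2 + ‖x‖ * ‖g‖) := by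
  set q := ‖(Q : H →L[𝕜] H)‖
  have hq : ∀ x, ‖Q x‖ ≤ q * ‖x‖ := (Q : H →L[𝕜] H).le_opNorm
  have hq0 : 0 ≤ q := norm_nonneg _
  have hre : ∀ x y : H, |RCLike.re (inner 𝕜 x y)| ≤ ‖x‖ * ‖y‖ := fun x y =>
    (RCLike.abs_re_le_norm _).trans (norm_inner_le_norm _ _)
  refine ⟨|β| * q + ‖R‖ * q ^ 2 + 2 * q, by positivity, fun x g => ?_⟩
  have h1 : |RCLike.re (inner 𝕜 (Q x) x)| ≤ q * ‖x‖ * ‖x‖ := (hre _ _).trans (by gcongr; exact hq x)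
  have h2 : |RCLike.re (inner 𝕜 (R (Q x)) (Q x))| ≤ (‖R‖ * (q * ‖x‖)) * (q * ‖x‖) :=
    (hre _ _).trans (by
      gcongr
      · exact (R.le_opNorm _).trans (by gcongr; exact hq x)
      · exact hq x)
  have h3 : |RCLike.re (inner 𝕜 (Q x) g)| ≤ q * ‖x‖ * ‖g‖ := (hre _ _).trans (by gcongr; exact hq x)
  calc _ ≤ |β| * |RCLike.re (inner 𝕜 (Q x) x)| + |RCLike.re (inner 𝕜 (R (Q x)) (Q x))|
        + 2 * |RCLike.re (inner 𝕜 (Q x) g)| := by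
        unfold energyRate
        refine (abs_add_three _ _ _).trans (le_of_eq ?_)
        rw [abs_mul, abs_mul, abs_two]
    _ ≤ |β| * (q * ‖x‖ * ‖x‖) + (‖R‖ * (q * ‖x‖)) * (q * ‖x‖) + 2 * (q * ‖x‖ * ‖g‖) := by gcongr
    _ = (|β| * q + ‖R‖ * q ^ 2) * ‖x‖ ^ 2 + 2 * q * (‖x‖ * ‖g‖) := by ring
    _ ≤ _ := by
        have a1 : 0 ≤ (|β| * q + ‖R‖ * q ^ 2) * (‖x‖ * ‖g‖) := by positivity
        have a2 : 0 ≤ 2 * q * ‖x‖ ^ 2 := by positivity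
        nlinarith

/-- Differentiating the weighted energy produces -2 Re⟨Qz, A*z⟩, and the Riccati identity trades it
for -‖B*z‖² plus bounded terms. The exponent α = 0 serves for observation bounds, α = 2λ for decay.
-/
theorem IsRiccatiTriple.energy_identity {S : C0Group 𝕜 H} {B : U →L[𝕜] S.DAdjDual} {lam : ℝ}
    {Q : H ≃L[𝕜] H} {R : H →L[𝕜] H}
    (hQ : S.IsRiccatiTriple B lam Q R (ContinuousLinearMap.id 𝕜 U)) (α : ℝ) {T : ℝ} {z₀ : H}
    {g : ℝ → H} {z : ℝ → S.DAdj} (h : S.IsAdjointWeakSolution T z₀ g (fun t => S.incl (z t)))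
    (hz : ContinuousOn z (Icc 0 T)) (hg : ContinuousOn g (Icc 0 T)) {t : ℝ} (ht : t ∈ Icc 0 T) :
    Real.exp (α * t) * RCLike.re (inner 𝕜 (Q (S.incl (z t))) (S.incl (z t)))
      + ∫ s in (0:ℝ)..t, Real.exp (α * s) * ‖S.Bstar B (z s)‖ ^ 2
      = RCLike.re (inner 𝕜 (Q z₀) z₀)
        + ∫ s in (0:ℝ)..t, Real.exp (α * s) * energyRate Q R (α + 2 * lam) (S.incl (z s)) (g s) := by
  have hsub : Icc 0 t ⊆ Icc 0 T := Icc_subset_Icc_right ht.2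
  have hz' := hz.mono hsub
  have hg' := hg.mono hsub
  have hzi : ContinuousOn (fun s => S.incl (z s)) (Icc 0 t) := S.continuous_incl.comp_continuousOn hz'
  have hQz : ContinuousOn (fun s => Q (S.incl (z s))) (Icc 0 t) := Q.continuous.comp_continuousOn hzi
  have hexp : Continuous fun s => Real.exp (α * s) := by fun_prop
  have c1 : ContinuousOn (fun s => Real.exp (α * s) * ‖S.Bstar B (z s)‖ ^ 2) (Icc 0 t) :=
    hexp.continuousOn.mul (((S.continuous_Bstar B).comp_continuousOn hz').norm.pow 2)
  have c2 : ContinuousOn (fun s => Real.exp (α * s) *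
      energyRate Q R (α + 2 * lam) (S.incl (z s)) (g s)) (Icc 0 t) :=
    hexp.continuousOn.mul ((continuous_energyRate Q R (α + 2 * lam)).comp_continuousOn
      (hzi.prodMk hg'))
  have i1 := (uIcc_of_le ht.1 ▸ c1 :
    ContinuousOn (fun s => Real.exp (α * s) * ‖S.Bstar B (z s)‖ ^ 2) (uIcc 0 t)).intervalIntegrable
      (μ := volume)
  have i2 := (uIcc_of_le ht.1 ▸ c2 :
    ContinuousOn (fun s => Real.exp (α * s) *
      energyRate Q R (α + 2 * lam) (S.incl (z s)) (g s)) (uIcc 0 t)).intervalIntegrable (μ := volume)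
  have hV : ContinuousOn (fun s => Real.exp (α * s) *
      RCLike.re (inner 𝕜 (Q (S.incl (z s))) (S.incl (z s)))) (Icc 0 t) :=
    hexp.continuousOn.mul (RCLike.continuous_re.comp_continuousOn (hQz.inner hzi))
  have hd : ∀ s ∈ Ioo 0 t, HasDerivAt (fun s => Real.exp (α * s) *
      RCLike.re (inner 𝕜 (Q (S.incl (z s))) (S.incl (z s))))
      (Real.exp (α * s) * energyRate Q R (α + 2 * lam) (S.incl (z s)) (g s)
        - Real.exp (α * s) * ‖S.Bstar B (z s)‖ ^ 2) s := by
    intro s hs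
    have d1 := h.hasDerivAt hz hg ⟨hs.1, hs.2.trans_le ht.2⟩
    have d2 : HasDerivAt (fun s => Q (S.incl (z s))) (Q (-S.Astar (z s) + g s)) s :=
      ((Q : H →L[𝕜] H).hasFDerivAt.restrictScalars ℝ).comp_hasDerivAt s d1
    have d3 := (RCLike.reCLM (K := 𝕜)).hasFDerivAt.comp_hasDerivAt s (d2.inner 𝕜 d1)
    have d4 : HasDerivAt (fun s => Real.exp (α * s)) (Real.exp (α * s) * α) s := by
      have := ((hasDerivAt_id s).const_mul α).exp
      exact HasDerivAt.congr_deriv this (by simp)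
    have d5 := d4.mul d3
    refine HasDerivAt.congr_deriv d5 ?_
    have e1 : RCLike.re (inner 𝕜 (Q (-S.Astar (z s) + g s)) (S.incl (z s)))
        = RCLike.re (inner 𝕜 (Q (S.incl (z s))) (-S.Astar (z s) + g s)) := by
      rw [hQ.Q_symmetric, inner_re_symm]
    have e2 := hQ.re_identity (z s)
    simp only [Function.comp_apply, RCLike.reCLM_apply]
    rw [map_add (RCLike.re : 𝕜 →+ ℝ), e1, inner_add_right, inner_neg_right, map_add, map_neg]
    unfold energyRate
    linear_combination -Real.exp (α * s) * e2
  have key := intervalIntegral.integral_eq_sub_of_hasDerivAt_of_le ht.1 hV hd (i2.sub i1)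
  rw [intervalIntegral.integral_sub i2 i1] at key
  have h0 : S.incl (z 0) = z₀ := h.initial
  simp only [mul_zero, Real.exp_zero, one_mul, h0] at key
  linarith

theorem IsRiccatiTriple.re_inner_nonneg {S : C0Group 𝕜 H} {B : U →L[𝕜] S.DAdjDual} {lam : ℝ}
    {Q : H ≃L[𝕜] H} {R : H →L[𝕜] H} {W : U →L[𝕜] U}
    (hQ : S.IsRiccatiTriple B lam Q R W) (x : H) : 0 ≤ RCLike.re (inner 𝕜 (Q x) x) := by
  obtain ⟨c, hc, h⟩ := hQ.Q_coercive
  exact (by positivity : 0 ≤ c * ‖x‖ ^ 2).trans (h x)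

/-- The observation inequality for regular solutions of the inhomogeneous adjoint equation. -/
theorem IsRiccatiTriple.exists_integral_Bstar_le {S : C0Group 𝕜 H} {B : U →L[𝕜] S.DAdjDual}
    {lam : ℝ} {Q : H ≃L[𝕜] H} {R : H →L[𝕜] H}
    (hQ : S.IsRiccatiTriple B lam Q R (ContinuousLinearMap.id 𝕜 U)) {T : ℝ} (hT : 0 ≤ T) :
    ∃ C : ℝ, 0 ≤ C ∧ ∀ (z₀ : H) (g : ℝ → H) (z : ℝ → S.DAdj),
      S.IsAdjointWeakSolution T z₀ g (fun t => S.incl (z t)) → ContinuousOn z (Icc 0 T) →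
      ContinuousOn g (Icc 0 T) →
      ∫ s in Ioo 0 T, ‖S.Bstar B (z s)‖ ^ 2 ≤ C * (‖z₀‖ + ∫ s in Ioo 0 T, ‖g s‖) ^ 2 := by
  obtain ⟨C, hC0, hC⟩ := IsAdjointWeakSolution.exists_norm_le S T
  obtain ⟨K, hK0, hK⟩ := exists_abs_energyRate_le Q R (0 + 2 * lam)
  set q := ‖(Q : H →L[𝕜] H)‖ with hq
  refine ⟨q + (K * (C ^ 2 * T) + K * C), by positivity, fun z₀ g z h hz hg => ?_⟩
  -- The energy at time T is nonnegative and is dropped; the initial energy and the energy rate are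
  -- then quadratic in ‖z₀‖ + ‖g‖ in L¹.
  have he := hQ.energy_identity 0 h hz hg (t := T) ⟨hT, le_rfl⟩
  simp only [zero_mul, Real.exp_zero, one_mul] at he
  set γ := ∫ s in Ioo 0 T, ‖g s‖ with hγ
  have hγ0 : 0 ≤ γ := integral_nonneg fun _ => norm_nonneg _
  set D := ‖z₀‖ + γ with hD
  have hD0 : 0 ≤ D := by positivity
  have hzb : ∀ t ∈ Icc 0 T, ‖S.incl (z t)‖ ≤ C * D := hC z₀ g _ h hg
  have hgi : IntegrableOn (fun s => ‖g s‖) (Ioo 0 T) := hg.norm.integrableOn_Ioo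
  have hV0 : RCLike.re (inner 𝕜 (Q z₀) z₀) ≤ q * D ^ 2 := by
    have hz0 : ‖z₀‖ ≤ D := by linarith
    calc _ ≤ ‖Q z₀‖ * ‖z₀‖ := (RCLike.re_le_norm _).trans (norm_inner_le_norm _ _)
      _ ≤ (q * ‖z₀‖) * ‖z₀‖ := by gcongr; exact (Q : H →L[𝕜] H).le_opNorm z₀
      _ ≤ (q * D) * D := by gcongr
      _ = _ := by ring
  have hint : ∫ s in (0:ℝ)..T, energyRate Q R (0 + 2 * lam) (S.incl (z s)) (g s)
      ≤ (K * (C ^ 2 * T) + K * C) * D ^ 2 := by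
    have hbi : IntegrableOn (fun s => K * (C * D) ^ 2 + K * (C * D) * ‖g s‖) (Ioo 0 T) :=
      (integrableOn_const (by simp)).add (hgi.const_mul _)
    calc _ ≤ ‖∫ s in (0:ℝ)..T, energyRate Q R (0 + 2 * lam) (S.incl (z s)) (g s)‖ := le_abs_self _
      _ ≤ ∫ s in Ioo 0 T, (K * (C * D) ^ 2 + K * (C * D) * ‖g s‖) := by
          rw [intervalIntegral.integral_of_le hT, integral_Ioc_eq_integral_Ioo]
          refine norm_integral_le_of_norm_le hbi ?_
          filter_upwards [ae_restrict_mem measurableSet_Ioo] with s hs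
          have hs' := hzb s (Ioo_subset_Icc_self hs)
          calc _ ≤ K * (‖S.incl (z s)‖ ^ 2 + ‖S.incl (z s)‖ * ‖g s‖) := hK _ _
            _ ≤ K * ((C * D) ^ 2 + (C * D) * ‖g s‖) := by gcongr
            _ = _ := by ring
      _ = K * (C * D) ^ 2 * T + K * (C * D) * γ := by
          rw [integral_add (integrable_const _) (hgi.const_mul _), setIntegral_const,
            integral_const_mul]
          simp [hT]
          ring
      _ ≤ K * (C * D) ^ 2 * T + K * (C * D) * D := by gcongr; rw [hD]; linarith [norm_nonneg z₀]
      _ = _ := by ring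
  rw [← integral_Ioc_eq_integral_Ioo, ← intervalIntegral.integral_of_le hT]
  have := hQ.re_inner_nonneg (S.incl (z T))
  nlinarith

/-- The average commutes with A and maps D(A) into itself, so it can be moved onto the test vector.
-/
theorem IsAdjointWeakSolution.smooth {S : C0Group 𝕜 H} {T : ℝ} {z₀ : H} {g z : ℝ → H}
    (h : S.IsAdjointWeakSolution T z₀ g z) (ε : ℝ) :
    S.IsAdjointWeakSolution T (S.incl (S.smooth ε z₀)) (fun t => S.incl (S.smooth ε (g t)))
      (fun t => S.incl (S.smooth ε (z t))) where
  source := ((S.mean ε).adjoint.integrable_comp h.source)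
  continuousOn := (S.mean ε).adjoint.continuous.comp_continuousOn h.continuousOn
  initial := by simp only [h.initial]
  equation φ := by
    obtain ⟨hm, he⟩ := S.mean_mem_domain ε φ
    have := h.equation ⟨_, hm⟩
    simp only [incl_smooth, ContinuousLinearMap.adjoint_inner_right]
    rwa [he] at this

theorem exists_norm_incl_smooth_le (S : C0Group 𝕜 H) {ε : ℕ → ℝ}
    (hε : Tendsto ε atTop (𝓝[>] 0)) :
    ∃ C : ℝ, 0 ≤ C ∧ ∀ n x, ‖S.incl (S.smooth (ε n) x)‖ ≤ C * ‖x‖ := by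
  obtain ⟨C, hC⟩ := banach_steinhaus (g := fun n => (S.mean (ε n)).adjoint) fun x => by
    obtain ⟨C, hC⟩ := (S.tendsto_incl_smooth hε x).norm.bddAbove_range
    exact ⟨C, fun n => hC ⟨n, rfl⟩⟩
  have hC0 : 0 ≤ C := (norm_nonneg _).trans (hC 0)
  exact ⟨C, hC0, fun n x => ((S.mean (ε n)).adjoint.le_opNorm x).trans (by gcongr; exact hC n)⟩

/-- Apply the identity to regularized solutions, discard the nonnegative integral of ‖B*z‖², and let
ε → 0: what remains is continuous in H, so B*z need not be defined. -/
theorem IsRiccatiTriple.energy_le {S : C0Group 𝕜 H} {B : U →L[𝕜] S.DAdjDual}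
    {lam : ℝ} {Q : H ≃L[𝕜] H} {R : H →L[𝕜] H}
    (hQ : S.IsRiccatiTriple B lam Q R (ContinuousLinearMap.id 𝕜 U)) (α : ℝ) {T : ℝ} {z₀ : H}
    {g z : ℝ → H} (h : S.IsAdjointWeakSolution T z₀ g z) (hg : ContinuousOn g (Icc 0 T)) {t : ℝ}
    (ht : t ∈ Icc 0 T) :
    Real.exp (α * t) * RCLike.re (inner 𝕜 (Q (z t)) (z t)) ≤ RCLike.re (inner 𝕜 (Q z₀) z₀)
        + ∫ s in (0:ℝ)..t, Real.exp (α * s) * energyRate Q R (α + 2 * lam) (z s) (g s) := by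
  obtain ⟨ε, hε⟩ := exists_tendsto_nhdsGT_zero
  have hsub : uIcc 0 t ⊆ Icc 0 T := by rw [uIcc_of_le ht.1]; exact Icc_subset_Icc_right ht.2
  obtain ⟨C, hC0, hC⟩ := S.exists_norm_incl_smooth_le hε
  obtain ⟨K, hK0, hK⟩ := exists_abs_energyRate_le Q R (α + 2 * lam)
  obtain ⟨Cz, hCz⟩ := isCompact_Icc.exists_bound_of_continuousOn h.continuousOn
  obtain ⟨Cg, hCg⟩ := isCompact_Icc.exists_bound_of_continuousOn hg
  have hCz0 : 0 ≤ Cz := (norm_nonneg _).trans (hCz t ht)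
  have hCg0 : 0 ≤ Cg := (norm_nonneg _).trans (hCg t ht)
  have hVc : Continuous fun x : H => RCLike.re (inner 𝕜 (Q x) x) :=
    RCLike.continuous_re.comp (Q.continuous.inner continuous_id)
  have hexp : Continuous fun s => Real.exp (α * s) := by fun_prop
  have key : ∀ n, Real.exp (α * t) * RCLike.re (inner 𝕜 (Q (S.incl (S.smooth (ε n) (z t))))
      (S.incl (S.smooth (ε n) (z t)))) ≤
      RCLike.re (inner 𝕜 (Q (S.incl (S.smooth (ε n) z₀))) (S.incl (S.smooth (ε n) z₀)))
        + ∫ s in (0:ℝ)..t, Real.exp (α * s) * energyRate Q R (α + 2 * lam)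
          (S.incl (S.smooth (ε n) (z s))) (S.incl (S.smooth (ε n) (g s))) := by
    intro n
    have := hQ.energy_identity α (h.smooth (ε n))
      ((S.smooth (ε n)).continuous.comp_continuousOn h.continuousOn)
      (((S.mean (ε n)).adjoint).continuous.comp_continuousOn hg) ht
    have h0 : 0 ≤ ∫ s in (0:ℝ)..t, Real.exp (α * s) *
        ‖S.Bstar B (S.smooth (ε n) (z s))‖ ^ 2 :=
      intervalIntegral.integral_nonneg ht.1 fun s _ => by positivity
    linarith
  have l1 : ∀ x : H, Tendsto (fun n => S.incl (S.smooth (ε n) x)) atTop (𝓝 x) :=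
    S.tendsto_incl_smooth hε
  refine le_of_tendsto_of_tendsto' (((hVc.tendsto _).comp (l1 (z t))).const_mul _)
    (((hVc.tendsto _).comp (l1 z₀)).add ?_) key
  refine intervalIntegral.tendsto_integral_filter_of_dominated_convergence
    (fun s => Real.exp (α * s) * (K * ((C * Cz) ^ 2 + (C * Cz) * (C * Cg)))) ?_ ?_
    (Continuous.intervalIntegrable (by fun_prop) _ _) ?_
  · refine Eventually.of_forall fun n => ?_
    have : ContinuousOn (fun s => Real.exp (α * s) * energyRate Q R (α + 2 * lam)
        (S.incl (S.smooth (ε n) (z s))) (S.incl (S.smooth (ε n) (g s)))) (Icc 0 T) :=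
      hexp.continuousOn.mul ((continuous_energyRate Q R _).comp_continuousOn
        (((S.mean (ε n)).adjoint.continuous.comp_continuousOn h.continuousOn).prodMk
          ((S.mean (ε n)).adjoint.continuous.comp_continuousOn hg)))
    exact (this.mono (uIoc_subset_uIcc.trans hsub)).aestronglyMeasurable measurableSet_uIoc
  · refine Eventually.of_forall fun n => Eventually.of_forall fun s hs => ?_
    have hs' := hsub (uIoc_subset_uIcc hs)
    rw [norm_mul, Real.norm_eq_abs, abs_of_pos (Real.exp_pos _), Real.norm_eq_abs]
    gcongr
    refine (hK _ _).trans ?_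
    have b1 : ‖S.incl (S.smooth (ε n) (z s))‖ ≤ C * Cz :=
      (hC n _).trans (by gcongr; exact hCz s hs')
    have b2 : ‖S.incl (S.smooth (ε n) (g s))‖ ≤ C * Cg :=
      (hC n _).trans (by gcongr; exact hCg s hs')
    gcongr
  · refine Eventually.of_forall fun s _ => ?_
    have l2 := ((continuous_energyRate Q R (α + 2 * lam)).tendsto (z s, g s)).comp
      ((l1 (z s)).prodMk_nhds (l1 (g s)))
    exact l2.const_mul _

/-- Exponential decay for the costate equation `z' = -A* z - 2 lam z - R Q z`. -/
theorem IsRiccatiTriple.decay {S : C0Group 𝕜 H} {B : U →L[𝕜] S.DAdjDual}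
    {lam : ℝ} {Q : H ≃L[𝕜] H} {R : H →L[𝕜] H}
    (hQ : S.IsRiccatiTriple B lam Q R (ContinuousLinearMap.id 𝕜 U)) {T : ℝ} {z₀ : H} {z : ℝ → H}
    (h : S.IsAdjointWeakSolution T z₀ (fun t => -((2 * (lam : 𝕜)) • z t) - R (Q (z t))) z)
    {t : ℝ} (ht : t ∈ Icc 0 T) :
    Real.exp (2 * lam * t) * RCLike.re (inner 𝕜 (Q (z t)) (z t))
      ≤ RCLike.re (inner 𝕜 (Q z₀) z₀) := by
  have hg : ContinuousOn (fun t => -((2 * (lam : 𝕜)) • z t) - R (Q (z t))) (Icc 0 T) :=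
    (h.continuousOn.const_smul _).neg.sub
      (R.continuous.comp_continuousOn (Q.continuous.comp_continuousOn h.continuousOn))
  have h1 := hQ.energy_le (2 * lam) h hg ht
  -- For this source and α = 2λ, the contributions 4λ⟨Qz,z⟩ cancel and the energy rate is -⟨RQz, Qz⟩
  -- ≤ 0.
  have h2 : ∫ s in (0:ℝ)..t, Real.exp (2 * lam * s) * energyRate Q R (2 * lam + 2 * lam) (z s)
      (-((2 * (lam : 𝕜)) • z s) - R (Q (z s))) ≤ 0 := by
    rw [← neg_nonneg, ← intervalIntegral.integral_neg]
    refine intervalIntegral.integral_nonneg ht.1 fun s _ => ?_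
    have e : energyRate Q R (2 * lam + 2 * lam) (z s) (-((2 * (lam : 𝕜)) • z s) - R (Q (z s)))
        = -RCLike.re (inner 𝕜 (R (Q (z s))) (Q (z s))) := by
      unfold energyRate
      have e1 : (2 * (lam : 𝕜)) = ((2 * lam : ℝ) : 𝕜) := by push_cast; rfl
      rw [inner_sub_right, inner_neg_right, inner_smul_right, map_sub, map_neg, e1,
        RCLike.re_ofReal_mul, inner_re_symm (Q (z s)) (R (Q (z s)))]
      ring
    rw [e, mul_neg, neg_neg]
    exact mul_nonneg (Real.exp_pos _).le (hQ.R_nonneg.re_inner_nonneg_left _)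
  linarith

end C0Group

/-! ### The observation B*z of weak solutions -/

theorem ContinuousOn.memLp_restrict_Ioo {E : Type*} [NormedAddCommGroup E] {f : ℝ → E} {T : ℝ}
    (hf : ContinuousOn f (Icc 0 T)) : MemLp f 2 (volume.restrict (Ioo 0 T)) := by
  obtain ⟨C, hC⟩ := isCompact_Icc.exists_bound_of_continuousOn hf
  refine MemLp.of_bound ((hf.mono Ioo_subset_Icc_self).aestronglyMeasurable measurableSet_Ioo) C ?_
  filter_upwards [ae_restrict_mem measurableSet_Ioo] with s hs
  exact hC s (Ioo_subset_Icc_self hs)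

theorem norm_toLp_sq {α 𝕜 E : Type*} [RCLike 𝕜] [NormedAddCommGroup E] [InnerProductSpace 𝕜 E]
    [MeasurableSpace α] {μ : Measure α} {f : α → E} (hf : MemLp f 2 μ) :
    ‖hf.toLp f‖ ^ 2 = ∫ t, ‖f t‖ ^ 2 ∂μ := by
  have h : inner 𝕜 (hf.toLp f) (hf.toLp f) = ((∫ t, ‖f t‖ ^ 2 ∂μ : ℝ) : 𝕜) := by
    rw [L2.inner_def, ← integral_ofReal]
    refine integral_congr_ae ?_
    filter_upwards [hf.coeFn_toLp] with t ht
    rw [ht, inner_self_eq_norm_sq_to_K]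
    push_cast
    rfl
  rw [inner_self_eq_norm_sq_to_K] at h
  exact_mod_cast h

/-- From ‖f‖ ≤ η + η⁻¹‖f‖², a consequence of (‖f‖ - η)² ≥ 0: choose η small, then n large. -/
theorem tendsto_integral_norm_of_sq {E : Type*} [NormedAddCommGroup E] {T : ℝ} (hT : 0 ≤ T)
    {f : ℕ → ℝ → E} (hf : ∀ n, MemLp (f n) 2 (volume.restrict (Ioo 0 T)))
    (h : Tendsto (fun n => ∫ t in Ioo 0 T, ‖f n t‖ ^ 2) atTop (𝓝 0)) :
    Tendsto (fun n => ∫ t in Ioo 0 T, ‖f n t‖) atTop (𝓝 0) := by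
  have key : ∀ n, ∀ η > 0, ∫ t in Ioo 0 T, ‖f n t‖ ≤ η * T + η⁻¹ * ∫ t in Ioo 0 T, ‖f n t‖ ^ 2 := by
    intro n η hη
    have i2 := (hf n).integrable_norm_pow (p := 2) (by norm_num)
    have i1 : Integrable (fun t => ‖f n t‖) (volume.restrict (Ioo 0 T)) :=
      ((hf n).integrable (by norm_num)).norm
    calc _ ≤ ∫ t in Ioo 0 T, (η + η⁻¹ * ‖f n t‖ ^ 2) := by
          refine integral_mono i1 ((integrable_const _).add (i2.const_mul _)) fun t => ?_
          have h1 : 0 ≤ η⁻¹ * (‖f n t‖ - η) ^ 2 := by positivity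
          have h2 : η⁻¹ * (‖f n t‖ - η) ^ 2 = η⁻¹ * ‖f n t‖ ^ 2 - 2 * ‖f n t‖ + η := by
            field_simp
            ring
          have h3 := norm_nonneg (f n t)
          change ‖f n t‖ ≤ η + η⁻¹ * ‖f n t‖ ^ 2
          linarith
      _ = _ := by
          rw [integral_add (integrable_const _) (i2.const_mul _), integral_const_mul,
            setIntegral_const]
          simp [hT, mul_comm]
  rw [Metric.tendsto_nhds]
  intro ε hε
  set η := ε / (2 * (T + 1)) with hη
  have hη0 : 0 < η := by positivity
  have hηT : η * T < ε / 2 := by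
    rw [hη, div_mul_eq_mul_div, div_lt_div_iff₀ (by positivity) (by norm_num)]
    nlinarith
  filter_upwards [h.eventually (gt_mem_nhds (show 0 < η * (ε / 2) by positivity))] with n hn
  rw [Real.dist_0_eq_abs, abs_of_nonneg (integral_nonneg fun _ => norm_nonneg _)]
  have h1 : η⁻¹ * ∫ t in Ioo 0 T, ‖f n t‖ ^ 2 < ε / 2 := by
    rwa [inv_mul_lt_iff₀ hη0]
  linarith [key n η hη0]

theorem HasDistribDeriv.mono {𝕜 : Type*} [RCLike 𝕜] {T T' : ℝ} {f g : ℝ → 𝕜}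
    (h : HasDistribDeriv T f g) (hT : T' ≤ T) : HasDistribDeriv T' f g := by
  intro θ hθ hc hs
  have hsub : Ioo 0 T' ⊆ Ioo 0 T := Ioo_subset_Ioo_right hT
  have hz : ∀ t, t ∉ Ioo 0 T' → θ t = 0 := fun t ht =>
    image_eq_zero_of_notMem_tsupport fun h => ht (hs h)
  have hz' : ∀ t, t ∉ Ioo 0 T' → deriv θ t = 0 := fun t ht =>
    image_eq_zero_of_notMem_tsupport fun h => ht (hs (tsupport_deriv_subset h))
  have e := h θ hθ hc (hs.trans hsub)
  rwa [setIntegral_eq_of_subset_of_forall_sdiff_eq_zero measurableSet_Ioo hsub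
    (fun t ht => by rw [hz' t ht.2]; simp),
    setIntegral_eq_of_subset_of_forall_sdiff_eq_zero measurableSet_Ioo hsub
    (fun t ht => by rw [hz t ht.2]; simp)] at e

namespace C0Group

variable {𝕜 H U : Type*} [RCLike 𝕜] [NormedAddCommGroup H] [InnerProductSpace 𝕜 H]
  [CompleteSpace H] [NormedAddCommGroup U] [InnerProductSpace 𝕜 U] [CompleteSpace U]

theorem IsAdjointWeakSolution.mono {S : C0Group 𝕜 H} {T T' : ℝ} {z₀ : H} {g z : ℝ → H}
    (h : S.IsAdjointWeakSolution T z₀ g z) (hT : T' ≤ T) : S.IsAdjointWeakSolution T' z₀ g z where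
  source := h.source.mono_set (Ioo_subset_Ioo_right hT)
  continuousOn := h.continuousOn.mono (Icc_subset_Icc_right hT)
  initial := h.initial
  equation φ := (h.equation φ).mono hT

theorem IsAdjointWeakSolution.congr {S : C0Group 𝕜 H} {T : ℝ} {z₀ : H} {g g' z : ℝ → H}
    (h : S.IsAdjointWeakSolution T z₀ g z) (hg : g = g') : S.IsAdjointWeakSolution T z₀ g' z :=
  hg ▸ h

theorem continuousOn_incl_comp {S : C0Group 𝕜 H} {z : ℝ → S.DAdj} {s : Set ℝ}
    (hz : ContinuousOn z s) : ContinuousOn (fun t => S.incl (z t)) s :=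
  S.inclL.continuous.comp_continuousOn hz

theorem memLp_Bstar {S : C0Group 𝕜 H} (B : U →L[𝕜] S.DAdjDual) {T : ℝ} {z : ℝ → S.DAdj}
    (hz : ContinuousOn z (Icc 0 T)) :
    MemLp (fun t => S.Bstar B (z t)) 2 (volume.restrict (Ioo 0 T)) :=
  ((S.BstarL B).continuous.comp_continuousOn hz).memLp_restrict_Ioo

theorem IsObservation.mono {S : C0Group 𝕜 H} {B : U →L[𝕜] S.DAdjDual} {T T' : ℝ} {g z : ℝ → H}
    {v : ℝ → U} (h : S.IsObservation B T g z v) (hT : T' ≤ T) (hg : IntegrableOn g (Ioo 0 T)) :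
    S.IsObservation B T' g z v := by
  obtain ⟨hv, gn, zn, hgn, hzn, hsol, h0, h1, h2⟩ := h
  have hsub : Ioo 0 T' ⊆ Ioo 0 T := Ioo_subset_Ioo_right hT
  refine ⟨hv.mono_measure (Measure.restrict_mono hsub le_rfl), gn, zn,
    fun n => (hgn n).mono (Icc_subset_Icc_right hT), fun n => (hzn n).mono (Icc_subset_Icc_right hT),
    fun n => (hsol n).mono hT, h0, ?_, ?_⟩
  · refine squeeze_zero (fun n => integral_nonneg fun _ => norm_nonneg _) (fun n => ?_) h1
    exact setIntegral_mono_set (((continuousOn_incl_comp (hgn n)).integrableOn_Ioo).sub hg).norm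
      (Eventually.of_forall fun _ => norm_nonneg _) hsub.eventuallyLE
  · refine squeeze_zero (fun n => integral_nonneg fun _ => by positivity) (fun n => ?_) h2
    exact setIntegral_mono_set (((memLp_Bstar B (hzn n)).sub hv).integrable_norm_pow (by norm_num))
      (Eventually.of_forall fun _ => by positivity) hsub.eventuallyLE

theorem IsObservation.congr_ae {S : C0Group 𝕜 H} {B : U →L[𝕜] S.DAdjDual} {T : ℝ} {g z : ℝ → H}
    {v v' : ℝ → U} (h : S.IsObservation B T g z v) (hv : v =ᵐ[volume.restrict (Ioo 0 T)] v') :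
    S.IsObservation B T g z v' := by
  obtain ⟨h0, gn, zn, hgn, hzn, hsol, h1, h2, h3⟩ := h
  refine ⟨h0.ae_eq hv, gn, zn, hgn, hzn, hsol, h1, h2, h3.congr fun n => integral_congr_ae ?_⟩
  filter_upwards [hv] with t ht
  rw [ht]

variable [NormedSpace ℝ H] [IsScalarTower ℝ 𝕜 H]

/-- The observation inequality for a difference, with the data compared to a common reference (w,
k). It covers two terms of one approximating sequence (existence) and terms of two sequences
(uniqueness). -/
theorem IsRiccatiTriple.exists_integral_Bstar_sub_le {S : C0Group 𝕜 H} {B : U →L[𝕜] S.DAdjDual}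
    {lam : ℝ} {Q : H ≃L[𝕜] H} {R : H →L[𝕜] H}
    (hQ : S.IsRiccatiTriple B lam Q R (ContinuousLinearMap.id 𝕜 U)) {T : ℝ} (hT : 0 ≤ T) :
    ∃ C : ℝ, 0 ≤ C ∧ ∀ (z₀ z₀' : H) (g g' : ℝ → S.DAdj) (z z' : ℝ → S.DAdj),
      S.IsAdjointWeakSolution T z₀ (fun t => S.incl (g t)) (fun t => S.incl (z t)) →
      S.IsAdjointWeakSolution T z₀' (fun t => S.incl (g' t)) (fun t => S.incl (z' t)) →
      ContinuousOn z (Icc 0 T) → ContinuousOn z' (Icc 0 T) →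
      ContinuousOn g (Icc 0 T) → ContinuousOn g' (Icc 0 T) →
      ∀ (w : H) (k : ℝ → H), IntegrableOn k (Ioo 0 T) →
      ∫ s in Ioo 0 T, ‖S.Bstar B (z s) - S.Bstar B (z' s)‖ ^ 2
        ≤ C * ((‖z₀ - w‖ + ∫ s in Ioo 0 T, ‖S.incl (g s) - k s‖)
          + (‖z₀' - w‖ + ∫ s in Ioo 0 T, ‖S.incl (g' s) - k s‖)) ^ 2 := by
  obtain ⟨C, hC0, hC⟩ := hQ.exists_integral_Bstar_le hT
  refine ⟨C, hC0, fun z₀ z₀' g g' z z' h h' hz hz' hg hg' w k hk => ?_⟩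
  have e : ∀ a b : S.DAdj, S.incl (a - b) = S.incl a - S.incl b := S.inclL.map_sub
  have eB : ∀ a b : S.DAdj, S.Bstar B (a - b) = S.Bstar B a - S.Bstar B b := (S.BstarL B).map_sub
  have hgc := continuousOn_incl_comp hg
  have hgc' := continuousOn_incl_comp hg'
  have hd := h.sub h'
  simp only [← e (z _)] at hd
  have := hC _ _ (fun t => z t - z' t) hd (hz.sub hz') (hgc.sub hgc')
  simp only [eB] at this
  refine this.trans ?_
  have i1 : Integrable (fun s => ‖S.incl (g s) - k s‖) (volume.restrict (Ioo 0 T)) :=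
    (hgc.integrableOn_Ioo.sub hk).norm
  have i2 : Integrable (fun s => ‖S.incl (g' s) - k s‖) (volume.restrict (Ioo 0 T)) :=
    (hgc'.integrableOn_Ioo.sub hk).norm
  have b1 : ‖z₀ - z₀'‖ ≤ ‖z₀ - w‖ + ‖z₀' - w‖ := by
    rw [← sub_sub_sub_cancel_right z₀ z₀' w]; exact norm_sub_le _ _
  have b2 : ∫ s in Ioo 0 T, ‖S.incl (g s) - S.incl (g' s)‖ ≤ (∫ s in Ioo 0 T, ‖S.incl (g s) - k s‖)
      + ∫ s in Ioo 0 T, ‖S.incl (g' s) - k s‖ := by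
    rw [← integral_add i1 i2]
    refine integral_mono ((hgc.sub hgc').norm.integrableOn_Ioo) (i1.add i2) fun s => ?_
    change _ ≤ ‖S.incl (g s) - k s‖ + ‖S.incl (g' s) - k s‖
    rw [← sub_sub_sub_cancel_right _ _ (k s)]
    exact norm_sub_le _ _
  have p : 0 ≤ ∫ s in Ioo 0 T, ‖S.incl (g s) - S.incl (g' s)‖ :=
    integral_nonneg fun _ => norm_nonneg _
  exact mul_le_mul_of_nonneg_left (pow_le_pow_left₀ (add_nonneg (norm_nonneg _) p)
    (by linarith) 2) hC0

/-- The observation `B* z` is determined by the data `(z(0), g)`. -/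
theorem IsRiccatiTriple.observation_unique {S : C0Group 𝕜 H} {B : U →L[𝕜] S.DAdjDual}
    {lam : ℝ} {Q : H ≃L[𝕜] H} {R : H →L[𝕜] H}
    (hQ : S.IsRiccatiTriple B lam Q R (ContinuousLinearMap.id 𝕜 U)) {T : ℝ} (hT : 0 ≤ T)
    {g g' z z' : ℝ → H} {v v' : ℝ → U} (h : S.IsObservation B T g z v)
    (h' : S.IsObservation B T g' z' v') (hz : z 0 = z' 0) (hg : EqOn g g' (Ioo 0 T))
    (hgi : IntegrableOn g (Ioo 0 T)) : v =ᵐ[volume.restrict (Ioo 0 T)] v' := by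
  obtain ⟨hv, gn, zn, hgn, hzn, hsol, h0, h1, h2⟩ := h
  obtain ⟨hv', gn', zn', hgn', hzn', hsol', h0', h1', h2'⟩ := h'
  obtain ⟨C, hC0, hC⟩ := hQ.exists_integral_Bstar_sub_le hT
  have h1'' : Tendsto (fun n => ∫ t in Ioo 0 T, ‖S.incl (gn' n t) - g t‖) atTop (𝓝 0) :=
    h1'.congr fun n => setIntegral_congr_fun measurableSet_Ioo fun t ht => by simp only [hg ht]
  have l0 : Tendsto (fun n => ‖S.incl (zn n 0) - z 0‖) atTop (𝓝 0) :=
    tendsto_iff_norm_sub_tendsto_zero.1 h0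
  have l0' : Tendsto (fun n => ‖S.incl (zn' n 0) - z 0‖) atTop (𝓝 0) :=
    tendsto_iff_norm_sub_tendsto_zero.1 (hz ▸ h0')
  have l3 : Tendsto (fun n => ∫ s in Ioo 0 T, ‖S.Bstar B (zn n s) - S.Bstar B (zn' n s)‖ ^ 2)
      atTop (𝓝 0) := by
    have := (((l0.add h1).add (l0'.add h1'')).pow 2).const_mul C
    simp only [add_zero, ne_eq, OfNat.ofNat_ne_zero, not_false_eq_true, zero_pow, mul_zero] at this
    exact squeeze_zero (fun n => integral_nonneg fun _ => by positivity)
      (fun n => hC _ _ _ _ _ _ (hsol n) (hsol' n) (hzn n) (hzn' n) (hgn n) (hgn' n) (z 0) g hgi) this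
  have iv := (hv.sub hv').integrable_norm_pow (p := 2) (by norm_num)
  have key : ∫ t in Ioo 0 T, ‖(v - v') t‖ ^ 2 ≤ 0 := by
    -- The factor 3 comes from (a + b + c)² ≤ 3(a² + b² + c²), along the chain v, B*zₙ, B*zₙ', v'.
    have l := ((h2.add l3).add h2').const_mul 3
    simp only [add_zero, mul_zero] at l
    refine ge_of_tendsto' l fun n => ?_
    have i1 := ((memLp_Bstar B (hzn n)).sub hv).integrable_norm_pow (p := 2) (by norm_num)
    have i2 := ((memLp_Bstar B (hzn n)).sub (memLp_Bstar B (hzn' n))).integrable_norm_pow (p := 2)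
      (by norm_num)
    have i3 := ((memLp_Bstar B (hzn' n)).sub hv').integrable_norm_pow (p := 2) (by norm_num)
    simp only [Pi.sub_apply] at i1 i2 i3 iv ⊢
    have i12 : Integrable (fun t => ‖S.Bstar B (zn n t) - v t‖ ^ 2
        + ‖S.Bstar B (zn n t) - S.Bstar B (zn' n t)‖ ^ 2) (volume.restrict (Ioo 0 T)) := i1.add i2
    rw [← integral_add i1 i2, ← integral_add i12 i3, ← integral_const_mul]
    refine integral_mono iv ((i12.add i3).const_mul 3) fun t => ?_
    set a := S.Bstar B (zn n t)
    set b := S.Bstar B (zn' n t)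
    change ‖v t - v' t‖ ^ 2 ≤ 3 * (‖a - v t‖ ^ 2 + ‖a - b‖ ^ 2 + ‖b - v' t‖ ^ 2)
    have hab : ‖v t - v' t‖ ≤ ‖a - v t‖ + ‖a - b‖ + ‖b - v' t‖ := by
      have e : v t - v' t = -(a - v t) + (a - b) + (b - v' t) := by abel
      rw [e, ← norm_neg (a - v t)]
      exact norm_add₃_le
    have := pow_le_pow_left₀ (norm_nonneg _) hab 2
    nlinarith [sq_nonneg (‖a - v t‖ - ‖a - b‖), sq_nonneg (‖a - v t‖ - ‖b - v' t‖),
      sq_nonneg (‖a - b‖ - ‖b - v' t‖)]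
  have hz0 := (integral_eq_zero_iff_of_nonneg (fun t => by positivity) iv).1
    (le_antisymm key (integral_nonneg fun t => by positivity))
  filter_upwards [hz0] with t ht
  have : ‖(v - v') t‖ ^ 2 = 0 := ht
  rw [sq_eq_zero_iff, norm_eq_zero, Pi.sub_apply, sub_eq_zero] at this
  exact this

/-- Existence of the observation `B* z` for a weak solution with continuous source. -/
theorem IsRiccatiTriple.exists_observation {S : C0Group 𝕜 H} {B : U →L[𝕜] S.DAdjDual}
    {lam : ℝ} {Q : H ≃L[𝕜] H} {R : H →L[𝕜] H}
    (hQ : S.IsRiccatiTriple B lam Q R (ContinuousLinearMap.id 𝕜 U)) {T : ℝ} (hT : 0 ≤ T)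
    {z₀ : H} {g z : ℝ → H} (h : S.IsAdjointWeakSolution T z₀ g z) (hg : ContinuousOn g (Icc 0 T)) :
    ∃ v : ℝ → U, S.IsObservation B T g z v := by
  obtain ⟨ε, hε⟩ := exists_tendsto_nhdsGT_zero
  obtain ⟨C, hC0, hC⟩ := hQ.exists_integral_Bstar_sub_le hT
  obtain ⟨M, hM0, hM⟩ := S.exists_norm_incl_smooth_le hε
  have hgn : ∀ n, ContinuousOn (fun t => S.smooth (ε n) (g t)) (Icc 0 T) := fun n =>
    (S.smooth (ε n)).continuous.comp_continuousOn hg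
  have hzn : ∀ n, ContinuousOn (fun t => S.smooth (ε n) (z t)) (Icc 0 T) := fun n =>
    (S.smooth (ε n)).continuous.comp_continuousOn h.continuousOn
  have hgi : IntegrableOn g (Ioo 0 T) := h.source
  have l0 : ∀ x, Tendsto (fun n => S.incl (S.smooth (ε n) x)) atTop (𝓝 x) :=
    S.tendsto_incl_smooth hε
  have lg : Tendsto (fun n => ∫ t in Ioo 0 T, ‖S.incl (S.smooth (ε n) (g t)) - g t‖)
      atTop (𝓝 0) := by
    suffices h : Tendsto (fun n => ∫ t in Ioo 0 T, ‖S.incl (S.smooth (ε n) (g t)) - g t‖) atTop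
        (𝓝 (∫ _ in Ioo 0 T, (0 : ℝ))) by rwa [integral_zero] at h
    refine tendsto_integral_of_dominated_convergence (fun t => (M + 1) * ‖g t‖) (fun n => ?_)
      (hgi.norm.const_mul _) (fun n => Eventually.of_forall fun t => ?_)
      (Eventually.of_forall fun t => tendsto_iff_norm_sub_tendsto_zero.1 (l0 (g t)))
    · exact (((continuousOn_incl_comp (hgn n)).integrableOn_Ioo).sub hgi).norm.aestronglyMeasurable
    · rw [norm_norm, add_mul, one_mul]
      exact (norm_sub_le _ _).trans (by gcongr; exact hM n _)
  set a : ℕ → ℝ := fun n => ‖S.incl (S.smooth (ε n) z₀) - z₀‖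
    + ∫ t in Ioo 0 T, ‖S.incl (S.smooth (ε n) (g t)) - g t‖ with ha
  have la : Tendsto a atTop (𝓝 0) := by
    simpa using (tendsto_iff_norm_sub_tendsto_zero.1 (l0 z₀)).add lg
  have ha0 : ∀ n, 0 ≤ a n := fun n =>
    add_nonneg (norm_nonneg _) (integral_nonneg fun _ => norm_nonneg _)
  have hmem : ∀ n, MemLp (fun t => S.Bstar B (S.smooth (ε n) (z t))) 2
      (volume.restrict (Ioo 0 T)) := fun n => memLp_Bstar B (hzn n)
  -- With a n the error of the n-th regularized data, this makes the regular observations Cauchy in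
  -- L²; v is their limit.
  have hdist : ∀ n m, ‖(hmem n).toLp _ - (hmem m).toLp _‖ ≤ Real.sqrt C * (a n + a m) := by
    intro n m
    rw [← MemLp.toLp_sub]
    refine le_of_sq_le_sq ?_ (mul_nonneg (Real.sqrt_nonneg _) (add_nonneg (ha0 n) (ha0 m)))
    rw [norm_toLp_sq (𝕜 := 𝕜), mul_pow, Real.sq_sqrt hC0]
    exact hC _ _ _ _ _ _ (h.smooth (ε n)) (h.smooth (ε m)) (hzn n) (hzn m) (hgn n) (hgn m) z₀ g hgi
  have hcauchy : CauchySeq fun n => (hmem n).toLp _ := by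
    rw [Metric.cauchySeq_iff]
    intro δ hδ
    have l2 : Tendsto (fun n => Real.sqrt C * a n) atTop (𝓝 0) := by simpa using la.const_mul _
    obtain ⟨N, hN⟩ := eventually_atTop.1 (l2.eventually (gt_mem_nhds (half_pos hδ)))
    refine ⟨N, fun m hm n hn => ?_⟩
    rw [dist_eq_norm]
    have := hdist m n
    rw [mul_add] at this
    linarith [hN m hm, hN n hn]
  obtain ⟨v, hv⟩ := cauchySeq_tendsto_of_complete hcauchy
  refine ⟨v, Lp.memLp v, fun n t => S.smooth (ε n) (g t), fun n t => S.smooth (ε n) (z t), hgn, hzn,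
    fun n => ?_, l0 (z 0), lg, ?_⟩
  · have := h.smooth (ε n)
    rwa [← h.initial] at this
  · have := (tendsto_iff_norm_sub_tendsto_zero.1 hv).pow 2
    simp only [ne_eq, OfNat.ofNat_ne_zero, not_false_eq_true, zero_pow] at this
    refine this.congr fun n => ?_
    have e : (hmem n).toLp _ - v = ((hmem n).sub (Lp.memLp v)).toLp _ := by
      rw [MemLp.toLp_sub (hmem n) (Lp.memLp v), Lp.toLp_coeFn v (Lp.memLp v)]
    rw [e, norm_toLp_sq (𝕜 := 𝕜)]
    rfl

/-- Observations on (0, k + 1) agree almost everywhere by uniqueness, so t ↦ v_⌊t⌋(t) glues them; t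
< ⌊t⌋ + 1 guarantees that the chosen piece is meaningful at t. -/
theorem IsRiccatiTriple.exists_global_observation {S : C0Group 𝕜 H} {B : U →L[𝕜] S.DAdjDual}
    {lam : ℝ} {Q : H ≃L[𝕜] H} {R : H →L[𝕜] H}
    (hQ : S.IsRiccatiTriple B lam Q R (ContinuousLinearMap.id 𝕜 U))
    {z₀ : H} {g z : ℝ → H} (h : ∀ T, S.IsAdjointWeakSolution T z₀ g z) (hg : Continuous g) :
    ∃ v : ℝ → U, ∀ T, 0 < T → S.IsObservation B T g z v := by
  have hex : ∀ k : ℕ, ∃ v : ℝ → U, S.IsObservation B ((k : ℝ) + 1) g z v := fun k =>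
    hQ.exists_observation (by positivity) (h _) hg.continuousOn
  choose vk hvk using hex
  have hgi : ∀ T, IntegrableOn g (Ioo 0 T) := fun T => hg.continuousOn.integrableOn_Ioo
  refine ⟨fun t => vk ⌊t⌋₊ t, fun T hT => ?_⟩
  have hTN : T ≤ (⌊T⌋₊ : ℝ) + 1 := (Nat.lt_floor_add_one T).le
  refine ((hvk ⌊T⌋₊).mono hTN (hgi _)).congr_ae ?_
  have hall : ∀ k : ℕ, ∀ᵐ t, k ≤ ⌊T⌋₊ → t ∈ Ioo (0 : ℝ) (k + 1) → vk ⌊T⌋₊ t = vk k t := by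
    intro k
    by_cases hk : k ≤ ⌊T⌋₊
    · have hk' : (k : ℝ) + 1 ≤ (⌊T⌋₊ : ℝ) + 1 := by gcongr
      have := hQ.observation_unique (by positivity) ((hvk ⌊T⌋₊).mono hk' (hgi _)) (hvk k) rfl
        (fun _ _ => rfl) (hgi _)
      filter_upwards [(ae_restrict_iff' measurableSet_Ioo).1 this] with t ht _ ht2 using ht ht2
    · exact Eventually.of_forall fun t h => absurd h hk
  filter_upwards [ae_restrict_of_ae (ae_all_iff.2 hall), ae_restrict_mem measurableSet_Ioo]
    with t ht hm
  exact ht ⌊t⌋₊ (Nat.floor_le_floor hm.2.le) ⟨hm.1, Nat.lt_floor_add_one t⟩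

end C0Group

/-! ### The closed loop: existence, uniqueness, decay -/

theorem tendsto_integral_norm_of_le_mul_add {E : Type*} [NormedAddCommGroup E]
    {T : ℝ} {f : ℕ → ℝ → E} {a : ℕ → ℝ → ℝ} (hf : ∀ n, IntegrableOn (f n) (Ioo 0 T)) (ha : ∀ n, IntegrableOn (a n) (Ioo 0 T))
    (hle : ∀ n, ∀ t ∈ Ioo 0 T, ‖f n t‖ ≤ a n t)
    (hlim : Tendsto (fun n => ∫ t in Ioo 0 T, a n t) atTop (𝓝 0)) :
    Tendsto (fun n => ∫ t in Ioo 0 T, ‖f n t‖) atTop (𝓝 0) :=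
  squeeze_zero (fun _ => integral_nonneg fun _ => norm_nonneg _)
    (fun n => setIntegral_mono_on (hf n).norm (ha n) measurableSet_Ioo (hle n)) hlim

namespace C0Group

variable {𝕜 H U : Type*} [RCLike 𝕜] [NormedAddCommGroup H] [InnerProductSpace 𝕜 H]
  [CompleteSpace H] [NormedAddCommGroup U] [InnerProductSpace 𝕜 U] [CompleteSpace U]
  [NormedSpace ℝ H] [IsScalarTower ℝ 𝕜 H]

/-- If `z` solves the closed-loop adjoint equation with observation `v`, then `Q z` solves the
state equation with control `-v`. -/
theorem IsRiccatiTriple.isWeakSolution {S : C0Group 𝕜 H} {B : U →L[𝕜] S.DAdjDual}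
    {lam : ℝ} {Q : H ≃L[𝕜] H} {R : H →L[𝕜] H}
    (hQ : S.IsRiccatiTriple B lam Q R (ContinuousLinearMap.id 𝕜 U)) {T : ℝ} (hT : 0 ≤ T) {z₀ : H}
    {z : ℝ → H} {v : ℝ → U}
    (h : S.IsAdjointWeakSolution T z₀ (fun t => -((2 * (lam : 𝕜)) • z t) - R (Q (z t))) z)
    (hobs : S.IsObservation B T (fun t => -((2 * (lam : 𝕜)) • z t) - R (Q (z t))) z v) :
    S.IsWeakSolution B T (Q z₀) (fun t => -(ContinuousLinearMap.id 𝕜 U) (v t))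
      (fun t => Q (z t)) := by
  set g : ℝ → H := fun t => -((2 * (lam : 𝕜)) • z t) - R (Q (z t)) with hgdef
  have hg : ContinuousOn g (Icc 0 T) := (h.continuousOn.const_smul _).neg.sub
      (R.continuous.comp_continuousOn (Q.continuous.comp_continuousOn h.continuousOn))
  obtain ⟨hv, gn, zn, hgn, hzn, hsol, h0, h1, h2⟩ := hobs
  have hv1 : IntegrableOn v (Ioo 0 T) := hv.integrable (by norm_num)
  refine ⟨hv.neg, Q.continuous.comp_continuousOn h.continuousOn, by rw [h.initial], fun φ => ?_⟩
  have hgn' := fun n => continuousOn_incl_comp (hgn n)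
  have hzn' := fun n => continuousOn_incl_comp (hzn n)
  have hAn : ∀ n, ContinuousOn (fun t => S.Astar (zn n t)) (Icc 0 T) := fun n =>
    S.continuous_Astar.comp_continuousOn (hzn n)
  have hBn := fun n => (S.continuous_Bstar B).comp_continuousOn (hzn n)
  have hR : ∀ x y, inner 𝕜 (R x) y = inner 𝕜 x (R y) := hQ.R_nonneg.1
  -- The Riccati identity with x = φ rewrites ⟨Qφ, -A*zₙ + gₙ⟩ as ⟨c, zₙ⟩ - ⟨B*φ, B*zₙ⟩ + ⟨Qφ, gₙ⟩.
  -- A* no longer falls on zₙ, so the expression has a limit.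
  set c : H := Q (S.Astar φ) + Q (R (Q (S.incl φ))) + (2 * (lam : 𝕜)) • Q (S.incl φ) with hc
  have hcz : ∀ x : H, inner 𝕜 c x = inner 𝕜 (S.Astar φ) (Q x) + inner 𝕜 (R (Q (S.incl φ))) (Q x)
      + 2 * (lam : 𝕜) * inner 𝕜 (Q (S.incl φ)) x := by
    intro x
    rw [hc, inner_add_left, inner_add_left, inner_smul_left, hQ.Q_symmetric, hQ.Q_symmetric (R _)]
    simp [map_ofNat]
  have hGn : ∀ n t, inner 𝕜 (Q (S.incl φ)) (-S.Astar (zn n t) + S.incl (gn n t))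
      = inner 𝕜 c (S.incl (zn n t)) - inner 𝕜 (S.Bstar B φ) (S.Bstar B (zn n t))
        + inner 𝕜 (Q (S.incl φ)) (S.incl (gn n t)) := by
    intro n t
    have := hQ.identity φ (zn n t)
    rw [ContinuousLinearMap.id_apply] at this
    rw [hcz, inner_add_right, inner_neg_right]
    linear_combination -this
  -- In the limit the R and λ terms of c cancel against the source g, which leaves exactly the
  -- right-hand side of the state equation.
  have hG : ∀ t, inner 𝕜 (S.Astar φ) (Q (z t))
        + inner 𝕜 (S.Bstar B φ) (-(ContinuousLinearMap.id 𝕜 U) (v t))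
      = inner 𝕜 c (z t) - inner 𝕜 (S.Bstar B φ) (v t) + inner 𝕜 (Q (S.incl φ)) (g t) := by
    intro t
    rw [hcz, hgdef]
    simp only [ContinuousLinearMap.id_apply, inner_neg_right, inner_sub_right, inner_smul_right, hR]
    ring
  obtain ⟨C, hC0, hC⟩ := IsAdjointWeakSolution.exists_norm_le S T
  set d : ℕ → ℝ := fun n => C * (‖S.incl (zn n 0) - z 0‖
    + ∫ t in Ioo 0 T, ‖S.incl (gn n t) - g t‖) with hd
  have hd0 : Tendsto d atTop (𝓝 0) := by
    simpa using ((tendsto_iff_norm_sub_tendsto_zero.1 h0).add h1).const_mul C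
  -- Linearity and the a priori bound turn convergence of the data into uniform convergence of zₙ on
  -- [0,T].
  have hzd : ∀ n, ∀ t ∈ Icc 0 T, ‖S.incl (zn n t) - z t‖ ≤ d n := by
    intro n t ht
    rw [hd, h.initial]
    exact hC _ _ _ ((hsol n).sub h) ((hgn' n).sub hg) t ht
  have hB1 : Tendsto (fun n => ∫ t in Ioo 0 T, ‖S.Bstar B (zn n t) - v t‖) atTop (𝓝 0) :=
    tendsto_integral_norm_of_sq hT (f := fun n t => S.Bstar B (zn n t) - v t)
      (fun n => (memLp_Bstar B (hzn n)).sub hv) h2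
  have hfi : IntegrableOn (fun t => inner 𝕜 (S.incl φ) (Q (z t))) (Ioo 0 T) :=
    (continuousOn_const.inner (Q.continuous.comp_continuousOn h.continuousOn)).integrableOn_Ioo
  have hfni : ∀ n, IntegrableOn (fun t => inner 𝕜 (S.incl φ) (Q (S.incl (zn n t)))) (Ioo 0 T) :=
    fun n => (continuousOn_const.inner (Q.continuous.comp_continuousOn (hzn' n))).integrableOn_Ioo
  have hGi : IntegrableOn (fun t => inner 𝕜 (S.Astar φ) (Q (z t))
        + inner 𝕜 (S.Bstar B φ) (-(ContinuousLinearMap.id 𝕜 U) (v t))) (Ioo 0 T) :=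
    Integrable.add
      (continuousOn_const.inner (Q.continuous.comp_continuousOn h.continuousOn)).integrableOn_Ioo
      (hv1.neg.const_inner _)
  have hGni : ∀ n, IntegrableOn (fun t => inner 𝕜 (Q (S.incl φ))
      (-S.Astar (zn n t) + S.incl (gn n t))) (Ioo 0 T) := fun n =>
    (continuousOn_const.inner ((hAn n).neg.add (hgn' n))).integrableOn_Ioo
  refine HasDistribDeriv.of_tendsto (F := fun n t => inner 𝕜 (S.incl φ) (Q (S.incl (zn n t))))
    (G := fun n t => inner 𝕜 (Q (S.incl φ)) (-S.Astar (zn n t) + S.incl (gn n t)))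
    (fun n => ?_) hfni hfi hGni hGi ?_ ?_
  · refine HasDistribDeriv.of_hasDerivAt
      (continuousOn_const.inner (Q.continuous.comp_continuousOn (hzn' n)))
      (continuousOn_const.inner ((hAn n).neg.add (hgn' n))) fun t ht => ?_
    have h3 := (hasDerivAt_const t (Q (S.incl φ))).inner 𝕜
      ((hsol n).hasDerivAt (hzn n) (hgn' n) ht)
    rw [inner_zero_left, add_zero] at h3
    refine h3.congr_of_eventuallyEq (Eventually.of_forall fun s => ?_)
    exact (hQ.Q_symmetric _ _).symm
  · refine tendsto_integral_norm_of_le_mul_add (a := fun n _ => ‖Q (S.incl φ)‖ * d n)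
      (fun n => (hfni n).sub hfi) (fun n => integrableOn_const measure_Ioo_lt_top.ne) (fun n t ht => ?_) ?_
    · rw [← hQ.Q_symmetric, ← hQ.Q_symmetric, ← inner_sub_right]
      exact (norm_inner_le_norm _ _).trans (mul_le_mul_of_nonneg_left
        (hzd n t (Ioo_subset_Icc_self ht)) (norm_nonneg _))
    · simp only [setIntegral_const, smul_eq_mul]
      simpa using (hd0.const_mul ‖Q (S.incl φ)‖).const_mul (volume.real (Ioo 0 T))
  · have iB : ∀ n, IntegrableOn (fun t => ‖S.Bstar B (zn n t) - v t‖) (Ioo 0 T) := fun n =>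
      ((hBn n).integrableOn_Ioo.sub hv1).norm
    have ig : ∀ n, IntegrableOn (fun t => ‖S.incl (gn n t) - g t‖) (Ioo 0 T) := fun n =>
      ((hgn' n).integrableOn_Ioo.sub h.source).norm
    have ic : ∀ n, IntegrableOn (fun _ : ℝ => ‖c‖ * d n) (Ioo 0 T) := fun n =>
      integrableOn_const measure_Ioo_lt_top.ne
    have i1 : ∀ n, IntegrableOn (fun t => ‖c‖ * d n + ‖S.Bstar B φ‖ * ‖S.Bstar B (zn n t) - v t‖)
      (Ioo 0 T) := fun n => (ic n).add ((iB n).const_mul _)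
    refine tendsto_integral_norm_of_le_mul_add (a := fun n t => ‖c‖ * d n
      + ‖S.Bstar B φ‖ * ‖S.Bstar B (zn n t) - v t‖ + ‖Q (S.incl φ)‖ * ‖S.incl (gn n t) - g t‖)
      (fun n => (hGni n).sub hGi) (fun n => (i1 n).add ((ig n).const_mul _)) (fun n t ht => ?_) ?_
    · rw [hGn, hG]
      have e : ∀ a b c a' b' c' : 𝕜, a - b + c - (a' - b' + c') = (a - a') - (b - b') + (c - c') := by
        intros; ring
      rw [e, ← inner_sub_right, ← inner_sub_right, ← inner_sub_right]
      refine (norm_add_le _ _).trans (add_le_add ((norm_sub_le _ _).trans (add_le_add ?_ ?_)) ?_)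
      · exact (norm_inner_le_norm _ _).trans (mul_le_mul_of_nonneg_left
          (hzd n t (Ioo_subset_Icc_self ht)) (norm_nonneg _))
      · exact norm_inner_le_norm _ _
      · exact norm_inner_le_norm _ _
    · have e : ∀ n, ∫ t in Ioo 0 T, (‖c‖ * d n + ‖S.Bstar B φ‖ * ‖S.Bstar B (zn n t) - v t‖
          + ‖Q (S.incl φ)‖ * ‖S.incl (gn n t) - g t‖) = volume.real (Ioo 0 T) * (‖c‖ * d n)
          + ‖S.Bstar B φ‖ * (∫ t in Ioo 0 T, ‖S.Bstar B (zn n t) - v t‖)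
          + ‖Q (S.incl φ)‖ * ∫ t in Ioo 0 T, ‖S.incl (gn n t) - g t‖ := by
        intro n
        rw [integral_add (i1 n) ((ig n).const_mul _), integral_add (ic n) ((iB n).const_mul _),
          setIntegral_const, smul_eq_mul, integral_const_mul, integral_const_mul]
      simp only [e]
      simpa using (((hd0.const_mul ‖c‖).const_mul (volume.real (Ioo 0 T))).add
        (hB1.const_mul ‖S.Bstar B φ‖)).add (h1.const_mul ‖Q (S.incl φ)‖)

/-- Coercivity and boundedness of Q turn energy decay into norm decay, with a constant independent
of T. For z₀ = 0 it is also the uniqueness statement. -/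
theorem IsRiccatiTriple.exists_norm_le_exp {S : C0Group 𝕜 H} {B : U →L[𝕜] S.DAdjDual}
    {lam : ℝ} {Q : H ≃L[𝕜] H} {R : H →L[𝕜] H}
    (hQ : S.IsRiccatiTriple B lam Q R (ContinuousLinearMap.id 𝕜 U)) :
    ∃ C : ℝ, 0 < C ∧ ∀ (T : ℝ) (z₀ : H) (z : ℝ → H),
      S.IsAdjointWeakSolution T z₀ (fun t => -((2 * (lam : 𝕜)) • z t) - R (Q (z t))) z →
      ∀ t ∈ Icc 0 T, ‖z t‖ ≤ C * Real.exp (-lam * t) * ‖z₀‖ := by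
  obtain ⟨c, hc, hcoer⟩ := hQ.Q_coercive
  set q := ‖(Q : H →L[𝕜] H)‖ with hq
  refine ⟨Real.sqrt ((q + 1) / c), Real.sqrt_pos.2 (by positivity), fun T z₀ z h t ht => ?_⟩
  have h1 := hQ.decay h ht
  have h2 : RCLike.re (inner 𝕜 (Q z₀) z₀) ≤ (q + 1) * ‖z₀‖ ^ 2 := by
    have e1 := (RCLike.re_le_norm _).trans (norm_inner_le_norm (𝕜 := 𝕜) (Q z₀) z₀)
    have e2 : ‖Q z₀‖ ≤ q * ‖z₀‖ := (Q : H →L[𝕜] H).le_opNorm z₀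
    nlinarith [norm_nonneg z₀, mul_le_mul_of_nonneg_right e2 (norm_nonneg z₀)]
  have h3 := hcoer (z t)
  refine le_of_sq_le_sq ?_ (by positivity)
  rw [mul_pow, mul_pow, Real.sq_sqrt (by positivity), ← Real.exp_nat_mul]
  have e : ((2 : ℕ) : ℝ) * (-lam * t) = -(2 * lam * t) := by push_cast; ring
  rw [e, Real.exp_neg]
  have h4 : Real.exp (2 * lam * t) * (c * ‖z t‖ ^ 2) ≤ (q + 1) * ‖z₀‖ ^ 2 :=
    (mul_le_mul_of_nonneg_left h3 (Real.exp_pos _).le).trans (h1.trans h2)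
  have h5 : ‖z t‖ ^ 2 = (Real.exp (2 * lam * t) * (c * ‖z t‖ ^ 2)) / (c * Real.exp (2 * lam * t)) := by
    field_simp
  rw [h5, show (q + 1) / c * (Real.exp (2 * lam * t))⁻¹ * ‖z₀‖ ^ 2
    = ((q + 1) * ‖z₀‖ ^ 2) / (c * Real.exp (2 * lam * t)) by field_simp]
  gcongr

/-- A Riccati triple with `W = 1` stabilizes the system. -/
theorem IsRiccatiTriple.isStaticallyStabilizable {S : C0Group 𝕜 H} {B : U →L[𝕜] S.DAdjDual}
    {lam : ℝ} {Q : H ≃L[𝕜] H} {R : H →L[𝕜] H}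
    (hQ : S.IsRiccatiTriple B lam Q R (ContinuousLinearMap.id 𝕜 U)) :
    S.IsStaticallyStabilizable B lam := by
  obtain ⟨C, hC0, hC⟩ := hQ.exists_norm_le_exp
  set q := ‖(Q : H →L[𝕜] H)‖ with hq
  set q' := ‖(Q.symm : H →L[𝕜] H)‖ with hq'
  -- The norms of Q and Q⁻¹ convert between y and z; each is increased by 1 so that the constant is
  -- positive even when H is trivial.
  refine ⟨Q, R, ContinuousLinearMap.id 𝕜 U, hQ, (q + 1) * C * (q' + 1), by positivity,
    fun y₀ => ?_⟩
  -- The costate equation is autonomous with bounded perturbation P, so it is solved first; y is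
  -- then defined as Qz.
  let P : H →L[𝕜] H := -((2 * (lam : 𝕜)) • ContinuousLinearMap.id 𝕜 H) - R ∘L (Q : H →L[𝕜] H)
  obtain ⟨z, hzc, hz⟩ := S.exists_adjointWeakSolution P (Q.symm y₀)
  have hz : ∀ T, S.IsAdjointWeakSolution T (Q.symm y₀)
    (fun t => -((2 * (lam : 𝕜)) • z t) - R (Q (z t))) z := hz
  have hgc : Continuous (fun t => -((2 * (lam : 𝕜)) • z t) - R (Q (z t))) := P.continuous.comp hzc
  obtain ⟨v, hv⟩ := hQ.exists_global_observation hz hgc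
  have hy : ∀ T, 0 < T → S.IsWeakSolution B T y₀ (fun t => -(ContinuousLinearMap.id 𝕜 U) (v t))
      (fun t => Q (z t)) := by
    intro T hT
    have := hQ.isWeakSolution hT.le (hz T) (hv T hT)
    rwa [Q.apply_symm_apply] at this
  refine ⟨fun t => Q (z t), z, v, fun T hT => ⟨hz T, hv T hT, hy T hT⟩,
    fun T hT y' z' v' h' => ?_, fun t _ => (Q.symm_apply_apply _).symm, fun t ht => ?_⟩
  -- The difference of two costates solves the same linear equation with zero initial value, so the
  -- decay bound makes it vanish.
  · have ez : EqOn z' z (Icc 0 T) := by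
      intro t ht
      have hd := h'.costate.sub (hz T)
      rw [sub_self] at hd
      have hd' : S.IsAdjointWeakSolution T 0
          (fun t => -((2 * (lam : 𝕜)) • (z' t - z t)) - R (Q (z' t - z t)))
          (fun t => z' t - z t) := by
        refine hd.congr (funext fun t => ?_)
        rw [map_sub, map_sub, smul_sub]
        abel
      have := hC T 0 _ hd' t ht
      rw [norm_zero, mul_zero] at this
      exact sub_eq_zero.1 (norm_le_zero_iff.1 this)
    have eg : EqOn (fun t => -((2 * (lam : 𝕜)) • z' t) - R (Q (z' t)))
        (fun t => -((2 * (lam : 𝕜)) • z t) - R (Q (z t))) (Ioo 0 T) := fun t ht => by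
      simp only [ez (Ioo_subset_Icc_self ht)]
    have ev : v' =ᵐ[volume.restrict (Ioo 0 T)] v :=
      hQ.observation_unique hT.le h'.observation (hv T hT) (ez ⟨le_rfl, hT.le⟩) eg
        h'.costate.source
    refine ⟨h'.state.eqOn (hy T hT) ?_, ez, ev⟩
    filter_upwards [ev] with t ht
    rw [ht]
  · have h1 := hC t _ z (hz t) t ⟨ht, le_rfl⟩
    have h2 : ‖Q (z t)‖ ≤ q * ‖z t‖ := (Q : H →L[𝕜] H).le_opNorm _
    have h3 : ‖Q.symm y₀‖ ≤ q' * ‖y₀‖ := (Q.symm : H →L[𝕜] H).le_opNorm _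
    calc ‖Q (z t)‖ ≤ (q + 1) * ‖z t‖ := h2.trans (by gcongr; linarith)
      _ ≤ (q + 1) * (C * Real.exp (-lam * t) * ((q' + 1) * ‖y₀‖)) := by
          gcongr
          refine h1.trans ?_
          gcongr
          exact h3.trans (by gcongr; linarith)
      _ = _ := by ring

end C0Group

end

theorem mainTheorem9 {𝕜 H U : Type*} [RCLike 𝕜]
    [NormedAddCommGroup H] [InnerProductSpace 𝕜 H] [CompleteSpace H]
    [NormedAddCommGroup U] [InnerProductSpace 𝕜 U] [CompleteSpace U]
    (S : C0Group 𝕜 H) (B : U →L[𝕜] S.DAdjDual) (hB : S.IsAdmissible B)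
    (hC : ∃ T : ℝ, 0 < T ∧ S.IsExactlyControllable B T) :
    S.IsRapidlyStaticallyStabilizable B := by
  -- Time derivatives and integrals use the real structure obtained by restricting scalars.
  let _ : NormedSpace ℝ H := NormedSpace.restrictScalars ℝ 𝕜 H
  have _ : IsScalarTower ℝ 𝕜 H := RestrictScalars.isScalarTower ℝ 𝕜 H
  intro lam hlam
  obtain ⟨Q, R, hQ⟩ := C0Group.exists_isRiccatiTriple S B hB hC lam hlam
  exact hQ.isStaticallyStabilizable
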